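/- Let $\omega$ be a non-principal ultrafilter on $\mathbb{N}$. Let $\mathrm{Sym}_n$ be the symmetric group on $n$ points with the normalized Hamming distance $d_n(\sigma,\rho)=\frac1n|\{i:\sigma(i)\ne\rho(i)\}|$, and let $$\mathcal{S}=\prod_{n\to\omega}(\mathrm{Sym}_n,d_n)=\prod_n \mathrm{Sym}_n\Big/\Big\{(g_n)_n:\lim_{n\to\omega}d_n(g_n,1)=0\Big\}$$ be the corresponding universal sofic group. Let $\mathrm{tr}(A)=\frac1n\sum_{j}A_{jj}$ on $M_n(\mathbb{C})$, and let $\mathcal{M}=\prod_{n\to\omega}(M_n(\mathbb{C}),\mathrm{tr})$ be the tracial ultraproduct, i.e. the operator-norm bounded sequences modulo those with $\lim_{n\to\omega}\mathrm{tr}(x_n^*x_n)=0$, with its trace $\tau((x_n)_{n\to\omega})=\lim_{n\to\omega}\mathrm{tr}(x_n)$, acting by left multiplication on the Hilbert space completion $L^2(\mathcal{M})$ of $\mathcal{M}$ for the inner product $\langle x,y\rangle=\tau(y^*x)$. Regard $\mathcal{S}$ as a group of unitaries of $\mathcal{M}$ via permutation matrices, and let $W^*(\mathcal{S})$ be the von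 Neumann algebra generated by $\mathcal{S}$, i.e. the smallest unital $*$-subalgebra of $B(L^2(\mathcal{M}))$ that contains $\mathcal{S}$ and is closed in the weak operator topology (WOT), with the trace $\tau(T)=\langle T\hat 1,\hat 1\rangle$. Let $L^\infty(\mathcal{L})=\prod_{n\to\omega}D_n(\mathbb{C})\subseteq\mathcal{M}$ be the Loeb algebra, which consists of the classes of the bounded sequences of diagonal matrices. Then: 1. For every projection $p\in L^\infty(\mathcal{L})$ there is an element $\psi\in\mathcal{S}$ such that $\psi^k\to p$ in the WOT as $k\to\infty$. 2. $L^\infty(\mathcal{L})\subseteq W^*(\mathcal{S})$. 3. For every group automorphism $\Phi$ of $\mathcal{S}$ there is a $*$-automorphism $\Phi_*$ of $W^*(\mathcal{S})$ that is normal (WOT-continuous on the unit ball), preserves $\tau$ and satisfies $\Phi_*|_{\mathcal{S}}=\Phi$. It is the only trace-preserving $*$-homomorphism $W^*(\mathcal{S})\to W^*(\mathcal{S})$ that extends $\Phi$. Moreover $\Phi_*(L^\infty(\mathcal{L}))=L^\infty(\mathcal{L})$. -/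

import Mathlib

namespace UniversalSofic

open Filter Topology
open scoped Matrix.Norms.L2Operator InnerProductSpace

/-! ## The universal sofic group -/

/-- The normalized Hamming distance on the symmetric group of `n` points. -/
noncomputable def hamming {n : ℕ} (σ ρ : Equiv.Perm (Fin n)) : ℝ :=
  (hammingDist (σ : Fin n → Fin n) (ρ : Fin n → Fin n) : ℝ) / n

theorem hamming_nonneg {n : ℕ} (σ ρ : Equiv.Perm (Fin n)) : 0 ≤ hamming σ ρ := by
  unfold hamming; positivity

theorem hamming_mul_left {n : ℕ} (τ σ ρ : Equiv.Perm (Fin n)) :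
    hamming (τ * σ) (τ * ρ) = hamming σ ρ := by
  simp [hamming, hammingDist]

theorem hamming_mul_right {n : ℕ} (σ ρ τ : Equiv.Perm (Fin n)) :
    hamming (σ * τ) (ρ * τ) = hamming σ ρ := by
  have h : hammingDist ((σ * τ : Equiv.Perm (Fin n)) : Fin n → Fin n)
      ((ρ * τ : Equiv.Perm (Fin n)) : Fin n → Fin n)
      = hammingDist (σ : Fin n → Fin n) (ρ : Fin n → Fin n) := by
    unfold hammingDist
    refine Finset.card_bij (fun i _ => τ i) ?_ ?_ ?_
    · intro a ha
      rw [Finset.mem_filter] at ha ⊢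
      exact ⟨Finset.mem_univ _, ha.2⟩
    · intro a _ b _ h
      exact τ.injective h
    · intro b hb
      refine ⟨τ.symm b, ?_, by simp⟩
      rw [Finset.mem_filter] at hb ⊢
      exact ⟨Finset.mem_univ _, by simpa using hb.2⟩
  unfold hamming
  rw [h]

theorem hamming_triangle {n : ℕ} (σ ρ τ : Equiv.Perm (Fin n)) :
    hamming σ τ ≤ hamming σ ρ + hamming ρ τ := by
  unfold hamming
  rw [← add_div]
  gcongr
  exact_mod_cast hammingDist_triangle _ _ _

theorem hamming_comm {n : ℕ} (σ ρ : Equiv.Perm (Fin n)) : hamming σ ρ = hamming ρ σ := by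
  unfold hamming
  rw [hammingDist_comm]

theorem hamming_self {n : ℕ} (σ : Equiv.Perm (Fin n)) : hamming σ σ = 0 := by
  simp [hamming]

/-- The normal subgroup of the sequences of permutations that converge to the identity along `ω`
in the normalized Hamming distance. -/
noncomputable def nullPerms (ω : Ultrafilter ℕ) : Subgroup (∀ n : ℕ, Equiv.Perm (Fin n)) where
  carrier := {g | Tendsto (fun n => hamming (g n) 1) (ω : Filter ℕ) (𝓝 0)}
  one_mem' := by
    simp [hamming_self]
  mul_mem' := by
    intro a b ha hb
    have h := Tendsto.add ha hb
    rw [add_zero] at h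
    refine squeeze_zero (fun n => hamming_nonneg _ _) (fun n => ?_) h
    have h1 := hamming_triangle (a n * b n) (a n) 1
    have h2 := hamming_mul_left (a n) (b n) 1
    rw [mul_one] at h2
    rw [h2, add_comm] at h1
    exact h1
  inv_mem' := by
    intro a ha
    refine Tendsto.congr (fun n => ?_) ha
    have h := hamming_mul_left (a n) (a n)⁻¹ 1
    rw [mul_inv_cancel, mul_one, hamming_comm] at h
    exact h

instance nullPerms_normal (ω : Ultrafilter ℕ) : (nullPerms ω).Normal where
  conj_mem := by
    intro a ha g
    refine Tendsto.congr (fun n => ?_) ha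
    have h := hamming_mul_right (g n * a n) (g n * 1) (g n)⁻¹
    rw [hamming_mul_left, mul_one, mul_inv_cancel] at h
    exact h.symm

/-- The universal sofic group `𝒮 = ∏_{n → ω} (Sym_n, d_n)`. -/
abbrev SoficGroup (ω : Ultrafilter ℕ) : Type :=
  (∀ n : ℕ, Equiv.Perm (Fin n)) ⧸ nullPerms ω

/-! ## Bounded sequences of matrices and the tracial ultraproduct -/

theorem norm_one_le (n : ℕ) : ‖(1 : Matrix (Fin n) (Fin n) ℂ)‖ ≤ 1 := by
  rw [← Matrix.permMatrix_one]
  exact Matrix.permMatrix_l2_opNorm_le _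

/-- The ⋆-algebra of sequences `(x_n)` with `x_n ∈ M_n(ℂ)` and `sup_n ‖x_n‖ < ∞` (operator norm). -/
noncomputable def BddSeq : StarSubalgebra ℂ (∀ n : ℕ, Matrix (Fin n) (Fin n) ℂ) where
  carrier := {x | ∃ C : ℝ, ∀ n, ‖x n‖ ≤ C}
  mul_mem' := by
    rintro a b ⟨C, hC⟩ ⟨D, hD⟩
    refine ⟨C * D, fun n => (norm_mul_le _ _).trans ?_⟩
    exact mul_le_mul (hC n) (hD n) (norm_nonneg _) ((norm_nonneg _).trans (hC n))
  add_mem' := by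
    rintro a b ⟨C, hC⟩ ⟨D, hD⟩
    exact ⟨C + D, fun n => (norm_add_le _ _).trans (add_le_add (hC n) (hD n))⟩
  algebraMap_mem' := by
    intro r
    refine ⟨‖r‖ * 1, fun n => ?_⟩
    rw [Pi.algebraMap_apply, Algebra.algebraMap_eq_smul_one]
    refine (norm_smul_le _ _).trans ?_
    exact mul_le_mul_of_nonneg_left (norm_one_le n) (norm_nonneg _)
  star_mem' := by
    rintro a ⟨C, hC⟩
    exact ⟨C, fun n => by rw [Pi.star_apply, norm_star]; exact hC n⟩

/-- The normalized trace on `M_n(ℂ)`. -/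
noncomputable def ntr {n : ℕ} (A : Matrix (Fin n) (Fin n) ℂ) : ℂ :=
  (∑ j, A j j) / n

theorem norm_entry_le {n : ℕ} (A : Matrix (Fin n) (Fin n) ℂ) (i j : Fin n) : ‖A i j‖ ≤ ‖A‖ := by
  have h := A.l2_opNorm_mulVec (EuclideanSpace.single j 1)
  rw [EuclideanSpace.single, PiLp.norm_single, norm_one, mul_one] at h
  refine le_trans ?_ h
  have h2 := EuclideanSpace.norm_eq (WithLp.toLp 2 (A.mulVec (Pi.single j 1)))
  refine le_trans ?_ (PiLp.norm_apply_le _ i)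
  simp

theorem norm_ntr_le {n : ℕ} (A : Matrix (Fin n) (Fin n) ℂ) : ‖ntr A‖ ≤ ‖A‖ := by
  unfold ntr
  rcases Nat.eq_zero_or_pos n with h | h
  · subst h
    simp
  · have hn : (0 : ℝ) < n := by exact_mod_cast h
    rw [norm_div, Complex.norm_natCast, div_le_iff₀ hn]
    refine (norm_sum_le _ _).trans ?_
    refine (Finset.sum_le_card_nsmul _ _ ‖A‖ (fun i _ => norm_entry_le A i i)).trans ?_
    simp [mul_comm]

theorem ntr_add {n : ℕ} (A B : Matrix (Fin n) (Fin n) ℂ) : ntr (A + B) = ntr A + ntr B := by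
  simp [ntr, Finset.sum_add_distrib, add_div]

theorem ntr_smul {n : ℕ} (c : ℂ) (A : Matrix (Fin n) (Fin n) ℂ) : ntr (c • A) = c * ntr A := by
  simp [ntr, ← Finset.mul_sum, mul_div_assoc]

theorem ntr_star {n : ℕ} (A : Matrix (Fin n) (Fin n) ℂ) :
    ntr (star A) = (starRingEnd ℂ) (ntr A) := by
  simp [ntr, Matrix.star_apply]

/-- `tr (A* A)` is `1/n` times the sum of the squared norms of the columns of `A`. -/
theorem ntr_star_mul_self {n : ℕ} (A : Matrix (Fin n) (Fin n) ℂ) :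
    ntr (star A * A) = (((∑ j, ‖WithLp.toLp 2 (fun i => A i j)‖ ^ 2) / n : ℝ) : ℂ) := by
  unfold ntr
  push_cast
  congr 1
  refine Finset.sum_congr rfl (fun j _ => ?_)
  rw [← Complex.ofReal_pow, EuclideanSpace.norm_sq_eq]
  push_cast
  rw [Matrix.mul_apply]
  refine Finset.sum_congr rfl (fun i _ => ?_)
  rw [Matrix.star_apply]
  exact RCLike.conj_mul _

theorem ntr_star_mul_self_re_nonneg {n : ℕ} (A : Matrix (Fin n) (Fin n) ℂ) :
    0 ≤ (ntr (star A * A)).re := by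
  rw [ntr_star_mul_self, Complex.ofReal_re]
  positivity

theorem ntr_star_mul_self_im {n : ℕ} (A : Matrix (Fin n) (Fin n) ℂ) :
    (ntr (star A * A)).im = 0 := by
  rw [ntr_star_mul_self, Complex.ofReal_im]

theorem ntr_mul_le {n : ℕ} (A B : Matrix (Fin n) (Fin n) ℂ) :
    (ntr (star (A * B) * (A * B))).re ≤ ‖A‖ ^ 2 * (ntr (star B * B)).re := by
  rw [ntr_star_mul_self, ntr_star_mul_self, Complex.ofReal_re, Complex.ofReal_re, ← mul_div_assoc,
    Finset.mul_sum]
  gcongr with j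
  rw [← mul_pow]
  have h := A.l2_opNorm_mulVec (WithLp.toLp 2 (fun i => B i j))
  exact pow_le_pow_left₀ (norm_nonneg _) h 2

/-- The trace `τ((x_n)_ω) = lim_{n → ω} tr(x_n)` on bounded sequences; the limit exists by
`tendsto_traceLim`. -/
noncomputable def traceLim (ω : Ultrafilter ℕ) (x : BddSeq) : ℂ :=
  limUnder (ω : Filter ℕ) (fun n => ntr (x.1 n))

theorem tendsto_traceLim (ω : Ultrafilter ℕ) (x : BddSeq) :
    Tendsto (fun n => ntr (x.1 n)) (ω : Filter ℕ) (𝓝 (traceLim ω x)) := by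
  obtain ⟨C, hC⟩ := x.2
  refine tendsto_nhds_limUnder ?_
  obtain ⟨a, -, ha⟩ := (isCompact_closedBall (0 : ℂ) C).ultrafilter_le_nhds
    (ω.map (fun n => ntr (x.1 n))) (by
      rw [Ultrafilter.coe_map, le_principal_iff, mem_map]
      refine Filter.univ_mem' (fun n => ?_)
      simpa using (norm_ntr_le _).trans (hC n))
  exact ⟨a, ha⟩

theorem traceLim_eq {ω : Ultrafilter ℕ} {x : BddSeq} {a : ℂ}
    (h : Tendsto (fun n => ntr (x.1 n)) (ω : Filter ℕ) (𝓝 a)) : traceLim ω x = a :=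
  tendsto_nhds_unique (tendsto_traceLim ω x) h

theorem traceLim_add (ω : Ultrafilter ℕ) (x y : BddSeq) :
    traceLim ω (x + y) = traceLim ω x + traceLim ω y :=
  traceLim_eq (((tendsto_traceLim ω x).add (tendsto_traceLim ω y)).congr
    (fun n => (ntr_add (x.1 n) (y.1 n)).symm))

theorem traceLim_smul (ω : Ultrafilter ℕ) (c : ℂ) (x : BddSeq) :
    traceLim ω (c • x) = c * traceLim ω x :=
  traceLim_eq (((tendsto_traceLim ω x).const_mul c).congr
    (fun n => (ntr_smul c (x.1 n)).symm))

theorem traceLim_star (ω : Ultrafilter ℕ) (x : BddSeq) :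
    traceLim ω (star x) = (starRingEnd ℂ) (traceLim ω x) :=
  traceLim_eq ((Complex.continuous_conj.tendsto _ |>.comp (tendsto_traceLim ω x)).congr
    (fun n => (ntr_star (x.1 n)).symm))

theorem traceLim_star_mul_self_re (ω : Ultrafilter ℕ) (x : BddSeq) :
    Tendsto (fun n => (ntr (star (x.1 n) * x.1 n)).re) (ω : Filter ℕ)
      (𝓝 (traceLim ω (star x * x)).re) :=
  (Complex.continuous_re.tendsto _).comp (tendsto_traceLim ω (star x * x))

/-- The bounded sequences, regarded as a pre-Hilbert space with the semi-inner product
`⟪x, y⟫ = τ(x* y)`. This is a type synonym of `BddSeq`. -/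
def PreL2 (_ω : Ultrafilter ℕ) : Type := BddSeq

noncomputable instance (ω : Ultrafilter ℕ) : AddCommGroup (PreL2 ω) :=
  inferInstanceAs (AddCommGroup BddSeq)

noncomputable instance (ω : Ultrafilter ℕ) : Module ℂ (PreL2 ω) :=
  inferInstanceAs (Module ℂ BddSeq)

/-- The identity map from bounded sequences to the pre-Hilbert space. -/
noncomputable def toPreL2 (ω : Ultrafilter ℕ) : BddSeq ≃ₗ[ℂ] PreL2 ω := LinearEquiv.refl ℂ _

/-- The semi-inner product `⟪x, y⟫ = τ(x* y)`, linear in `y`. -/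
noncomputable abbrev preL2Core (ω : Ultrafilter ℕ) : PreInnerProductSpace.Core ℂ (PreL2 ω) where
  inner x y := traceLim ω (star ((toPreL2 ω).symm x) * (toPreL2 ω).symm y)
  conj_inner_symm x y := by
    rw [← traceLim_star, star_mul, star_star]
  re_inner_nonneg x :=
    ge_of_tendsto' (traceLim_star_mul_self_re ω ((toPreL2 ω).symm x))
      (fun n => ntr_star_mul_self_re_nonneg _)
  add_left x y z := by
    rw [map_add, star_add, add_mul, traceLim_add]
  smul_left x y r := by
    rw [map_smul, star_smul, smul_mul_assoc, traceLim_smul]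
    rfl

noncomputable instance (ω : Ultrafilter ℕ) : SeminormedAddCommGroup (PreL2 ω) :=
  InnerProductSpace.Core.toSeminormedAddCommGroup (c := preL2Core ω)

noncomputable instance (ω : Ultrafilter ℕ) : InnerProductSpace ℂ (PreL2 ω) :=
  InnerProductSpace.ofCore (preL2Core ω)

theorem preL2_inner (ω : Ultrafilter ℕ) (x y : BddSeq) :
    ⟪toPreL2 ω x, toPreL2 ω y⟫_ℂ = traceLim ω (star x * y) := rfl

theorem preL2_norm_sq (ω : Ultrafilter ℕ) (x : BddSeq) :
    ‖toPreL2 ω x‖ ^ 2 = (traceLim ω (star x * x)).re := by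
  rw [← preL2_inner, ← inner_self_eq_norm_sq (𝕜 := ℂ)]
  rfl

/-- The Hilbert space `L²(ℳ)` of the tracial ultraproduct `ℳ = ∏_{n → ω} (M_n(ℂ), tr)`
(the completion identifies sequences at distance zero in the `2`-norm). -/
abbrev L2 (ω : Ultrafilter ℕ) : Type := UniformSpace.Completion (PreL2 ω)

/-- The vector `1̂` of `L²(ℳ)`. -/
noncomputable def oneVec (ω : Ultrafilter ℕ) : L2 ω := ((toPreL2 ω 1 : PreL2 ω) : L2 ω)

theorem norm_mul_le_preL2 (ω : Ultrafilter ℕ) (x y : BddSeq) {C : ℝ} (hC : ∀ n, ‖x.1 n‖ ≤ C) :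
    ‖toPreL2 ω (x * y)‖ ≤ C * ‖toPreL2 ω y‖ := by
  have hC0 : 0 ≤ C := (norm_nonneg _).trans (hC 0)
  refine le_of_sq_le_sq ?_ (by positivity)
  rw [mul_pow, preL2_norm_sq, preL2_norm_sq]
  refine le_of_tendsto_of_tendsto' (traceLim_star_mul_self_re ω (x * y))
    ((traceLim_star_mul_self_re ω y).const_mul (C ^ 2)) (fun n => ?_)
  refine (ntr_mul_le (x.1 n) (y.1 n)).trans ?_
  exact mul_le_mul_of_nonneg_right (pow_le_pow_left₀ (norm_nonneg _) (hC n) 2)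
    (ntr_star_mul_self_re_nonneg _)

/-- Left multiplication by a bounded sequence, on the pre-Hilbert space. -/
noncomputable def leftMulPre (ω : Ultrafilter ℕ) (x : BddSeq) : PreL2 ω →L[ℂ] PreL2 ω :=
  ((toPreL2 ω).toLinearMap ∘ₗ LinearMap.mulLeft ℂ x ∘ₗ (toPreL2 ω).symm.toLinearMap).mkContinuousOfExistsBound
    (by
      obtain ⟨C, hC⟩ := x.2
      exact ⟨C, fun y => norm_mul_le_preL2 ω x ((toPreL2 ω).symm y) hC⟩)

theorem leftMulPre_apply (ω : Ultrafilter ℕ) (x y : BddSeq) :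
    leftMulPre ω x (toPreL2 ω y) = toPreL2 ω (x * y) := rfl

theorem clm_ext {ω : Ultrafilter ℕ} {S T : L2 ω →L[ℂ] L2 ω}
    (h : ∀ y : BddSeq, S ((toPreL2 ω y : PreL2 ω) : L2 ω) = T ((toPreL2 ω y : PreL2 ω) : L2 ω)) :
    S = T := by
  ext z
  induction z using UniformSpace.Completion.induction_on with
  | hp => exact isClosed_eq S.continuous T.continuous
  | ih z => exact h ((toPreL2 ω).symm z)

/-- The operator of left multiplication by a bounded sequence on `L²(ℳ)`. -/
noncomputable def leftMulFun (ω : Ultrafilter ℕ) (x : BddSeq) : L2 ω →L[ℂ] L2 ω :=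
  (leftMulPre ω x).completion

theorem leftMulFun_coe (ω : Ultrafilter ℕ) (x y : BddSeq) :
    leftMulFun ω x ((toPreL2 ω y : PreL2 ω) : L2 ω) = ((toPreL2 ω (x * y) : PreL2 ω) : L2 ω) := by
  rw [leftMulFun, ContinuousLinearMap.completion_apply_coe, leftMulPre_apply]

theorem leftMulFun_add (ω : Ultrafilter ℕ) (x y : BddSeq) :
    leftMulFun ω (x + y) = leftMulFun ω x + leftMulFun ω y :=
  clm_ext fun z => by
    rw [_root_.add_apply, leftMulFun_coe, leftMulFun_coe, leftMulFun_coe, add_mul,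
      map_add, UniformSpace.Completion.coe_add]

theorem leftMulFun_mul (ω : Ultrafilter ℕ) (x y : BddSeq) :
    leftMulFun ω (x * y) = leftMulFun ω x * leftMulFun ω y :=
  clm_ext fun z => by
    rw [_root_.mul_apply_eq_comp, leftMulFun_coe, leftMulFun_coe, leftMulFun_coe, mul_assoc]

theorem leftMulFun_algebraMap (ω : Ultrafilter ℕ) (c : ℂ) :
    leftMulFun ω (algebraMap ℂ BddSeq c) = algebraMap ℂ (L2 ω →L[ℂ] L2 ω) c :=
  clm_ext fun z => by
    rw [leftMulFun_coe, Algebra.algebraMap_eq_smul_one, Algebra.algebraMap_eq_smul_one,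
      _root_.smul_apply, _root_.one_apply_eq_self, smul_mul_assoc, one_mul,
      map_smul, UniformSpace.Completion.coe_smul]

theorem leftMulFun_star (ω : Ultrafilter ℕ) (x : BddSeq) :
    leftMulFun ω (star x) = star (leftMulFun ω x) := by
  rw [ContinuousLinearMap.star_eq_adjoint, ContinuousLinearMap.eq_adjoint_iff]
  intro a b
  induction a, b using UniformSpace.Completion.induction_on₂ with
  | hp => apply isClosed_eq <;> fun_prop
  | ih a b =>
    have h1 := leftMulFun_coe ω (star x) ((toPreL2 ω).symm a)
    have h2 := leftMulFun_coe ω x ((toPreL2 ω).symm b)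
    rw [LinearEquiv.apply_symm_apply] at h1 h2
    rw [h1, h2, UniformSpace.Completion.inner_coe, UniformSpace.Completion.inner_coe]
    change traceLim ω (star (star x * (toPreL2 ω).symm a) * (toPreL2 ω).symm b)
      = traceLim ω (star ((toPreL2 ω).symm a) * (x * (toPreL2 ω).symm b))
    rw [star_mul, star_star, mul_assoc]

/-- The representation of the bounded sequences on `L²(ℳ)` by left multiplication. Its kernel
consists of the sequences that vanish along `ω` in the `2`-norm (`leftMul_eq_zero_iff`), so that
`leftMul ω x` is the class `(x_n)_{n → ω}` of `x` in the ultraproduct `ℳ`, in its standard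
representation. -/
noncomputable def leftMul (ω : Ultrafilter ℕ) : BddSeq →⋆ₐ[ℂ] (L2 ω →L[ℂ] L2 ω) where
  toFun := leftMulFun ω
  map_one' := by
    have h := leftMulFun_algebraMap ω 1
    rwa [map_one, map_one] at h
  map_mul' := leftMulFun_mul ω
  map_zero' := by
    have h := leftMulFun_algebraMap ω 0
    rwa [map_zero, map_zero] at h
  map_add' := leftMulFun_add ω
  commutes' := leftMulFun_algebraMap ω
  map_star' := leftMulFun_star ω

theorem leftMul_coe (ω : Ultrafilter ℕ) (x y : BddSeq) :
    leftMul ω x ((toPreL2 ω y : PreL2 ω) : L2 ω) = ((toPreL2 ω (x * y) : PreL2 ω) : L2 ω) :=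
  leftMulFun_coe ω x y

/-- The square of the `2`-norm on `M_n(ℂ)`. -/
noncomputable def normTwoSq {n : ℕ} (A : Matrix (Fin n) (Fin n) ℂ) : ℝ := (ntr (star A * A)).re

theorem ntr_mul_comm {n : ℕ} (A B : Matrix (Fin n) (Fin n) ℂ) : ntr (A * B) = ntr (B * A) := by
  have h : ∀ X : Matrix (Fin n) (Fin n) ℂ, ntr X = X.trace / n := fun _ => rfl
  rw [h, h, Matrix.trace_mul_comm]

theorem traceLim_mul_comm (ω : Ultrafilter ℕ) (x y : BddSeq) :
    traceLim ω (x * y) = traceLim ω (y * x) :=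
  traceLim_eq ((tendsto_traceLim ω (y * x)).congr (fun n => ntr_mul_comm (y.1 n) (x.1 n)))

theorem preL2_norm_star (ω : Ultrafilter ℕ) (x : BddSeq) :
    ‖toPreL2 ω (star x)‖ = ‖toPreL2 ω x‖ := by
  have h : ‖toPreL2 ω (star x)‖ ^ 2 = ‖toPreL2 ω x‖ ^ 2 := by
    rw [preL2_norm_sq, preL2_norm_sq, star_star, traceLim_mul_comm]
  exact (pow_left_inj₀ (norm_nonneg _) (norm_nonneg _) two_ne_zero).1 h

theorem leftMul_eq_zero_iff (ω : Ultrafilter ℕ) (x : BddSeq) :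
    leftMul ω x = 0 ↔ Tendsto (fun n => normTwoSq (x.1 n)) (ω : Filter ℕ) (𝓝 0) := by
  have key : Tendsto (fun n => normTwoSq (x.1 n)) (ω : Filter ℕ) (𝓝 0)
      ↔ ‖toPreL2 ω x‖ = 0 := by
    rw [← sq_eq_zero_iff, preL2_norm_sq]
    refine ⟨fun h => tendsto_nhds_unique (traceLim_star_mul_self_re ω x) h, fun h => ?_⟩
    rw [← h]
    exact traceLim_star_mul_self_re ω x
  rw [key]
  constructor
  · intro h
    have h1 := leftMul_coe ω x 1
    rw [h, mul_one, _root_.zero_apply] at h1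
    rw [← UniformSpace.Completion.norm_coe, ← h1, norm_zero]
  · intro h
    refine clm_ext fun y => ?_
    rw [leftMul_coe, _root_.zero_apply, ← norm_eq_zero,
      UniformSpace.Completion.norm_coe, ← preL2_norm_star, star_mul]
    obtain ⟨C, hC⟩ := (star y).2
    have h2 := norm_mul_le_preL2 ω (star y) (star x) hC
    rw [preL2_norm_star ω x, h, mul_zero] at h2
    exact le_antisymm h2 (norm_nonneg _)

/-- The trace `T ↦ ⟪1̂, T 1̂⟫` on operators of `L²(ℳ)`; on the class of a bounded sequence it is
the limit along `ω` of the normalized traces (`trace_leftMul`). -/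
noncomputable def trace (ω : Ultrafilter ℕ) (T : L2 ω →L[ℂ] L2 ω) : ℂ :=
  ⟪oneVec ω, T (oneVec ω)⟫_ℂ

theorem trace_leftMul (ω : Ultrafilter ℕ) (x : BddSeq) :
    trace ω (leftMul ω x) = traceLim ω x := by
  rw [trace, oneVec, leftMul_coe, UniformSpace.Completion.inner_coe, preL2_inner, star_one,
    one_mul, mul_one]

/-- The Loeb algebra `L^∞(ℒ) = ∏_{n → ω} D_n(ℂ)`: the classes in `ℳ` of the bounded sequences of
diagonal matrices. -/
noncomputable def loebAlgebra (ω : Ultrafilter ℕ) : StarSubalgebra ℂ (L2 ω →L[ℂ] L2 ω) :=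
  StarSubalgebra.map (leftMul ω)
    { carrier := {x : BddSeq | ∀ n, (x.1 n).IsDiag}
      mul_mem' := by
        intro a b ha hb n i j hij
        change (a.1 n * b.1 n) i j = 0
        rw [← (ha n).diagonal_diag, ← (hb n).diagonal_diag, Matrix.diagonal_mul_diagonal]
        exact Matrix.diagonal_apply_ne _ hij
      add_mem' := by
        intro a b ha hb n
        exact (ha n).add (hb n)
      algebraMap_mem' := by
        intro r n
        change (algebraMap ℂ (Matrix (Fin n) (Fin n) ℂ) r).IsDiag
        rw [Matrix.algebraMap_eq_diagonal]
        exact Matrix.isDiag_diagonal _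
      star_mem' := by
        intro a ha n
        exact (ha n).conjTranspose }

/-! ## The embedding of the universal sofic group -/

/-- The bounded sequence of permutation matrices of a sequence of permutations; the matrix of `σ`
maps the basis vector `e_j` to `e_{σ j}`. -/
noncomputable def permSeq : (∀ n : ℕ, Equiv.Perm (Fin n)) →* BddSeq where
  toFun g := ⟨fun n => Matrix.permMatrixHom (R := ℂ) (g n),
    ⟨1, fun n => Matrix.permMatrix_l2_opNorm_le _⟩⟩
  map_one' := by
    apply Subtype.ext
    funext n
    exact map_one _
  map_mul' g h := by
    apply Subtype.ext
    funext n
    exact map_mul _ _ _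

theorem ntr_permMatrixHom {n : ℕ} (hn : n ≠ 0) (σ : Equiv.Perm (Fin n)) :
    ntr (Matrix.permMatrixHom (R := ℂ) σ) = ((1 - hamming σ 1 : ℝ) : ℂ) := by
  have hn' : (n : ℝ) ≠ 0 := by exact_mod_cast hn
  have h1 : (∑ j, Matrix.permMatrixHom (R := ℂ) σ j j)
      = ((Finset.univ.filter (fun j => σ j = j)).card : ℂ) := by
    rw [Finset.card_filter]
    push_cast
    refine Finset.sum_congr rfl (fun j _ => ?_)
    change (if j ∈ some (σ⁻¹ j) then (1 : ℂ) else 0) = _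
    have h : σ j = j ↔ j ∈ some (σ⁻¹ j) := by
      rw [Option.mem_some_iff, Equiv.Perm.inv_eq_iff_eq, eq_comm]
    simp only [h]
  have h2 : (Finset.univ.filter (fun j => σ j = j)).card
      + hammingDist (σ : Fin n → Fin n) ((1 : Equiv.Perm (Fin n)) : Fin n → Fin n) = n := by
    have h := Finset.card_filter_add_card_filter_not (s := (Finset.univ : Finset (Fin n)))
      (fun j => σ j = j)
    rw [Finset.card_univ, Fintype.card_fin] at h
    refine Eq.trans ?_ h
    congr 1
  have h3 : ((Finset.univ.filter (fun j => σ j = j)).card : ℝ)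
      = n - hammingDist (σ : Fin n → Fin n) ((1 : Equiv.Perm (Fin n)) : Fin n → Fin n) := by
    rw [eq_sub_iff_add_eq]
    exact_mod_cast h2
  have h4 : (1 - hamming σ 1 : ℝ) = ((Finset.univ.filter (fun j => σ j = j)).card : ℝ) / n := by
    rw [h3, hamming, sub_div, div_self hn']
  rw [ntr, h1, h4]
  push_cast
  rfl

theorem normTwoSq_perm_sub_one {n : ℕ} (σ : Equiv.Perm (Fin n)) :
    normTwoSq (Matrix.permMatrixHom (R := ℂ) σ - 1) = 2 * hamming σ 1 := by
  rcases Nat.eq_zero_or_pos n with h | h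
  · subst h
    simp [normTwoSq, ntr, hamming]
  · have hs : star (Matrix.permMatrixHom (R := ℂ) σ) = Matrix.permMatrixHom (R := ℂ) σ⁻¹ :=
      Matrix.conjTranspose_permMatrix _
    have hexp : star (Matrix.permMatrixHom (R := ℂ) σ - 1) * (Matrix.permMatrixHom (R := ℂ) σ - 1)
        = (Matrix.permMatrixHom (R := ℂ) 1 + Matrix.permMatrixHom (R := ℂ) 1)
          + (-1 : ℂ) • (Matrix.permMatrixHom (R := ℂ) σ⁻¹ + Matrix.permMatrixHom (R := ℂ) σ) := by
      have hm : Matrix.permMatrixHom (R := ℂ) σ⁻¹ * Matrix.permMatrixHom (R := ℂ) σ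
          = Matrix.permMatrixHom (R := ℂ) 1 := by
        rw [← map_mul, inv_mul_cancel]
      rw [star_sub, hs, star_one, sub_mul, mul_sub, mul_sub, hm, map_one, neg_one_smul]
      simp only [mul_one, one_mul]
      abel
    have hinv : hamming σ⁻¹ 1 = hamming σ 1 := by
      have h := hamming_mul_left σ σ⁻¹ 1
      rw [mul_inv_cancel, mul_one, hamming_comm] at h
      exact h.symm
    rw [normTwoSq, hexp, ntr_add, ntr_add, ntr_smul, ntr_add, ntr_permMatrixHom h.ne',
      ntr_permMatrixHom h.ne', ntr_permMatrixHom h.ne', hinv, hamming_self]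
    simp only [Complex.add_re, Complex.mul_re, Complex.ofReal_re, Complex.neg_re, Complex.one_re,
      Complex.neg_im, Complex.one_im, Complex.add_im, Complex.ofReal_im]
    ring

/-- A sequence of permutations acts trivially on `L²(ℳ)` exactly if it is null in the Hamming
distance. -/
theorem leftMul_permSeq_eq_one_iff (ω : Ultrafilter ℕ) (g : ∀ n : ℕ, Equiv.Perm (Fin n)) :
    leftMul ω (permSeq g) = 1 ↔ g ∈ nullPerms ω := by
  have h1 : leftMul ω (permSeq g) = 1 ↔ leftMul ω (permSeq g - 1) = 0 := by
    rw [map_sub, map_one, sub_eq_zero]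
  rw [h1, leftMul_eq_zero_iff]
  have h2 : (fun n => normTwoSq ((permSeq g - 1 : BddSeq).1 n)) = fun n => 2 * hamming (g n) 1 :=
    funext fun n => normTwoSq_perm_sub_one (g n)
  rw [h2]
  constructor
  · intro h
    have h3 := h.const_mul (1 / 2 : ℝ)
    rw [mul_zero] at h3
    exact h3.congr (fun n => by ring)
  · intro h
    have h3 := Tendsto.const_mul (2 : ℝ) h
    rw [mul_zero] at h3
    exact h3

/-- The embedding of the universal sofic group into (the unitary group of) `ℳ`, induced by sending
permutations to permutation matrices. -/
noncomputable def soficEmb (ω : Ultrafilter ℕ) : SoficGroup ω →* (L2 ω →L[ℂ] L2 ω) :=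
  QuotientGroup.lift (nullPerms ω) ((leftMul ω : BddSeq →* (L2 ω →L[ℂ] L2 ω)).comp permSeq)
    (fun g hg => (leftMul_permSeq_eq_one_iff ω g).2 hg)

/-! ## Von Neumann algebras -/

/-- The weak operator topology on the bounded operators of a Hilbert space. -/
@[reducible] noncomputable def wot (H : Type*) [NormedAddCommGroup H] [InnerProductSpace ℂ H] :
    TopologicalSpace (H →L[ℂ] H) :=
  TopologicalSpace.induced
    (fun T => (ContinuousLinearMapWOT.ofCLM T : H →WOT[ℂ] H)) inferInstance

/-- The von Neumann algebra `W*(E)` generated by a set `E` of bounded operators: the smallest unital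
⋆-subalgebra of `B(H)` that contains `E` and is closed in the weak operator topology. -/
noncomputable def vNGenerated {H : Type*} [NormedAddCommGroup H] [InnerProductSpace ℂ H]
    [CompleteSpace H] (E : Set (H →L[ℂ] H)) : StarSubalgebra ℂ (H →L[ℂ] H) :=
  sInf {A | E ⊆ (A : Set (H →L[ℂ] H)) ∧ IsClosed[wot H] (A : Set (H →L[ℂ] H))}

theorem subset_vNGenerated {H : Type*} [NormedAddCommGroup H] [InnerProductSpace ℂ H]
    [CompleteSpace H] (E : Set (H →L[ℂ] H)) : E ⊆ (vNGenerated E : Set (H →L[ℂ] H)) := by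
  intro x hx
  rw [SetLike.mem_coe, vNGenerated, StarSubalgebra.mem_sInf]
  exact fun A hA => hA.1 hx

theorem isClosed_vNGenerated {H : Type*} [NormedAddCommGroup H] [InnerProductSpace ℂ H]
    [CompleteSpace H] (E : Set (H →L[ℂ] H)) :
    IsClosed[wot H] (vNGenerated E : Set (H →L[ℂ] H)) := by
  rw [vNGenerated, StarSubalgebra.coe_sInf]
  let _ := wot H
  exact isClosed_biInter fun A hA => hA.2

/-- A map between von Neumann algebras `A`, `B` on `H` is *normal* if its restriction to the unit
ball of `A` is continuous for the weak operator topologies. -/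
def IsNormalMap {H : Type*} [NormedAddCommGroup H] [InnerProductSpace ℂ H] [CompleteSpace H]
    {A B : StarSubalgebra ℂ (H →L[ℂ] H)} (Θ : A → B) : Prop :=
  @ContinuousOn A B (TopologicalSpace.induced Subtype.val (wot H))
    (TopologicalSpace.induced Subtype.val (wot H)) Θ {x | ‖(x : H →L[ℂ] H)‖ ≤ 1}

/-- The von Neumann algebra `W*(𝒮)` generated by the universal sofic group. -/
noncomputable def WS (ω : Ultrafilter ℕ) : StarSubalgebra ℂ (L2 ω →L[ℂ] L2 ω) :=
  vNGenerated (Set.range (soficEmb ω))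

/-- The universal sofic group inside `W*(𝒮)`. -/
noncomputable def soficToWS (ω : Ultrafilter ℕ) (s : SoficGroup ω) : WS ω :=
  ⟨soficEmb ω s, subset_vNGenerated _ ⟨s, rfl⟩⟩

end UniversalSofic

/-!
Write `Fix A` for the projection of the Loeb algebra that is given by a sequence `A` of sets
`A n ⊆ {1, …, n}`.

*Powers.* Let `ψ` be given by a long cycle on the complement of each `A n`. For each `k ≠ 0`, the
power `ψ ^ k` moves almost all points of the complement, so that it has the same trace as `ψ`. Hence
the vectors `ψ ^ k 1̂ - Fix A 1̂` are pairwise orthogonal and of constant norm, and `ψ ^ k` converges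
weakly to `Fix A` (`exists_tendsto_pow`). As each idempotent of the Loeb algebra is some `Fix A`
(`exists_indSeq_eq`), this is the first claim. Every element of the Loeb algebra is a linear
combination of norm convergent dyadic sums of such projections (`loebAlgebra_le_span`), which gives
the second.

*Automorphisms are isometric.* The third claim rests on the fact that an automorphism `Φ` of the
group preserves the length `len s = 1 - τ(s)`, the distance to the identity (`len_map`). Two
involutions of the same length are conjugate, so the length of the image of an involution depends
only on its length. An involution of length at most `2 a` is a product of two involutions of length
`a`, as is seen already in the products of Klein four-groups that act on blocks of four points;
comparing halves in this way for `Φ` and for its inverse shows that the dependence is monotone, and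
counting disjoint involutions of lengths `1 / k` that it is the identity (`len_map_of_involution`).
For general `s`, the property that the support of `s` is contained in the support of an
involution `π` is expressed by commutation relations and by lengths of involutions
(`supportedIn`), so it is preserved by `Φ`; and `len s` is the minimum of `len π` over such `π`.

*Extension.* Thus `s 1̂ ↦ Φ s 1̂` extends to an isometry of the closed span of the vectors `s 1̂`,
with graph `graphL2 Φ`. The pairs of elements of `W*(𝒮)` whose values at `1̂` correspond to each
other form a `⋆`-algebra `graphAlg Φ`, which is a graph since `1̂` is separating. Its projections are
onto (`exists_mem_graphAlg`): a selfadjoint `x` is the limit in `L²` of selfadjoint elements of the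
span of the group; these may be unbounded in norm, but their resolvents at `-i` are contractions,
so these converge strongly on both sides; hence the resolvent of `x`, and with it `x`, has a
counterpart. This takes the place of Kaplansky's density theorem. The extension is normal as it
is spatially given on `L²` (`tendsto_inner_snd`), and any trace preserving extension is isometric
for the `2`-norm and so has the same graph (`mem_graphAlg_of_extends`). Finally, if `Fix A` is the
limit of `ψ ^ k`, its image is the limit of `Φ ψ ^ k`, whose traces are constant for `k ≠ 0` too; by
the same orthogonality it is the projection on the fixed points of `Φ ψ`
(`exists_indSeq_mem_graphAlg`). So the Loeb algebra is mapped to itself, also by the inverse.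
-/

namespace UniversalSofic

open Filter Topology
open scoped Matrix.Norms.L2Operator InnerProductSpace

/-! ### Permutations of a finite set -/

section Finite

variable {α : Type*} [DecidableEq α]

/-- Given finitely many permutations `f k`, every finite set `E` contains a subset of proportional
size none of whose points is moved by any `f k` to another point of the subset. -/
theorem exists_independent {ι : Type*} [Fintype ι] (f : ι → Equiv.Perm α) (E : Finset α) :
    ∃ I ⊆ E, (∀ k, ∀ i ∈ I, f k i ∈ I → f k i = i) ∧
      E.card ≤ (2 * Fintype.card ι + 1) * I.card := by
  classical
  let P : Finset α → Prop := fun I => ∀ k, ∀ i ∈ I, f k i ∈ I → f k i = i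
  obtain ⟨I, hI, hmax⟩ := Finset.exists_max_image (E.powerset.filter P) Finset.card
    ⟨∅, by simp [P]⟩
  rw [Finset.mem_filter, Finset.mem_powerset] at hI
  refine ⟨I, hI.1, hI.2, ?_⟩
  -- by maximality, `E` is covered by `I` and its images under the `f k` and their inverses
  have hcov : E ⊆ I ∪ Finset.univ.biUnion
      (fun k => I.image (f k) ∪ I.image (f k).symm) := by
    intro e he
    by_contra hcon
    simp only [Finset.mem_union, Finset.mem_biUnion, Finset.mem_univ, true_and, Finset.mem_image,
      not_or, not_exists, not_and] at hcon
    obtain ⟨heI, hk⟩ := hcon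
    have hins : P (insert e I) := by
      intro k i hi hfi
      rw [Finset.mem_insert] at hi hfi
      rcases hi with rfl | hi
      · rcases hfi with h | h
        · exact h
        · exact absurd ((f k).symm_apply_apply i) ((hk k).2 _ h)
      · rcases hfi with h | h
        · exact absurd h ((hk k).1 i hi)
        · exact hI.2 k i hi h
    have h := hmax (insert e I) (by
      rw [Finset.mem_filter, Finset.mem_powerset]
      exact ⟨Finset.insert_subset he hI.1, hins⟩)
    rw [Finset.card_insert_of_notMem heI] at h
    omega
  have h1 := Finset.card_le_card hcov
  have h2 := Finset.card_union_le I (Finset.univ.biUnion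
      (fun k => I.image (f k) ∪ I.image (f k).symm))
  have h3 : (Finset.univ.biUnion (fun k => I.image (f k) ∪ I.image (f k).symm)).card
      ≤ Fintype.card ι * (2 * I.card) := by
    refine Finset.card_biUnion_le_card_mul _ _ _ (fun k _ => ?_)
    refine (Finset.card_union_le _ _).trans ?_
    have := Finset.card_image_le (s := I) (f := f k)
    have := Finset.card_image_le (s := I) (f := (f k).symm)
    omega
  calc E.card ≤ I.card + Fintype.card ι * (2 * I.card) := by omega
    _ = _ := by ring

/-- A permutation can be restricted to an invariant set, and extended by the identity. -/
theorem exists_restrict (σ : Equiv.Perm α) (B : Finset α) (h : ∀ i ∈ B, σ i ∈ B) :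
    ∃ ρ : Equiv.Perm α, (∀ i ∈ B, ρ i = σ i) ∧ ∀ i ∉ B, ρ i = i := by
  have hB : B.image σ = B :=
    Finset.eq_of_subset_of_card_le (Finset.image_subset_iff.2 h)
      (Finset.card_image_of_injective B σ.injective).ge
  have h' : ∀ i, σ i ∈ B ↔ i ∈ B := by
    refine fun i => ⟨fun hi => ?_, h i⟩
    rw [← hB, Finset.mem_image] at hi
    obtain ⟨j, hj, hji⟩ := hi
    rwa [← σ.injective hji]
  refine ⟨Equiv.Perm.ofSubtype (σ.subtypePerm h'), fun i hi => ?_, fun i hi => ?_⟩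
  · exact Equiv.Perm.ofSubtype_apply_of_mem _ hi
  · exact Equiv.Perm.ofSubtype_apply_of_not_mem _ hi

/-- Every finite set carries an involution that moves all of its points but at most one. -/
theorem exists_involution_on (A : Finset α) : ∃ π : Equiv.Perm α, π * π = 1 ∧
    (∀ i, π i ≠ i → i ∈ A) ∧ (A.filter (fun i => π i = i)).card ≤ 1 := by
  let e := A.equivFin
  let ρ : Equiv.Perm {i // i ∈ A} := e.symm.permCongr Fin.revPerm
  have hρ : ∀ i, ρ i = e.symm (Fin.rev (e i)) := fun i => rfl
  refine ⟨Equiv.Perm.ofSubtype ρ, ?_, fun i hi => ?_, ?_⟩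
  · have h1 : ρ * ρ = 1 := by
      ext i
      simp [hρ]
    rw [← map_mul, h1, map_one]
  · by_contra h
    exact hi (Equiv.Perm.ofSubtype_apply_of_not_mem _ h)
  · rw [Finset.card_le_one]
    have key : ∀ a (ha : a ∈ A), Equiv.Perm.ofSubtype ρ a = a →
        2 * (e ⟨a, ha⟩ : ℕ) + 1 = A.card := by
      intro a ha h
      rw [Equiv.Perm.ofSubtype_apply_of_mem _ ha] at h
      have h1 : ρ ⟨a, ha⟩ = ⟨a, ha⟩ := Subtype.ext h
      rw [hρ, Equiv.symm_apply_eq] at h1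
      have h2 := congrArg Fin.val h1
      rw [Fin.val_rev] at h2
      have := (e ⟨a, ha⟩).isLt
      omega
    intro a ha b hb
    rw [Finset.mem_filter] at ha hb
    have h1 := key a ha.1 ha.2
    have h2 := key b hb.1 hb.2
    have h3 : e ⟨a, ha.1⟩ = e ⟨b, hb.1⟩ := Fin.ext (by omega)
    exact congrArg Subtype.val (e.injective h3)

variable [Fintype α]

/-- An involution has a set of representatives of its `2`-cycles. -/
theorem involution_support (y : Equiv.Perm α) (hy : y * y = 1) :
    ∃ A : Finset α, (∀ i ∈ A, y i ∉ A) ∧ y.support = A ∪ A.image y := by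
  have hyy : ∀ i, y (y i) = i := fun i => by rw [← Equiv.Perm.mul_apply, hy]; rfl
  let e := Fintype.equivFin α
  refine ⟨Finset.univ.filter (fun i => e i < e (y i)), fun i hi => ?_, ?_⟩
  · simp only [Finset.mem_filter, Finset.mem_univ, true_and, hyy] at hi ⊢
    exact hi.le.not_gt
  · ext i
    simp only [Equiv.Perm.mem_support, Finset.mem_union, Finset.mem_filter, Finset.mem_univ,
      true_and, Finset.mem_image]
    constructor
    · intro h
      rcases lt_or_gt_of_ne (fun h' => h (e.injective h').symm : e i ≠ e (y i)) with h1 | h1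
      · exact Or.inl h1
      · exact Or.inr ⟨y i, by rwa [hyy], hyy i⟩
    · rintro (h | ⟨j, h, rfl⟩) h2
      · rw [h2] at h; exact lt_irrefl _ h
      · rw [hyy] at h2; rw [← h2] at h; exact lt_irrefl _ h

/-- An involution contains involutions with any smaller even support. -/
theorem exists_sub_involution (y : Equiv.Perm α) (hy : y * y = 1) (x : Equiv.Perm α)
    (hx : x * x = 1) (hle : x.support.card ≤ y.support.card) :
    ∃ z : Equiv.Perm α, z * z = 1 ∧ z.support.card = x.support.card ∧
      ∀ i, z i ≠ y i → y i ≠ i ∧ z i = i := by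
  have hyy : ∀ i, y (y i) = i := fun i => by rw [← Equiv.Perm.mul_apply, hy]; rfl
  obtain ⟨A, hA, hAs⟩ := involution_support y hy
  obtain ⟨C, hC, hCs⟩ := involution_support x hx
  have hcard : ∀ (w : Equiv.Perm α) (D : Finset α), (∀ i ∈ D, w i ∉ D) →
      (D ∪ D.image w).card = 2 * D.card := by
    intro w D hD
    rw [Finset.card_union_of_disjoint, Finset.card_image_of_injective _ w.injective]
    · ring
    · rw [Finset.disjoint_right]
      intro i hi
      rw [Finset.mem_image] at hi
      obtain ⟨j, hj, rfl⟩ := hi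
      exact hD j hj
  rw [hAs, hCs, hcard y A hA, hcard x C hC] at hle
  obtain ⟨B, hBA, hB⟩ := Finset.exists_subset_card_eq (show C.card ≤ A.card by omega)
  have hBy : ∀ i ∈ B, y i ∉ B := fun i hi h => hA i (hBA hi) (hBA h)
  obtain ⟨z, hz1, hz2⟩ := exists_restrict y (B ∪ B.image y) (by
    intro i hi
    rw [Finset.mem_union, Finset.mem_image] at hi ⊢
    rcases hi with hi | ⟨j, hj, rfl⟩
    · exact Or.inr ⟨i, hi, rfl⟩
    · left; rwa [hyy])
  have hsupp : ∀ i ∈ B ∪ B.image y, y i ≠ i := by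
    intro i hi
    rw [← Equiv.Perm.mem_support, hAs]
    exact Finset.union_subset_union hBA (Finset.image_subset_image hBA) hi
  have hinv : ∀ i ∈ B ∪ B.image y, y i ∈ B ∪ B.image y := by
    intro i hi
    rw [Finset.mem_union, Finset.mem_image] at hi ⊢
    rcases hi with hi | ⟨j, hj, rfl⟩
    · exact Or.inr ⟨i, hi, rfl⟩
    · left; rwa [hyy]
  have hzs : z.support = B ∪ B.image y := by
    ext i
    rw [Equiv.Perm.mem_support]
    by_cases hi : i ∈ B ∪ B.image y
    · rw [hz1 i hi]; exact iff_of_true (hsupp i hi) hi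
    · rw [hz2 i hi]; exact iff_of_false (by simp) hi
  refine ⟨z, ?_, ?_, fun i hi => ?_⟩
  · ext i
    by_cases hi : i ∈ B ∪ B.image y
    · rw [Equiv.Perm.mul_apply, hz1 i hi, hz1 _ (hinv i hi), hyy]; rfl
    · rw [Equiv.Perm.mul_apply, hz2 i hi, hz2 i hi]; rfl
  · rw [hzs, hCs, hcard y B hBy, hcard x C hC, hB]
  · by_cases h : i ∈ B ∪ B.image y
    · exact absurd (hz1 i h) hi
    · rw [hz2 i h] at hi ⊢
      exact ⟨fun h' => hi h'.symm, rfl⟩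

/-- Involutions with supports of equal size are conjugate. -/
theorem isConj_of_involution {x y : Equiv.Perm α} (hx : x * x = 1) (hy : y * y = 1)
    (h : x.support.card = y.support.card) : IsConj x y := by
  have key : ∀ w : Equiv.Perm α, w * w = 1 →
      w.cycleType = Multiset.replicate (w.support.card / 2) 2 := by
    intro w hw
    have hall : ∀ n ∈ w.cycleType, n = 2 := by
      intro n hn
      have h1 : n ∣ 2 := (Equiv.Perm.dvd_of_mem_cycleType hn).trans
        (orderOf_dvd_of_pow_eq_one (by rw [pow_two, hw]))
      have h2 := Equiv.Perm.two_le_of_mem_cycleType hn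
      exact le_antisymm (Nat.le_of_dvd (by norm_num) h1) h2
    have h1 := Multiset.eq_replicate_card.2 hall
    have h2 := w.sum_cycleType
    rw [h1, Multiset.sum_replicate, smul_eq_mul] at h2
    rw [← h2, Nat.mul_div_cancel _ (by norm_num : 0 < 2)]
    exact h1
  rw [Equiv.Perm.isConj_iff_cycleType_eq, key x hx, key y hy, h]

end Finite

/-! ### Negligible sequences of sets -/

/-- A sequence of sets `A n ⊆ Fin n` is negligible if its normalized counting measure tends to `0`
along `ω`, that is, if it represents a null set of the Loeb space. -/
def Negligible (ω : Ultrafilter ℕ) (A : ∀ n : ℕ, Finset (Fin n)) : Prop :=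
  Tendsto (fun n => ((A n).card : ℝ) / n) (ω : Filter ℕ) (𝓝 0)

section Negl

variable {ω : Ultrafilter ℕ} {A B C : ∀ n : ℕ, Finset (Fin n)}

theorem Negligible.of_card_le (c : ℕ) (hA : Negligible ω A)
    (h : ∀ n, (B n).card ≤ c * (A n).card) : Negligible ω B := by
  have h1 := hA.const_mul (c : ℝ)
  rw [mul_zero] at h1
  refine squeeze_zero (fun n => by positivity) (fun n => ?_) h1
  rw [← mul_div_assoc]
  gcongr
  exact_mod_cast h n

theorem Negligible.of_card_le_one (hA : Negligible ω A)
    (h : ∀ n, (B n).card ≤ (A n).card) : Negligible ω B :=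
  hA.of_card_le 1 (fun n => by rw [one_mul]; exact h n)

theorem Negligible.mono (hA : Negligible ω A) (h : ∀ n, B n ⊆ A n) : Negligible ω B :=
  hA.of_card_le_one (fun n => Finset.card_le_card (h n))

theorem Negligible.union (hA : Negligible ω A) (hB : Negligible ω B) :
    Negligible ω (fun n => A n ∪ B n) := by
  have h := hA.add hB
  rw [add_zero] at h
  refine squeeze_zero (fun n => by positivity) (fun n => ?_) h
  rw [← add_div]
  gcongr
  exact_mod_cast Finset.card_union_le _ _

/-- A nonprincipal ultrafilter on `ℕ` converges to infinity. -/
theorem le_atTop_of_ne_pure (hω : ∀ n : ℕ, ω ≠ pure n) : (ω : Filter ℕ) ≤ atTop := by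
  rw [← Nat.cofinite_eq_atTop]
  rcases ω.le_cofinite_or_eq_pure with h | ⟨n, hn⟩
  · exact h
  · exact absurd hn (hω n)

theorem Negligible.of_card_le_add (hω : (ω : Filter ℕ) ≤ atTop) (c : ℕ) (hA : Negligible ω A)
    (h : ∀ n, (B n).card ≤ (A n).card + c) : Negligible ω B := by
  have h1 := hA.add ((tendsto_const_div_atTop_nhds_zero_nat (c : ℝ)).mono_left hω)
  rw [add_zero] at h1
  refine squeeze_zero (fun n => by positivity) (fun n => ?_) h1
  rw [← add_div]
  gcongr
  exact_mod_cast h n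

theorem Negligible.of_card_bounded (hω : (ω : Filter ℕ) ≤ atTop) (c : ℕ)
    (h : ∀ n, (B n).card ≤ c) : Negligible ω B :=
  Negligible.of_card_le_add (A := fun _ => ∅) hω c (by simp [Negligible]) (by simpa using h)

end Negl

/-! ### Equality in the universal sofic group -/

section Sofic

variable {ω : Ultrafilter ℕ}

theorem mk_eq_mk_iff {g h : ∀ n : ℕ, Equiv.Perm (Fin n)} :
    (QuotientGroup.mk g : SoficGroup ω) = QuotientGroup.mk h ↔
      Negligible ω (fun n => Finset.univ.filter (fun i => g n i ≠ h n i)) := by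
  rw [QuotientGroup.eq]
  refine tendsto_congr (fun n => ?_)
  have h1 := hamming_mul_left (g n) ((g n)⁻¹ * h n) 1
  rw [mul_inv_cancel_left, mul_one, hamming_comm] at h1
  exact h1.symm

/-- The Hamming length of an element of the universal sofic group. -/
noncomputable def len (s : SoficGroup ω) : ℝ := 1 - (trace ω (soficEmb ω s)).re

theorem tendsto_trace_permSeq (hω : (ω : Filter ℕ) ≤ atTop) (g : ∀ n : ℕ, Equiv.Perm (Fin n)) :
    Tendsto (fun n => ((1 - hamming (g n) 1 : ℝ) : ℂ)) (ω : Filter ℕ)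
      (𝓝 (trace ω (soficEmb ω (QuotientGroup.mk g)))) := by
  have h := tendsto_traceLim ω (permSeq g)
  rw [← trace_leftMul] at h
  refine h.congr' ?_
  filter_upwards [hω (eventually_ne_atTop 0)] with n hn
  exact ntr_permMatrixHom hn (g n)

theorem tendsto_len (hω : (ω : Filter ℕ) ≤ atTop) (g : ∀ n : ℕ, Equiv.Perm (Fin n)) :
    Tendsto (fun n => ((Finset.univ.filter (fun i => g n i ≠ i)).card : ℝ) / n) (ω : Filter ℕ)
      (𝓝 (len (QuotientGroup.mk g : SoficGroup ω))) := by
  have h := ((Complex.continuous_re.tendsto _).comp (tendsto_trace_permSeq hω g)).const_sub 1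
  refine h.congr (fun n => ?_)
  rw [Function.comp_apply, Complex.ofReal_re, sub_sub_cancel]
  rfl

theorem len_eq (hω : (ω : Filter ℕ) ≤ atTop) {g : ∀ n : ℕ, Equiv.Perm (Fin n)} {a : ℝ}
    (h : Tendsto (fun n => ((Finset.univ.filter (fun i => g n i ≠ i)).card : ℝ) / n)
      (ω : Filter ℕ) (𝓝 a)) : len (QuotientGroup.mk g : SoficGroup ω) = a :=
  tendsto_nhds_unique (tendsto_len hω g) h

/-- The trace is real on the universal sofic group. -/
theorem trace_soficEmb (hω : (ω : Filter ℕ) ≤ atTop) (s : SoficGroup ω) :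
    trace ω (soficEmb ω s) = ((1 - len s : ℝ) : ℂ) := by
  obtain ⟨g, rfl⟩ := QuotientGroup.mk_surjective s
  have h := tendsto_trace_permSeq hω g
  refine tendsto_nhds_unique h ?_
  refine (Complex.continuous_ofReal.tendsto _).comp ((tendsto_len hω g).const_sub 1)

theorem len_nonneg (hω : (ω : Filter ℕ) ≤ atTop) (s : SoficGroup ω) : 0 ≤ len s := by
  obtain ⟨g, rfl⟩ := QuotientGroup.mk_surjective s
  exact ge_of_tendsto' (tendsto_len hω g) (fun n => by positivity)

theorem len_le_one (hω : (ω : Filter ℕ) ≤ atTop) (s : SoficGroup ω) : len s ≤ 1 := by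
  obtain ⟨g, rfl⟩ := QuotientGroup.mk_surjective s
  refine le_of_tendsto' (tendsto_len hω g) (fun n => ?_)
  refine div_le_one_of_le₀ ?_ (by positivity)
  exact_mod_cast (Finset.card_le_univ _).trans (by simp)

theorem len_mul_le (hω : (ω : Filter ℕ) ≤ atTop) (s t : SoficGroup ω) :
    len (s * t) ≤ len s + len t := by
  obtain ⟨g, rfl⟩ := QuotientGroup.mk_surjective s
  obtain ⟨h, rfl⟩ := QuotientGroup.mk_surjective t
  refine le_of_tendsto_of_tendsto' (tendsto_len hω (g * h))
    ((tendsto_len hω g).add (tendsto_len hω h)) (fun n => ?_)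
  have h1 := hamming_triangle ((g * h) n) (g n) 1
  have h2 := hamming_mul_left (g n) (h n) 1
  rw [mul_one] at h2
  rw [Pi.mul_apply, h2, add_comm] at h1
  exact h1

theorem len_conj (hω : (ω : Filter ℕ) ≤ atTop) (s t : SoficGroup ω) :
    len (s * t * s⁻¹) = len t := by
  obtain ⟨g, rfl⟩ := QuotientGroup.mk_surjective s
  obtain ⟨h, rfl⟩ := QuotientGroup.mk_surjective t
  refine len_eq hω (g := g * h * g⁻¹) ((tendsto_len hω h).congr (fun n => ?_))
  have h1 := hamming_mul_right (g n * h n) (g n * 1) (g n)⁻¹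
  rw [hamming_mul_left, mul_one, mul_inv_cancel] at h1
  exact h1.symm

/-- Every involution of the universal sofic group is represented by involutions. -/
theorem exists_involutive_lift (s : SoficGroup ω) (hs : s * s = 1) :
    ∃ g : ∀ n : ℕ, Equiv.Perm (Fin n), (∀ n, g n * g n = 1) ∧ QuotientGroup.mk g = s := by
  obtain ⟨h, rfl⟩ := QuotientGroup.mk_surjective s
  have hneg : Negligible ω (fun n => Finset.univ.filter (fun i => h n (h n i) ≠ i)) :=
    (mk_eq_mk_iff (g := h * h) (h := 1)).1 hs
  have hinv : ∀ n, ∀ i ∈ Finset.univ.filter (fun i => h n (h n i) = i),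
      h n i ∈ Finset.univ.filter (fun i => h n (h n i) = i) := by
    intro n i hi
    simp only [Finset.mem_filter, Finset.mem_univ, true_and] at hi ⊢
    rw [hi]
  choose g hg1 hg2 using fun n => exists_restrict (h n)
    (Finset.univ.filter (fun i => h n (h n i) = i)) (hinv n)
  refine ⟨g, fun n => ?_, mk_eq_mk_iff.2 (hneg.mono fun n i hi => ?_)⟩
  · refine Equiv.ext (fun i => ?_)
    rw [Equiv.Perm.mul_apply]
    by_cases hi : i ∈ Finset.univ.filter (fun i => h n (h n i) = i)
    · rw [hg1 n i hi, hg1 n _ (hinv n i hi)]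
      simpa using hi
    · rw [hg2 n i hi, hg2 n i hi]; rfl
  · simp only [Finset.mem_filter, Finset.mem_univ, true_and] at hi ⊢
    intro hi2
    exact hi (hg1 n i (by simpa using hi2))

/-- Involutions of the universal sofic group with equal Hamming length are conjugate. -/
theorem exists_conj_of_len_eq (hω : (ω : Filter ℕ) ≤ atTop) {s t : SoficGroup ω} (hs : s * s = 1)
    (ht : t * t = 1) (h : len s = len t) : ∃ g : SoficGroup ω, g * s * g⁻¹ = t := by
  obtain ⟨x, hx, rfl⟩ := exists_involutive_lift s hs
  obtain ⟨y, hy, rfl⟩ := exists_involutive_lift t ht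
  have key : ∀ n, ∃ g : Equiv.Perm (Fin n),
      ((Finset.univ.filter (fun i => (g * x n * g⁻¹) i ≠ y n i)).card : ℝ)
        ≤ |((Finset.univ.filter (fun i => x n i ≠ i)).card : ℝ)
          - (Finset.univ.filter (fun i => y n i ≠ i)).card| := by
    intro n
    have aux : ∀ x y : Equiv.Perm (Fin n), x * x = 1 → y * y = 1 →
        x.support.card ≤ y.support.card → ∃ g : Equiv.Perm (Fin n),
          (Finset.univ.filter (fun i => (g * x * g⁻¹) i ≠ y i)).card + x.support.card
            ≤ y.support.card := by
      intro x y hx hy hle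
      obtain ⟨z, hz, hzc, hzy⟩ := exists_sub_involution y hy x hx hle
      obtain ⟨g, hg⟩ := isConj_iff.1 (isConj_of_involution hx hz hzc.symm)
      refine ⟨g, ?_⟩
      rw [hg, ← hzc, ← Finset.card_union_of_disjoint]
      · refine Finset.card_le_card (Finset.union_subset (fun i hi => ?_) (fun i hi => ?_))
        · rw [Finset.mem_filter] at hi
          exact Equiv.Perm.mem_support.2 (hzy i hi.2).1
        · rw [Equiv.Perm.mem_support] at hi ⊢
          by_cases h : z i = y i
          · rwa [← h]
          · exact (hzy i h).1
      · rw [Finset.disjoint_left]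
        intro i hi
        rw [Finset.mem_filter] at hi
        rw [Equiv.Perm.mem_support, not_not]
        exact (hzy i hi.2).2
    rcases le_total (x n).support.card (y n).support.card with hle | hle
    · obtain ⟨g, hg⟩ := aux (x n) (y n) (hx n) (hy n) hle
      refine ⟨g, ?_⟩
      rw [abs_sub_comm]
      refine le_trans ?_ (le_abs_self _)
      rw [le_sub_iff_add_le]
      exact_mod_cast hg
    · obtain ⟨g, hg⟩ := aux (y n) (x n) (hy n) (hx n) hle
      refine ⟨g⁻¹, ?_⟩
      have hc : (Finset.univ.filter (fun i => (g⁻¹ * x n * g⁻¹⁻¹) i ≠ y n i)).card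
          = (Finset.univ.filter (fun i => (g * y n * g⁻¹) i ≠ x n i)).card := by
        refine Finset.card_bij (fun i _ => g i) ?_ (fun a _ b _ hab => g.injective hab) ?_
        · intro i hi
          rw [Finset.mem_filter] at hi ⊢
          refine ⟨Finset.mem_univ _, fun hcon => hi.2 ?_⟩
          simp only [Equiv.Perm.mul_apply, inv_inv, Equiv.Perm.coe_inv,
            Equiv.symm_apply_apply, Equiv.symm_apply_eq] at hcon ⊢
          exact hcon.symm
        · intro i hi
          refine ⟨g⁻¹ i, ?_, by simp⟩
          rw [Finset.mem_filter] at hi ⊢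
          refine ⟨Finset.mem_univ _, fun hcon => hi.2 ?_⟩
          simp only [Equiv.Perm.mul_apply, inv_inv, Equiv.Perm.coe_inv,
            Equiv.apply_symm_apply, Equiv.symm_apply_eq] at hcon ⊢
          exact hcon.symm
      rw [hc]
      refine le_trans ?_ (le_abs_self _)
      rw [le_sub_iff_add_le]
      exact_mod_cast hg
  choose g hg using key
  refine ⟨QuotientGroup.mk g, ?_⟩
  have hd := ((tendsto_len hω x).sub (tendsto_len hω y)).abs
  rw [h, sub_self, abs_zero] at hd
  refine (mk_eq_mk_iff (g := g * x * g⁻¹)).2 (squeeze_zero (fun n => by positivity) (fun n => ?_) hd)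
  rw [← sub_div, abs_div, Nat.abs_cast]
  gcongr
  exact hg n

end Sofic

/-! ### Involutions of prescribed length -/

/-- The Klein four-group. -/
abbrev Klein : Type := Multiplicative (ZMod 2 × ZMod 2)

theorem klein_mul_self (v : Klein) : v * v = 1 := by
  revert v; decide

/-- Functions with values in a group act on blocks of points by left translation. -/
def blockPerm (ι V : Type*) [Group V] : (ι → V) →* Equiv.Perm (ι × V) where
  toFun P :=
    { toFun := fun x => (x.1, P x.1 * x.2)
      invFun := fun x => (x.1, (P x.1)⁻¹ * x.2)
      left_inv := fun x => by simp
      right_inv := fun x => by simp }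
  map_one' := by ext x <;> simp
  map_mul' P Q := by ext x <;> simp [mul_assoc]

theorem exists_kleinHom (n : ℕ) : ∃ B : (Fin (n / 4) → Klein) →* Equiv.Perm (Fin n),
    ∀ P, (Finset.univ.filter (fun i => B P i ≠ i)).card
      = 4 * (Finset.univ.filter (fun j => P j ≠ 1)).card := by
  classical
  have hV : Fintype.card Klein = 4 := by decide
  obtain ⟨e⟩ : Nonempty (Fin (n / 4) × Klein ↪ Fin n) := by
    refine Function.Embedding.nonempty_of_card_le ?_
    rw [Fintype.card_prod, hV, Fintype.card_fin, Fintype.card_fin]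
    omega
  refine ⟨(Equiv.Perm.viaEmbeddingHom e).comp (blockPerm _ _), fun P => ?_⟩
  have h : Finset.univ.filter (fun i => ((Equiv.Perm.viaEmbeddingHom e).comp (blockPerm _ _)) P i ≠ i)
      = ((Finset.univ.filter (fun j => P j ≠ 1)) ×ˢ (Finset.univ : Finset Klein)).map e := by
    ext i
    simp only [Finset.mem_filter, Finset.mem_univ, true_and, Finset.mem_map, Finset.mem_product,
      and_true]
    rw [MonoidHom.comp_apply, Equiv.Perm.viaEmbeddingHom_apply]
    constructor
    · intro hi
      by_cases hr : i ∈ Set.range e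
      · obtain ⟨x, rfl⟩ := hr
        refine ⟨x, fun hx => hi ?_, rfl⟩
        rw [Equiv.Perm.viaEmbedding_apply]
        simp [blockPerm, hx]
      · exact absurd (Equiv.Perm.viaEmbedding_apply_of_notMem _ _ _ hr) hi
    · rintro ⟨x, hx, rfl⟩ hi
      rw [Equiv.Perm.viaEmbedding_apply] at hi
      have h2 := congrArg Prod.snd (e.injective hi)
      exact hx (mul_eq_right.1 h2)
  rw [h, Finset.card_map, Finset.card_product, Finset.card_univ, hV, mul_comm]

/-- The element of the Klein four-group valued function `v · 1_{[a, b)}`, discretized. -/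
noncomputable def kleinStep (a b : ℝ) (v : Klein) (n : ℕ) : Fin (n / 4) → Klein := fun j =>
  if ⌊a * (n / 4 : ℕ)⌋₊ ≤ (j : ℕ) ∧ (j : ℕ) < ⌊b * (n / 4 : ℕ)⌋₊ then v else 1

section Sofic

variable {ω : Ultrafilter ℕ}

/-- The involution of the universal sofic group given by a sequence of functions with values in the
Klein four-group. -/
noncomputable def kleinElt (ω : Ultrafilter ℕ) : (∀ n : ℕ, Fin (n / 4) → Klein) →* SoficGroup ω :=
  (QuotientGroup.mk' (nullPerms ω)).comp
    { toFun := fun P n => (exists_kleinHom n).choose (P n)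
      map_one' := by funext n; exact map_one _
      map_mul' := fun P Q => by funext n; exact map_mul _ _ _ }

theorem kleinElt_mul_self (P : ∀ n : ℕ, Fin (n / 4) → Klein) :
    kleinElt ω P * kleinElt ω P = 1 := by
  rw [← map_mul]
  have h : P * P = 1 := by
    funext n j
    exact klein_mul_self _
  rw [h, map_one]

theorem len_kleinElt (hω : (ω : Filter ℕ) ≤ atTop) {a b : ℝ} (ha : 0 ≤ a) (hab : a ≤ b)
    (hb : b ≤ 1) (P : ∀ n : ℕ, Fin (n / 4) → Klein)
    (hP : ∀ n j, P n j ≠ 1 ↔ ⌊a * (n / 4 : ℕ)⌋₊ ≤ (j : ℕ) ∧ (j : ℕ) < ⌊b * (n / 4 : ℕ)⌋₊) :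
    len (kleinElt ω P) = b - a := by
  refine len_eq (g := fun n => (exists_kleinHom n).choose (P n)) hω ?_
  have hm : Tendsto (fun n : ℕ => n / 4) (ω : Filter ℕ) atTop :=
    (Nat.tendsto_div_const_atTop (by norm_num)).mono_left hω
  have h1 : ∀ c : ℝ, 0 ≤ c → Tendsto (fun n : ℕ => (⌊c * (n / 4 : ℕ)⌋₊ : ℝ) / (n / 4 : ℕ))
      (ω : Filter ℕ) (𝓝 c) := fun c hc =>
    (tendsto_nat_floor_mul_div_atTop hc).comp (tendsto_natCast_atTop_atTop.comp hm)
  have h2 : Tendsto (fun n : ℕ => 4 * ((n / 4 : ℕ) : ℝ) / n) (ω : Filter ℕ) (𝓝 1) := by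
    have h3 : Tendsto (fun n : ℕ => 1 - (3 : ℝ) / n) (ω : Filter ℕ) (𝓝 1) := by
      have := ((tendsto_const_div_atTop_nhds_zero_nat (3 : ℝ)).mono_left hω).const_sub 1
      rwa [sub_zero] at this
    refine tendsto_of_tendsto_of_tendsto_of_le_of_le' h3 tendsto_const_nhds ?_ ?_
    · filter_upwards [hω (eventually_gt_atTop 0)] with n hn
      have hn' : (0 : ℝ) < n := by exact_mod_cast hn
      rw [le_div_iff₀ hn', sub_mul, one_mul, div_mul_cancel₀ _ hn'.ne']
      have : n ≤ 4 * (n / 4) + 3 := by omega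
      have : (n : ℝ) ≤ 4 * (n / 4 : ℕ) + 3 := by exact_mod_cast this
      linarith
    · filter_upwards with n
      refine div_le_one_of_le₀ ?_ (by positivity)
      have : 4 * (n / 4) ≤ n := by omega
      exact_mod_cast this
  have h4 := ((h1 b (ha.trans hab)).sub (h1 a ha)).mul h2
  rw [mul_one] at h4
  refine h4.congr' ?_
  filter_upwards [hm.eventually (eventually_gt_atTop 0)] with n hn
  have hn' : (((n / 4 : ℕ) : ℝ)) ≠ 0 := by exact_mod_cast hn.ne'
  have hfl : ⌊a * (n / 4 : ℕ)⌋₊ ≤ ⌊b * (n / 4 : ℕ)⌋₊ :=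
    Nat.floor_mono (by gcongr)
  have hle : ⌊b * (n / 4 : ℕ)⌋₊ ≤ n / 4 := by
    refine Nat.floor_le_of_le ?_
    exact mul_le_of_le_one_left (by positivity) hb
  have hc : (Finset.univ.filter (fun j => P n j ≠ 1)).card
      = ⌊b * (n / 4 : ℕ)⌋₊ - ⌊a * (n / 4 : ℕ)⌋₊ := by
    rw [← Nat.card_Ico, ← Finset.card_map Fin.valEmbedding]
    congr 1
    ext j
    simp only [Finset.mem_map, Finset.mem_filter, Finset.mem_univ, true_and, Finset.mem_Ico, hP]
    constructor
    · rintro ⟨i, hi, rfl⟩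
      exact hi
    · intro hj
      exact ⟨⟨j, hj.2.trans_le hle⟩, hj, rfl⟩
  rw [(exists_kleinHom n).choose_spec, hc]
  push_cast [Nat.cast_sub hfl]
  field_simp

/-- There are commuting involutions `x`, `y` such that `x` and `y` have length `a` and `x * y` has
length `c`, provided that `c ≤ 2 * a`. -/
theorem exists_involutions_mul (hω : (ω : Filter ℕ) ≤ atTop) {a c : ℝ} (ha : a ≤ 1) (hc : 0 ≤ c)
    (hc1 : c ≤ 1) (hca : c ≤ 2 * a) : ∃ x y : SoficGroup ω, x * x = 1 ∧ y * y = 1 ∧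
      x * y * (x * y) = 1 ∧ len x = a ∧ len y = a ∧ len (x * y) = c := by
  have ha0 : 0 ≤ a := by linarith
  have hα : (Multiplicative.ofAdd (1, 0) : Klein) ≠ 1 := by decide
  have hβ : (Multiplicative.ofAdd (0, 1) : Klein) ≠ 1 := by decide
  have hαβ : (Multiplicative.ofAdd (1, 0) * Multiplicative.ofAdd (0, 1) : Klein) ≠ 1 := by decide
  have hαα : (Multiplicative.ofAdd (1, 0) * Multiplicative.ofAdd (1, 0) : Klein) = 1 := by decide
  have hfl : ∀ {u v : ℝ} (n : ℕ), u ≤ v → ⌊u * (n / 4 : ℕ)⌋₊ ≤ ⌊v * (n / 4 : ℕ)⌋₊ :=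
    fun n huv => Nat.floor_mono (by gcongr)
  rcases le_total c a with h | h
  · refine ⟨kleinElt ω (kleinStep 0 a (Multiplicative.ofAdd (1, 0))),
      kleinElt ω (kleinStep 0 c (Multiplicative.ofAdd (0, 1)) *
        kleinStep c a (Multiplicative.ofAdd (1, 0))), kleinElt_mul_self _, kleinElt_mul_self _,
      by rw [← map_mul]; exact kleinElt_mul_self _, ?_, ?_, ?_⟩
    · rw [len_kleinElt hω le_rfl ha0 ha, sub_zero]
      intro n j
      simp only [kleinStep]
      split_ifs <;> simp_all
    · rw [len_kleinElt hω le_rfl ha0 ha, sub_zero]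
      intro n j
      have h4 := hfl n h
      clear hfl
      simp only [kleinStep, Pi.mul_apply, zero_mul, Nat.floor_zero]
      split_ifs <;> simp_all <;> omega
    · rw [← map_mul, len_kleinElt hω le_rfl hc hc1, sub_zero]
      intro n j
      have h4 := hfl n h
      clear hfl
      simp only [kleinStep, Pi.mul_apply, zero_mul, Nat.floor_zero]
      split_ifs <;> simp_all <;> omega
  · have h1 : c - a ≤ a := by linarith
    have h0 : 0 ≤ c - a := by linarith
    have h2 : c - a ≤ c := by linarith
    refine ⟨kleinElt ω (kleinStep 0 a (Multiplicative.ofAdd (1, 0))),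
      kleinElt ω (kleinStep (c - a) c (Multiplicative.ofAdd (0, 1))),
      kleinElt_mul_self _, kleinElt_mul_self _,
      by rw [← map_mul]; exact kleinElt_mul_self _, ?_, ?_, ?_⟩
    · rw [len_kleinElt hω le_rfl ha0 ha, sub_zero]
      intro n j
      simp only [kleinStep]
      split_ifs <;> simp_all
    · rw [len_kleinElt hω h0 h2 hc1, sub_sub_cancel]
      intro n j
      simp only [kleinStep]
      split_ifs <;> simp_all
    · rw [← map_mul, len_kleinElt hω le_rfl hc hc1, sub_zero]
      intro n j
      have h4 := hfl n h
      have h5 := hfl n h1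
      clear hfl
      simp only [kleinStep, Pi.mul_apply, zero_mul, Nat.floor_zero]
      split_ifs <;> simp_all <;> omega

/-- There are disjoint involutions of lengths `a` and `b`, provided that `a + b ≤ 1`. -/
theorem exists_involutions_disjoint (hω : (ω : Filter ℕ) ≤ atTop) {a b : ℝ} (ha : 0 ≤ a)
    (hb : 0 ≤ b) (hab : a + b ≤ 1) : ∃ x y : SoficGroup ω, x * x = 1 ∧ y * y = 1 ∧
      x * y * (x * y) = 1 ∧ len x = a ∧ len y = b ∧ len (x * y) = a + b := by
  have hα : (Multiplicative.ofAdd (1, 0) : Klein) ≠ 1 := by decide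
  have h1 : a ≤ a + b := by linarith
  have h2 : a ≤ 1 := by linarith
  refine ⟨kleinElt ω (kleinStep 0 a (Multiplicative.ofAdd (1, 0))),
    kleinElt ω (kleinStep a (a + b) (Multiplicative.ofAdd (1, 0))),
    kleinElt_mul_self _, kleinElt_mul_self _,
    by rw [← map_mul]; exact kleinElt_mul_self _, ?_, ?_, ?_⟩
  · rw [len_kleinElt hω le_rfl ha h2, sub_zero]
    intro n j
    simp only [kleinStep]
    split_ifs <;> simp_all
  · rw [len_kleinElt hω ha h1 hab, add_sub_cancel_left]
    intro n j
    simp only [kleinStep]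
    split_ifs <;> simp_all
  · rw [← map_mul, len_kleinElt hω le_rfl (ha.trans h1) hab, sub_zero]
    intro n j
    have : ⌊a * (n / 4 : ℕ)⌋₊ ≤ ⌊(a + b) * (n / 4 : ℕ)⌋₊ := Nat.floor_mono (by gcongr)
    simp only [kleinStep, Pi.mul_apply, zero_mul, Nat.floor_zero]
    split_ifs <;> simp_all <;> omega

theorem exists_involution_len (hω : (ω : Filter ℕ) ≤ atTop) {a : ℝ} (ha : 0 ≤ a) (ha1 : a ≤ 1) :
    ∃ x : SoficGroup ω, x * x = 1 ∧ len x = a := by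
  obtain ⟨x, -, hx, -, -, h, -⟩ := exists_involutions_disjoint hω ha le_rfl (by simpa using ha1)
  exact ⟨x, hx, h⟩

/-! ### Automorphisms preserve the length of involutions -/

theorem len_map_eq_of_len_eq (hω : (ω : Filter ℕ) ≤ atTop) (Φ : SoficGroup ω ≃* SoficGroup ω)
    {x y : SoficGroup ω} (hx : x * x = 1) (hy : y * y = 1) (h : len x = len y) :
    len (Φ x) = len (Φ y) := by
  obtain ⟨g, rfl⟩ := exists_conj_of_len_eq hω hx hy h
  rw [map_mul, map_mul, map_inv, len_conj hω]

theorem mulEquiv_involution (Φ : SoficGroup ω ≃* SoficGroup ω) {x : SoficGroup ω}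
    (hx : x * x = 1) : Φ x * Φ x = 1 := by
  rw [← map_mul, hx, map_one]

/-- An involution `x` with `len x ≤ 2 * len y` is a product of two conjugates of `y`. -/
theorem len_map_le_two_mul (hω : (ω : Filter ℕ) ≤ atTop) (Φ : SoficGroup ω ≃* SoficGroup ω)
    {x y : SoficGroup ω} (hx : x * x = 1) (hy : y * y = 1) (h : len x ≤ 2 * len y) :
    len (Φ x) ≤ 2 * len (Φ y) := by
  obtain ⟨u, v, hu, hv, huv, h1, h2, h3⟩ := exists_involutions_mul hω (len_le_one hω y)
    (len_nonneg hω x) (len_le_one hω x) h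
  rw [← len_map_eq_of_len_eq hω Φ huv hx h3, map_mul, two_mul]
  refine (len_mul_le hω _ _).trans (add_le_add ?_ ?_)
  · exact (len_map_eq_of_len_eq hω Φ hu hy h1).le
  · exact (len_map_eq_of_len_eq hω Φ hv hy h2).le

theorem len_map_mono (hω : (ω : Filter ℕ) ≤ atTop) (Φ : SoficGroup ω ≃* SoficGroup ω)
    {x y : SoficGroup ω} (hx : x * x = 1) (hy : y * y = 1) (h : len x ≤ len y) :
    len (Φ x) ≤ len (Φ y) := by
  -- compare both lengths with an involution `t` of half the length of `Φ y`
  obtain ⟨t, ht, htl⟩ := exists_involution_len (a := len (Φ y) / 2) hω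
    (by have := len_nonneg hω (Φ y); linarith) (by have := len_le_one hω (Φ y); linarith)
  have h1 := len_map_le_two_mul hω Φ.symm (mulEquiv_involution Φ hy) ht (by linarith)
  rw [MulEquiv.symm_apply_apply] at h1
  have h2 := len_map_le_two_mul hω Φ hx (mulEquiv_involution Φ.symm ht) (h.trans h1)
  rw [MulEquiv.apply_symm_apply] at h2
  linarith

theorem len_map_le_nat_mul (hω : (ω : Filter ℕ) ≤ atTop) (Φ : SoficGroup ω ≃* SoficGroup ω)
    {x : SoficGroup ω} (hx : x * x = 1) (k : ℕ) : ∀ y : SoficGroup ω, y * y = 1 →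
      len y = k * len x → len (Φ y) ≤ k * len (Φ x) := by
  induction k with
  | zero =>
    intro y hy h
    have h1 : len y = len (1 : SoficGroup ω) := by
      have h2 : len (1 : SoficGroup ω) = 0 := len_eq (g := 1) hω (by simp)
      rw [h, h2, Nat.cast_zero, zero_mul]
    rw [len_map_eq_of_len_eq hω Φ hy (mul_one 1) h1, map_one, ← h1, h]
    simp
  | succ k ih =>
    intro y hy h
    have h0 := len_nonneg hω x
    push_cast at h
    obtain ⟨u, v, hu, hv, huv, h1, h2, h3⟩ := exists_involutions_disjoint hω
      (a := k * len x) (b := len x) (by positivity) h0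
      (by have := len_le_one hω y; linarith)
    have h4 := len_map_eq_of_len_eq hω Φ huv hy (by rw [h3, h]; ring)
    have h5 := ih u hu h1
    have h6 := len_map_eq_of_len_eq hω Φ hv hx h2
    have h7 := len_mul_le hω (Φ u) (Φ v)
    rw [← map_mul, h4] at h7
    push_cast
    linarith

theorem one_div_le_len_map (hω : (ω : Filter ℕ) ≤ atTop) (Φ : SoficGroup ω ≃* SoficGroup ω)
    {x : SoficGroup ω} (hx : x * x = 1) {k : ℕ} (hk : 0 < k) (h : len x = 1 / k) :
    1 / k ≤ len (Φ x) := by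
  have hk' : (0 : ℝ) < k := by exact_mod_cast hk
  obtain ⟨t, ht, htl⟩ := exists_involution_len (ω := ω) (a := 1) hω zero_le_one le_rfl
  obtain ⟨y, hy, hyl⟩ := exists_involution_len (ω := ω) (a := 1) hω zero_le_one le_rfl
  have h3 := len_map_mono hω Φ (mulEquiv_involution Φ.symm ht) hy
    (by rw [hyl]; exact len_le_one hω _)
  rw [MulEquiv.apply_symm_apply, htl] at h3
  have h4 := len_map_le_nat_mul hω Φ hx k y hy (by rw [hyl, h, mul_one_div_cancel hk'.ne'])
  rw [div_le_iff₀ hk']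
  linarith

theorem len_map_le_of_involution (hω : (ω : Filter ℕ) ≤ atTop) (Φ : SoficGroup ω ≃* SoficGroup ω)
    {x : SoficGroup ω} (hx : x * x = 1) : len (Φ x) ≤ len x := by
  have key : ∀ k : ℕ, len (Φ x) ≤ len x + 1 / ((k : ℝ) + 1) := by
    intro k
    have hk : (0 : ℝ) < (k : ℝ) + 1 := by positivity
    have h0 := len_nonneg hω x
    have h1 := len_le_one hω x
    -- compare `x` with an involution whose length is a multiple of `1 / (k + 1)`
    obtain ⟨u, hu, hul⟩ := exists_involution_len (ω := ω) (a := 1 / ((k + 1 : ℕ) : ℝ)) hω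
      (by positivity) (by
        rw [Nat.cast_add_one]
        exact div_le_one_of_le₀ (by have : (0 : ℝ) ≤ k := by positivity
                                    linarith) hk.le)
    have huΦ : len (Φ u) ≤ 1 / ((k + 1 : ℕ) : ℝ) := by
      have h2 := one_div_le_len_map hω Φ.symm hu k.succ_pos hul
      have h3 := len_map_mono hω Φ hu (mulEquiv_involution Φ.symm hu) (hul.le.trans h2)
      rwa [MulEquiv.apply_symm_apply, hul] at h3
    have hj : (⌈len x * ((k + 1 : ℕ) : ℝ)⌉₊ : ℝ) ≤ ((k + 1 : ℕ) : ℝ) := by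
      have : ⌈len x * ((k + 1 : ℕ) : ℝ)⌉₊ ≤ k + 1 :=
        Nat.ceil_le.2 (mul_le_of_le_one_left (by positivity) h1)
      exact_mod_cast this
    have hj2 := (Nat.ceil_lt_add_one (a := len x * ((k + 1 : ℕ) : ℝ)) (by positivity)).le
    have hj3 := Nat.le_ceil (len x * ((k + 1 : ℕ) : ℝ))
    set j := ⌈len x * ((k + 1 : ℕ) : ℝ)⌉₊
    obtain ⟨y, hy, hyl⟩ := exists_involution_len (ω := ω)
      (a := j * (1 / ((k + 1 : ℕ) : ℝ))) hω (by positivity) (by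
        rw [mul_one_div]; exact div_le_one_of_le₀ hj (by positivity))
    have h5 := len_map_le_nat_mul hω Φ hu j y hy (by rw [hyl, hul])
    have h6 := len_map_mono hω Φ hx hy (by
      rw [hyl, mul_one_div, le_div_iff₀ (by positivity)]; exact hj3)
    calc len (Φ x) ≤ j * len (Φ u) := h6.trans h5
      _ ≤ j * (1 / ((k + 1 : ℕ) : ℝ)) := by gcongr
      _ ≤ (len x * ((k + 1 : ℕ) : ℝ) + 1) * (1 / ((k + 1 : ℕ) : ℝ)) := by gcongr
      _ = len x + 1 / ((k : ℝ) + 1) := by push_cast; field_simp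
  have h := tendsto_one_div_add_atTop_nhds_zero_nat (𝕜 := ℝ)
  have h2 := h.const_add (len x)
  rw [add_zero] at h2
  exact ge_of_tendsto' h2 key

theorem len_map_of_involution (hω : (ω : Filter ℕ) ≤ atTop) (Φ : SoficGroup ω ≃* SoficGroup ω)
    {x : SoficGroup ω} (hx : x * x = 1) : len (Φ x) = len x := by
  refine le_antisymm (len_map_le_of_involution hω Φ hx) ?_
  have h := len_map_le_of_involution hω Φ.symm (mulEquiv_involution Φ hx)
  rwa [MulEquiv.symm_apply_apply] at h

end Sofic

/-! ### Supports and automorphisms -/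

section Sofic

variable {ω : Ultrafilter ℕ}

/-- The involutions `φ` such that `φ` and `φ * π` are involutions whose lengths add up to that of
`π`; for an involution `π`, these are the restrictions of `π` to invariant sets. -/
def subInvolutions (π : SoficGroup ω) : Set (SoficGroup ω) :=
  {φ | φ * φ = 1 ∧ φ * π * (φ * π) = 1 ∧ len φ + len (φ * π) = len π}

/-- The elements that commute with the squares of all elements of the centralizer of
`subInvolutions π`. For an involution `π`, these are the elements whose support is contained in that
of `π` (`mk_mem_supportedIn`, `negligible_of_mk_mem_supportedIn`). -/
def supportedIn (π : SoficGroup ω) : Set (SoficGroup ω) :=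
  {s | ∀ v, (∀ φ ∈ subInvolutions π, v * φ = φ * v) → s * (v * v) = v * v * s}

/-- An element that commutes with all restrictions of an involution `p` acts on the support of `p`
with square `1`. -/
theorem negligible_sq_of_commute (hω : (ω : Filter ℕ) ≤ atTop) {p v : ∀ n : ℕ, Equiv.Perm (Fin n)}
    (hp : ∀ n, p n * p n = 1)
    (hv : ∀ φ ∈ subInvolutions (QuotientGroup.mk p : SoficGroup ω),
      QuotientGroup.mk v * φ = φ * QuotientGroup.mk v) :
    Negligible ω (fun n => Finset.univ.filter (fun i => p n i ≠ i ∧ v n (v n i) ≠ i)) := by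
  have hpp : ∀ n i, p n (p n i) = i := fun n i => by
    rw [← Equiv.Perm.mul_apply, hp]; rfl
  choose I hIE hI hcard using fun n => exists_independent ![p n, v n, p n * v n]
    (Finset.univ.filter (fun i => p n i ≠ i ∧ v n (v n i) ≠ i))
  have hIp : ∀ n, ∀ i ∈ I n, p n i ≠ i := fun n i hi => (Finset.mem_filter.1 (hIE n hi)).2.1
  have hIv : ∀ n, ∀ i ∈ I n, v n (v n i) ≠ i := fun n i hi => (Finset.mem_filter.1 (hIE n hi)).2.2
  have hB : ∀ n, ∀ i ∈ I n ∪ (I n).image (p n), p n i ∈ I n ∪ (I n).image (p n) := by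
    intro n i hi
    rw [Finset.mem_union, Finset.mem_image] at hi ⊢
    rcases hi with hi | ⟨j, hj, rfl⟩
    · exact Or.inr ⟨i, hi, rfl⟩
    · left; rwa [hpp]
  choose t ht1 ht2 using fun n => exists_restrict (p n) (I n ∪ (I n).image (p n)) (hB n)
  have htt : t * t = 1 := by
    funext n
    refine Equiv.ext fun i => ?_
    rw [Pi.mul_apply, Equiv.Perm.mul_apply]
    by_cases hi : i ∈ I n ∪ (I n).image (p n)
    · rw [ht1 n i hi, ht1 n _ (hB n i hi), hpp]; rfl
    · rw [ht2 n i hi, ht2 n i hi]; rfl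
  have hpB : ∀ n, ∀ i ∉ I n ∪ (I n).image (p n), p n i ∉ I n ∪ (I n).image (p n) := by
    intro n i hi h
    have := hB n _ h
    rw [hpp] at this
    exact hi this
  have htp1 : ∀ n, ∀ i ∈ I n ∪ (I n).image (p n), (t n * p n) i = i := by
    intro n i hi
    rw [Equiv.Perm.mul_apply, ht1 n _ (hB n i hi), hpp]
  have htp2 : ∀ n, ∀ i ∉ I n ∪ (I n).image (p n), (t n * p n) i = p n i := by
    intro n i hi
    rw [Equiv.Perm.mul_apply, ht2 n _ (hpB n i hi)]
  have htp : t * p * (t * p) = 1 := by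
    funext n
    refine Equiv.ext fun i => ?_
    rw [Pi.mul_apply, Equiv.Perm.mul_apply, Pi.mul_apply]
    by_cases hi : i ∈ I n ∪ (I n).image (p n)
    · rw [htp1 n i hi, htp1 n i hi]; rfl
    · rw [htp2 n i hi, htp2 n _ (hpB n i hi), hpp]; rfl
  have hmem : (QuotientGroup.mk t : SoficGroup ω) ∈ subInvolutions (QuotientGroup.mk p) := by
    refine ⟨?_, ?_, ?_⟩
    · rw [← QuotientGroup.mk_mul, htt, QuotientGroup.mk_one]
    · rw [← QuotientGroup.mk_mul, ← QuotientGroup.mk_mul, htp, QuotientGroup.mk_one]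
    · rw [← QuotientGroup.mk_mul]
      refine (len_eq hω (((tendsto_len hω t).add (tendsto_len hω (t * p))).congr
        (fun n => ?_))).symm
      rw [← add_div, ← Nat.cast_add, ← Finset.card_union_of_disjoint]
      · congr 3
        ext i
        simp only [Finset.mem_union, Finset.mem_filter, Finset.mem_univ, true_and, Pi.mul_apply]
        by_cases hi : i ∈ I n ∪ (I n).image (p n)
        · rw [ht1 n i hi, htp1 n i hi]; simp
        · rw [ht2 n i hi, htp2 n i hi]; simp
      · rw [Finset.disjoint_left]
        intro i
        simp only [Finset.mem_filter, Finset.mem_univ, true_and, Pi.mul_apply, not_not]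
        intro h
        by_cases hi : i ∈ I n ∪ (I n).image (p n)
        · exact htp1 n i hi
        · exact absurd (ht2 n i hi) h
  have hcomm := hv _ hmem
  rw [← QuotientGroup.mk_mul, ← QuotientGroup.mk_mul, mk_eq_mk_iff] at hcomm
  have hIneg : Negligible ω I := by
    refine hcomm.mono fun n i hi => ?_
    rw [Finset.mem_filter]
    refine ⟨Finset.mem_univ _, ?_⟩
    have hiB : i ∈ I n ∪ (I n).image (p n) := Finset.mem_union_left _ hi
    rw [Pi.mul_apply, Pi.mul_apply, Equiv.Perm.mul_apply, Equiv.Perm.mul_apply, ht1 n i hiB]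
    by_cases h : v n i ∈ I n ∪ (I n).image (p n)
    · rw [Finset.mem_union, Finset.mem_image] at h
      rcases h with h | ⟨j, hj, hji⟩
      · have h1 : v n i = i := hI n 1 i hi h
        exact absurd (by rw [h1, h1]) (hIv n i hi)
      · have h1 : (p n * v n) i = j := by
          rw [Equiv.Perm.mul_apply, ← hji, hpp]
        have h2 : (p n * v n) i = i := hI n 2 i hi (by
          change (p n * v n) i ∈ I n
          rwa [h1])
        have h3 : v n i = p n i := by
          rw [← hpp n (v n i)]
          exact congrArg (p n) h2
        have h4 : t n (p n i) = i := htp1 n i hiB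
        rw [h3, h4, ← h3]
        exact hIv n i hi
    · rw [ht2 n _ h]
      exact fun h' => hIp n i hi ((v n).injective h')
  exact hIneg.of_card_le 7 (fun n => by simpa using hcard n)

/-- Containment of supports implies membership in `supportedIn`: the squares occurring there are
trivial on the support of `p`, so they commute with everything that is supported in it. -/
theorem mk_mem_supportedIn (hω : (ω : Filter ℕ) ≤ atTop) {p g : ∀ n : ℕ, Equiv.Perm (Fin n)}
    (hp : ∀ n, p n * p n = 1)
    (h : Negligible ω (fun n => Finset.univ.filter (fun i => g n i ≠ i ∧ p n i = i))) :
    (QuotientGroup.mk g : SoficGroup ω) ∈ supportedIn (QuotientGroup.mk p) := by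
  intro v hv
  obtain ⟨v, rfl⟩ := QuotientGroup.mk_surjective v
  have h1 := negligible_sq_of_commute hω hp hv
  rw [← QuotientGroup.mk_mul, ← QuotientGroup.mk_mul, ← QuotientGroup.mk_mul, mk_eq_mk_iff]
  -- off a negligible set, `v * v` is the identity on the support of `g`
  have hE : Negligible ω (fun n => Finset.univ.filter (fun i => g n i ≠ i ∧ v n (v n i) ≠ i)) := by
    refine (h.union h1).mono fun n i hi => ?_
    simp only [Finset.mem_union, Finset.mem_filter, Finset.mem_univ, true_and] at hi ⊢
    by_cases hpi : p n i = i
    · exact Or.inl ⟨hi.1, hpi⟩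
    · exact Or.inr ⟨hpi, hi.2⟩
  have hE2 := hE.of_card_le_one (B := fun n => (Finset.univ.filter
    (fun i => g n i ≠ i ∧ v n (v n i) ≠ i)).image (g n).symm) (fun n => Finset.card_image_le)
  have hE3 := hE.of_card_le_one (B := fun n => (Finset.univ.filter
    (fun i => g n i ≠ i ∧ v n (v n i) ≠ i)).image (v n * v n).symm) (fun n => Finset.card_image_le)
  refine ((hE.union hE2).union hE3).mono fun n i hi => ?_
  have himg : ∀ w : Equiv.Perm (Fin n), i ∈ (Finset.univ.filter
      (fun i => g n i ≠ i ∧ v n (v n i) ≠ i)).image w.symm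
      ↔ g n (w i) ≠ w i ∧ v n (v n (w i)) ≠ w i := by
    intro w
    rw [Finset.mem_image]
    constructor
    · rintro ⟨j, hj, rfl⟩
      simpa using hj
    · intro hw
      exact ⟨w i, by simpa using hw, by simp⟩
  rw [Finset.mem_union, Finset.mem_union, himg, himg, Finset.mem_filter]
  rw [Finset.mem_filter] at hi
  by_contra hcon
  simp only [not_or, not_and, not_not, Finset.mem_univ, true_implies, ne_eq,
    Equiv.Perm.mul_apply] at hcon
  obtain ⟨⟨c1, c2⟩, c3⟩ := hcon
  refine hi.2 ?_
  simp only [Pi.mul_apply, Equiv.Perm.mul_apply]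
  by_cases hgi : g n i = i
  · rw [hgi]
    by_contra hne
    have h5 := c3 hne
    have h6 : v n (v n i) = i := (v n).injective ((v n).injective h5)
    rw [h6] at hne
    exact hne hgi
  · rw [c1 hgi, c2 (fun h' => hgi ((g n).injective h'))]

/-- The elements of `subInvolutions π` are supported in the support of `π`. -/
theorem negligible_of_mem_subInvolutions (hω : (ω : Filter ℕ) ≤ atTop)
    {p f : ∀ n : ℕ, Equiv.Perm (Fin n)}
    (hf : (QuotientGroup.mk f : SoficGroup ω) ∈ subInvolutions (QuotientGroup.mk p)) :
    Negligible ω (fun n => Finset.univ.filter (fun i => f n i ≠ i ∧ p n i = i)) := by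
  have h := hf.2.2
  rw [← QuotientGroup.mk_mul] at h
  have h1 := ((tendsto_len hω f).add (tendsto_len hω (f * p))).sub (tendsto_len hω p)
  rw [h, sub_self] at h1
  refine squeeze_zero (fun n => by positivity) (fun n => ?_) h1
  rw [← add_div, ← sub_div]
  gcongr
  rw [le_sub_iff_add_le]
  -- a point moved by `f` and fixed by `p` is moved by `f * p` as well
  have h2 : (Finset.univ.filter (fun i => f n i ≠ i ∧ p n i = i)).card
      + (Finset.univ.filter (fun i => p n i ≠ i)).card
      ≤ (Finset.univ.filter (fun i => f n i ≠ i)).card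
        + (Finset.univ.filter (fun i => (f * p) n i ≠ i)).card := by
    rw [← Finset.card_union_add_card_inter (Finset.univ.filter (fun i => f n i ≠ i)), add_comm]
    refine add_le_add (Finset.card_le_card fun i hi => ?_) (Finset.card_le_card fun i hi => ?_)
    · simp only [Finset.mem_union, Finset.mem_filter, Finset.mem_univ, true_and] at hi ⊢
      rw [Pi.mul_apply, Equiv.Perm.mul_apply]
      by_contra hcon
      simp only [not_or, not_not, ne_eq] at hcon
      refine hi ((f n).injective ?_)
      rw [hcon.2, hcon.1]
    · simp only [Finset.mem_inter, Finset.mem_filter, Finset.mem_univ, true_and] at hi ⊢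
      rw [Pi.mul_apply, Equiv.Perm.mul_apply, hi.2]
      exact ⟨hi.1, hi.1⟩
  exact_mod_cast h2

/-- Elements with disjoint supports commute. -/
theorem mk_commute_of_disjoint {f g : ∀ n : ℕ, Equiv.Perm (Fin n)}
    (h : Negligible ω (fun n => Finset.univ.filter (fun i => f n i ≠ i ∧ g n i ≠ i))) :
    (QuotientGroup.mk g : SoficGroup ω) * QuotientGroup.mk f
      = QuotientGroup.mk f * QuotientGroup.mk g := by
  rw [← QuotientGroup.mk_mul, ← QuotientGroup.mk_mul, mk_eq_mk_iff]
  have hf := h.of_card_le_one (B := fun n => (Finset.univ.filter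
    (fun i => f n i ≠ i ∧ g n i ≠ i)).image (f n).symm) (fun n => Finset.card_image_le)
  have hg := h.of_card_le_one (B := fun n => (Finset.univ.filter
    (fun i => f n i ≠ i ∧ g n i ≠ i)).image (g n).symm) (fun n => Finset.card_image_le)
  refine ((h.union hf).union hg).mono fun n i hi => ?_
  simp only [Finset.mem_union, Finset.mem_filter, Finset.mem_univ, true_and, Finset.mem_image]
    at hi ⊢
  rw [Pi.mul_apply, Pi.mul_apply, Equiv.Perm.mul_apply, Equiv.Perm.mul_apply] at hi
  by_contra hcon
  simp only [not_or, not_exists, not_and, not_not, ne_eq] at hcon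
  obtain ⟨⟨c1, c2⟩, c3⟩ := hcon
  by_cases hfi : f n i = i
  · by_cases hgi : g n i = i
    · exact hi (by rw [hfi, hgi, hfi])
    · have h1 : f n (g n i) = g n i := by
        by_contra hne
        exact c3 (g n i) ⟨hne, fun h' => hgi ((g n).injective h')⟩ (by simp)
      exact hi (by rw [hfi, h1])
  · have hgi := c1 hfi
    have h1 : g n (f n i) = f n i := by
      by_contra hne
      exact c2 (f n i) ⟨fun h' => hfi ((f n).injective h'), hne⟩ (by simp)
    exact hi (by rw [hgi, h1])

/-- Membership in `supportedIn` implies containment of supports. If `g` moved many points off the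
support of `p`, there would be a cycle on such points, commuting with all involutions below `p`,
whose square does not commute with `g`. -/
theorem negligible_of_mk_mem_supportedIn (hω : (ω : Filter ℕ) ≤ atTop)
    {p g : ∀ n : ℕ, Equiv.Perm (Fin n)}
    (h : (QuotientGroup.mk g : SoficGroup ω) ∈ supportedIn (QuotientGroup.mk p)) :
    Negligible ω (fun n => Finset.univ.filter (fun i => g n i ≠ i ∧ p n i = i)) := by
  choose I hIE hI hcard using fun n => exists_independent (fun _ : Unit => g n)
    (Finset.univ.filter (fun i => g n i ≠ i ∧ p n i = i))
  have hIg : ∀ n, ∀ i ∈ I n, g n i ∉ I n := fun n i hi hgi =>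
    (Finset.mem_filter.1 (hIE n hi)).2.1 (hI n () i hi hgi)
  have hIp : ∀ n, ∀ i ∈ I n, p n i = i := fun n i hi => (Finset.mem_filter.1 (hIE n hi)).2.2
  -- a cycle `v` on `I` commutes with everything that is supported in the support of `p`
  choose v hv hvs using fun n => (I n).exists_cycleOn
  have hvI : ∀ n i, v n i ≠ i → i ∈ I n := fun n i hi => hvs n (Equiv.Perm.mem_support.2 hi)
  have hcomm := h (QuotientGroup.mk v) (by
    intro φ hφ
    obtain ⟨f, rfl⟩ := QuotientGroup.mk_surjective φ
    refine mk_commute_of_disjoint ((negligible_of_mem_subInvolutions hω hφ).mono fun n i hi => ?_)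
    simp only [Finset.mem_filter, Finset.mem_univ, true_and] at hi ⊢
    exact ⟨hi.1, hIp n i (hvI n i hi.2)⟩)
  rw [← QuotientGroup.mk_mul, ← QuotientGroup.mk_mul, ← QuotientGroup.mk_mul, mk_eq_mk_iff] at hcomm
  have hIneg : Negligible ω I := by
    refine hcomm.of_card_le_add hω 2 fun n => ?_
    rcases le_or_gt (I n).card 2 with hle | hlt
    · omega
    · refine (Finset.card_le_card fun i hi => ?_).trans (Nat.le_add_right _ 2)
      rw [Finset.mem_filter]
      refine ⟨Finset.mem_univ _, ?_⟩
      simp only [Pi.mul_apply, Equiv.Perm.mul_apply]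
      have h1 : v n (v n i) ≠ i := by
        intro h'
        have h2 := ((hv n).pow_apply_eq hi (n := 2)).1 (by
          rw [pow_two, Equiv.Perm.mul_apply, h'])
        exact absurd (Nat.le_of_dvd (by norm_num) h2) (by omega)
      have h2 : v n (g n i) = g n i := by
        by_contra h'
        exact hIg n i hi (hvI n _ h')
      rw [h2, h2]
      exact fun h' => h1 ((g n).injective h')
  exact hIneg.of_card_le 3 (fun n => by simpa using hcard n)

theorem len_le_of_mem_supportedIn (hω : (ω : Filter ℕ) ≤ atTop) {s π : SoficGroup ω}
    (h : s ∈ supportedIn π) : len s ≤ len π := by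
  obtain ⟨g, rfl⟩ := QuotientGroup.mk_surjective s
  obtain ⟨p, rfl⟩ := QuotientGroup.mk_surjective π
  have h1 := negligible_of_mk_mem_supportedIn hω h
  have h2 := (tendsto_len hω p).add h1
  rw [add_zero] at h2
  refine le_of_tendsto_of_tendsto' (tendsto_len hω g) h2 (fun n => ?_)
  rw [← add_div]
  gcongr
  rw [← Nat.cast_add, Nat.cast_le]
  refine (Finset.card_le_card fun i hi => ?_).trans (Finset.card_union_le _ _)
  simp only [Finset.mem_union, Finset.mem_filter, Finset.mem_univ, true_and] at hi ⊢
  by_cases hp : p n i = i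
  · exact Or.inr ⟨hi, hp⟩
  · exact Or.inl hp

/-- Every element is supported in the support of an involution of the same length. -/
theorem exists_involution_supportedIn (hω : (ω : Filter ℕ) ≤ atTop) (s : SoficGroup ω) :
    ∃ π : SoficGroup ω, π * π = 1 ∧ len π = len s ∧ s ∈ supportedIn π := by
  obtain ⟨g, rfl⟩ := QuotientGroup.mk_surjective s
  choose p hp hps hpc using fun n =>
    exists_involution_on (Finset.univ.filter (fun i => g n i ≠ i))
  have hneg : Negligible ω (fun n => Finset.univ.filter (fun i => g n i ≠ i ∧ p n i = i)) := by
    refine Negligible.of_card_bounded hω 1 fun n => ?_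
    rw [← Finset.filter_filter]
    exact hpc n
  have hmem := mk_mem_supportedIn hω hp hneg
  refine ⟨QuotientGroup.mk p, ?_, le_antisymm ?_ (len_le_of_mem_supportedIn hω hmem), hmem⟩
  · rw [← QuotientGroup.mk_mul]
    congr 1
    exact funext hp
  · refine le_of_tendsto_of_tendsto' (tendsto_len hω p) (tendsto_len hω g) (fun n => ?_)
    refine div_le_div_of_nonneg_right (Nat.cast_le.2 (Finset.card_le_card fun i hi => ?_))
      (Nat.cast_nonneg n)
    exact hps n i (Finset.mem_filter.1 hi).2

theorem map_mem_supportedIn (hω : (ω : Filter ℕ) ≤ atTop) (Φ : SoficGroup ω ≃* SoficGroup ω)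
    {s π : SoficGroup ω} (hπ : π * π = 1) (h : s ∈ supportedIn π) : Φ s ∈ supportedIn (Φ π) := by
  intro v hv
  have h1 := h (Φ.symm v) (by
    rintro φ ⟨hφ1, hφ2, hφ3⟩
    have h2 := hv (Φ φ) ⟨mulEquiv_involution Φ hφ1, by
      rw [← map_mul]; exact mulEquiv_involution Φ hφ2, by
      rw [← map_mul, len_map_of_involution hω Φ hφ1, len_map_of_involution hω Φ hφ2,
        len_map_of_involution hω Φ hπ, hφ3]⟩
    apply Φ.injective
    rwa [map_mul, map_mul, MulEquiv.apply_symm_apply])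
  have h2 := congrArg Φ h1
  simpa only [map_mul, MulEquiv.apply_symm_apply] using h2

theorem len_map_le (hω : (ω : Filter ℕ) ≤ atTop) (Φ : SoficGroup ω ≃* SoficGroup ω)
    (s : SoficGroup ω) : len (Φ s) ≤ len s := by
  obtain ⟨π, hπ, hl, hs⟩ := exists_involution_supportedIn hω s
  rw [← hl, ← len_map_of_involution hω Φ hπ]
  exact len_le_of_mem_supportedIn hω (map_mem_supportedIn hω Φ hπ hs)

/-- Every automorphism of the universal sofic group is isometric. -/
theorem len_map (hω : (ω : Filter ℕ) ≤ atTop) (Φ : SoficGroup ω ≃* SoficGroup ω)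
    (s : SoficGroup ω) : len (Φ s) = len s := by
  refine le_antisymm (len_map_le hω Φ s) ?_
  have h := len_map_le hω Φ.symm (Φ s)
  rwa [MulEquiv.symm_apply_apply] at h

theorem trace_map (hω : (ω : Filter ℕ) ≤ atTop) (Φ : SoficGroup ω ≃* SoficGroup ω)
    (s : SoficGroup ω) : trace ω (soficEmb ω (Φ s)) = trace ω (soficEmb ω s) := by
  rw [trace_soficEmb hω, trace_soficEmb hω, len_map hω]

end Sofic

/-! ### The weak operator topology -/

section WOT

variable {H : Type*} [NormedAddCommGroup H] [InnerProductSpace ℂ H]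

theorem continuous_wot_inner (v w : H) :
    @Continuous _ _ (wot H) _ (fun T : H →L[ℂ] H => ⟪v, T w⟫_ℂ) := by
  let _ := wot H
  exact (ContinuousLinearMapWOT.continuous_dual_apply w (innerSL ℂ v)).comp continuous_induced_dom

/-- On bounded sets, the weak operator topology is determined by the matrix coefficients of the
vectors from a dense set. -/
theorem tendsto_inner_of_dense {ι : Type*} {l : Filter ι} {T : ι → H →L[ℂ] H} {S : H →L[ℂ] H}
    {C : ℝ} (hC : ∀ᶠ i in l, ‖T i‖ ≤ C) {D : Set H} (hD : Dense D)
    (h : ∀ v ∈ D, ∀ w ∈ D, Tendsto (fun i => ⟪v, T i w⟫_ℂ) l (𝓝 ⟪v, S w⟫_ℂ)) (v w : H) :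
    Tendsto (fun i => ⟪v, T i w⟫_ℂ) l (𝓝 ⟪v, S w⟫_ℂ) := by
  -- first extend in the second variable, then in the first one
  have step : ∀ (f : ι → H → ℂ) (g : H → ℂ) (K : ℝ), 0 ≤ K →
      (∀ᶠ i in l, ∀ a b, ‖f i a - f i b‖ ≤ K * ‖a - b‖) → (∀ a b, ‖g a - g b‖ ≤ K * ‖a - b‖) →
      (∀ a ∈ D, Tendsto (fun i => f i a) l (𝓝 (g a))) →
      ∀ a, Tendsto (fun i => f i a) l (𝓝 (g a)) := by
    intro f g K hK hf hg hfg a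
    rw [Metric.tendsto_nhds]
    intro ε hε
    obtain ⟨b, hb, hab⟩ := Metric.dense_iff.1 hD a (ε / (3 * (K + 1))) (by positivity)
    rw [Metric.mem_ball, dist_eq_norm] at hb
    have hK1 : K * ‖a - b‖ ≤ ε / 3 := by
      rw [norm_sub_rev]
      calc K * ‖b - a‖ ≤ (K + 1) * (ε / (3 * (K + 1))) := by gcongr; linarith
        _ = ε / 3 := by field_simp
    filter_upwards [hf, Metric.tendsto_nhds.1 (hfg b hab) (ε / 3) (by positivity)] with i h1 h2
    rw [dist_eq_norm] at h2 ⊢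
    have h3 := h1 a b
    have h4 := hg b a
    rw [norm_sub_rev b a] at h4
    have h5 : f i a - g a = (f i a - f i b) + (f i b - g b) + (g b - g a) := by ring
    rw [h5]
    refine (norm_add₃_le).trans_lt ?_
    linarith
  have hop : ∀ (R : H →L[ℂ] H) (v a b : H),
      ‖⟪v, R a⟫_ℂ - ⟪v, R b⟫_ℂ‖ ≤ ‖v‖ * ‖R‖ * ‖a - b‖ := by
    intro R v a b
    rw [← inner_sub_right, ← map_sub, mul_assoc]
    exact (norm_inner_le_norm _ _).trans (by gcongr; exact R.le_opNorm _)
  have hop' : ∀ (R : H →L[ℂ] H) (w a b : H),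
      ‖⟪a, R w⟫_ℂ - ⟪b, R w⟫_ℂ‖ ≤ ‖R‖ * ‖w‖ * ‖a - b‖ := by
    intro R w a b
    rw [← inner_sub_left, mul_comm]
    exact (norm_inner_le_norm _ _).trans (by gcongr; exact R.le_opNorm _)
  have hC0 : ∀ᶠ i in l, ‖T i‖ ≤ max C ‖S‖ := hC.mono fun i hi => hi.trans (le_max_left _ _)
  have hS0 : 0 ≤ max C ‖S‖ := (norm_nonneg S).trans (le_max_right _ _)
  have h1 : ∀ v ∈ D, ∀ w, Tendsto (fun i => ⟪v, T i w⟫_ℂ) l (𝓝 ⟪v, S w⟫_ℂ) := by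
    intro v hv
    refine step (fun i w => ⟪v, T i w⟫_ℂ) (fun w => ⟪v, S w⟫_ℂ) (‖v‖ * max C ‖S‖) (by positivity)
      ?_ ?_ (h v hv)
    · filter_upwards [hC0] with i hi a b
      exact (hop (T i) v a b).trans (by gcongr)
    · intro a b
      exact (hop S v a b).trans (by gcongr; exact le_max_right _ _)
  refine step (fun i v => ⟪v, T i w⟫_ℂ) (fun v => ⟪v, S w⟫_ℂ) (max C ‖S‖ * ‖w‖) (by positivity)
      ?_ ?_ (fun v hv => h1 v hv w) v
  · filter_upwards [hC0] with i hi a b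
    exact (hop' (T i) w a b).trans (by gcongr)
  · intro a b
    exact (hop' S w a b).trans (by gcongr; exact le_max_right _ _)

variable [CompleteSpace H]

theorem tendsto_wot_iff {ι : Type*} {l : Filter ι} {T : ι → H →L[ℂ] H} {S : H →L[ℂ] H} :
    Tendsto T l (@nhds _ (wot H) S) ↔ ∀ v w, Tendsto (fun i => ⟪v, T i w⟫_ℂ) l (𝓝 ⟪v, S w⟫_ℂ) := by
  rw [nhds_induced, tendsto_comap_iff,
    ContinuousLinearMapWOT.tendsto_iff_forall_inner_apply_tendsto]
  exact ⟨fun h v w => h w v, fun h w v => h v w⟩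

/-- The commutant of a set is closed in the weak operator topology. -/
theorem isClosed_wot_centralizer (E : Set (H →L[ℂ] H)) :
    IsClosed[wot H] (StarSubalgebra.centralizer ℂ E : Set (H →L[ℂ] H)) := by
  let _ := wot H
  have h1 : (StarSubalgebra.centralizer ℂ E : Set (H →L[ℂ] H))
      = ⋂ g ∈ E ∪ star E, ⋂ v : H, ⋂ w : H, {T | ⟪star g v, T w⟫_ℂ = ⟪v, T (g w)⟫_ℂ} := by
    ext T
    rw [StarSubalgebra.coe_centralizer, Set.mem_centralizer_iff]
    simp only [Set.mem_iInter, Set.mem_ofPred_eq]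
    refine forall₂_congr fun g _ => ⟨fun h v w => ?_, fun h => ?_⟩
    · rw [ContinuousLinearMap.star_eq_adjoint, ContinuousLinearMap.adjoint_inner_left]
      exact congrArg (fun R : H →L[ℂ] H => ⟪v, R w⟫_ℂ) h
    · refine ContinuousLinearMap.ext fun w => ext_inner_left ℂ fun v => ?_
      have h2 := h v w
      rw [ContinuousLinearMap.star_eq_adjoint, ContinuousLinearMap.adjoint_inner_left] at h2
      exact h2
  rw [h1]
  exact isClosed_biInter fun g _ => isClosed_iInter fun v => isClosed_iInter fun w =>
    isClosed_eq (continuous_wot_inner _ _) (continuous_wot_inner _ _)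

theorem vNGenerated_le_centralizer {E F : Set (H →L[ℂ] H)}
    (h : E ⊆ (StarSubalgebra.centralizer ℂ F : Set (H →L[ℂ] H))) :
    vNGenerated E ≤ StarSubalgebra.centralizer ℂ F :=
  sInf_le (show _ ∈ {_A : StarSubalgebra ℂ (H →L[ℂ] H) | _} from ⟨h, isClosed_wot_centralizer F⟩)

theorem mem_vNGenerated_of_tendsto {E : Set (H →L[ℂ] H)} {ι : Type*} {l : Filter ι} [l.NeBot]
    {T : ι → H →L[ℂ] H} {S : H →L[ℂ] H}
    (h : ∀ v w, Tendsto (fun i => ⟪v, T i w⟫_ℂ) l (𝓝 ⟪v, S w⟫_ℂ))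
    (hT : ∀ᶠ i in l, T i ∈ vNGenerated E) : S ∈ vNGenerated E := by
  let _ := wot H
  exact (isClosed_vNGenerated E).mem_of_tendsto (tendsto_wot_iff.2 h) hT

/-- A von Neumann algebra is closed in the norm topology. -/
theorem isClosed_norm_vNGenerated (E : Set (H →L[ℂ] H)) :
    IsClosed (vNGenerated E : Set (H →L[ℂ] H)) := by
  refine isClosed_of_closure_subset fun S hS => ?_
  obtain ⟨T, hT, hlim⟩ := mem_closure_iff_seq_limit.1 hS
  refine mem_vNGenerated_of_tendsto (l := atTop) (fun v w => ?_) (Eventually.of_forall hT)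
  exact tendsto_const_nhds.inner (((ContinuousLinearMap.apply ℂ H w).continuous.tendsto S).comp hlim)

end WOT

/-! ### The vectors of bounded sequences and right multiplication -/

section Vec

variable {ω : Ultrafilter ℕ}

/-- The vector of `L²(ℳ)` given by a bounded sequence. -/
noncomputable def vec (ω : Ultrafilter ℕ) : BddSeq →ₗ[ℂ] L2 ω :=
  (UniformSpace.Completion.toComplL (𝕜 := ℂ) (E := PreL2 ω)).toLinearMap ∘ₗ
    (toPreL2 ω).toLinearMap

theorem vec_apply (x : BddSeq) : vec ω x = ((toPreL2 ω x : PreL2 ω) : L2 ω) := rfl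

theorem vec_one : vec ω 1 = oneVec ω := rfl

theorem dense_range_vec : Dense (Set.range (vec ω)) := by
  have h := UniformSpace.Completion.denseRange_coe (α := PreL2 ω)
  refine h.mono ?_
  rintro _ ⟨y, rfl⟩
  exact ⟨(toPreL2 ω).symm y, rfl⟩

theorem inner_vec (x y : BddSeq) : ⟪vec ω x, vec ω y⟫_ℂ = traceLim ω (star x * y) := by
  rw [vec_apply, vec_apply, UniformSpace.Completion.inner_coe, preL2_inner]

theorem norm_vec (x : BddSeq) : ‖vec ω x‖ = ‖toPreL2 ω x‖ := by
  rw [vec_apply, UniformSpace.Completion.norm_coe]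

theorem norm_vec_star (x : BddSeq) : ‖vec ω (star x)‖ = ‖vec ω x‖ := by
  rw [norm_vec, norm_vec, preL2_norm_star]

theorem leftMul_vec (x y : BddSeq) : leftMul ω x (vec ω y) = vec ω (x * y) := leftMul_coe ω x y

theorem leftMul_oneVec (x : BddSeq) : leftMul ω x (oneVec ω) = vec ω x := by
  rw [← vec_one, leftMul_vec, mul_one]

theorem norm_leftMul_le (x : BddSeq) {C : ℝ} (hC : ∀ n, ‖x.1 n‖ ≤ C) : ‖leftMul ω x‖ ≤ C := by
  have hC0 : 0 ≤ C := (norm_nonneg _).trans (hC 0)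
  refine ContinuousLinearMap.opNorm_le_bound _ hC0 fun v => ?_
  induction v using UniformSpace.Completion.induction_on with
  | hp => exact isClosed_le (by fun_prop) (by fun_prop)
  | ih v =>
    have h := norm_mul_le_preL2 ω x ((toPreL2 ω).symm v) hC
    rw [← norm_vec, ← norm_vec, ← leftMul_vec] at h
    exact h

/-- Right multiplication by a bounded sequence, on the pre-Hilbert space. -/
noncomputable def rightMulPre (ω : Ultrafilter ℕ) (x : BddSeq) : PreL2 ω →L[ℂ] PreL2 ω :=
  ((toPreL2 ω).toLinearMap ∘ₗ LinearMap.mulRight ℂ x ∘ₗ (toPreL2 ω).symm.toLinearMap).mkContinuousOfExistsBound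
    (by
      obtain ⟨C, hC⟩ := (star x).2
      refine ⟨C, fun y => ?_⟩
      have h := norm_mul_le_preL2 ω (star x) (star ((toPreL2 ω).symm y)) hC
      rw [← star_mul, preL2_norm_star, preL2_norm_star] at h
      exact h)

/-- The operator of right multiplication by a bounded sequence on `L²(ℳ)`. -/
noncomputable def rightMul (ω : Ultrafilter ℕ) (x : BddSeq) : L2 ω →L[ℂ] L2 ω :=
  (rightMulPre ω x).completion

theorem rightMul_vec (x y : BddSeq) : rightMul ω x (vec ω y) = vec ω (y * x) := by
  rw [rightMul, vec_apply, ContinuousLinearMap.completion_apply_coe]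
  rfl

theorem rightMul_oneVec (x : BddSeq) : rightMul ω x (oneVec ω) = vec ω x := by
  rw [← vec_one, rightMul_vec, one_mul]

theorem inner_rightMul_left (x : BddSeq) (v w : L2 ω) :
    ⟪rightMul ω x v, w⟫_ℂ = ⟪v, rightMul ω (star x) w⟫_ℂ := by
  induction v, w using UniformSpace.Completion.induction_on₂ with
  | hp => apply isClosed_eq <;> fun_prop
  | ih a b =>
    change ⟪rightMul ω x (vec ω ((toPreL2 ω).symm a)), vec ω ((toPreL2 ω).symm b)⟫_ℂ
      = ⟪vec ω ((toPreL2 ω).symm a), rightMul ω (star x) (vec ω ((toPreL2 ω).symm b))⟫_ℂ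
    rw [rightMul_vec, rightMul_vec, inner_vec, inner_vec, star_mul, mul_assoc, traceLim_mul_comm,
      mul_assoc]

theorem star_rightMul (x : BddSeq) : star (rightMul ω x) = rightMul ω (star x) := by
  rw [ContinuousLinearMap.star_eq_adjoint, eq_comm, ContinuousLinearMap.eq_adjoint_iff]
  intro v w
  rw [inner_rightMul_left, star_star]

/-- The commutant of the right multiplications, a von Neumann algebra that contains `ℳ`. -/
noncomputable def rightCommutant (ω : Ultrafilter ℕ) : StarSubalgebra ℂ (L2 ω →L[ℂ] L2 ω) :=
  StarSubalgebra.centralizer ℂ (Set.range (rightMul ω))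

theorem mem_rightCommutant {T : L2 ω →L[ℂ] L2 ω} :
    T ∈ rightCommutant ω ↔ ∀ x, rightMul ω x * T = T * rightMul ω x := by
  rw [rightCommutant, StarSubalgebra.mem_centralizer_iff, Set.forall_mem_range]
  refine ⟨fun h x => (h x).1, fun h x => ⟨h x, ?_⟩⟩
  rw [star_rightMul, h]

theorem leftMul_mem_rightCommutant (x : BddSeq) : leftMul ω x ∈ rightCommutant ω := by
  refine mem_rightCommutant.2 fun y => clm_ext fun z => ?_
  change rightMul ω y (leftMul ω x (vec ω z)) = leftMul ω x (rightMul ω y (vec ω z))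
  rw [leftMul_vec, rightMul_vec, rightMul_vec, leftMul_vec, mul_assoc]

theorem apply_vec_of_mem {T : L2 ω →L[ℂ] L2 ω} (hT : T ∈ rightCommutant ω) (x : BddSeq) :
    T (vec ω x) = rightMul ω x (T (oneVec ω)) := by
  rw [← rightMul_oneVec]
  exact (congrArg (fun R : L2 ω →L[ℂ] L2 ω => R (oneVec ω)) (mem_rightCommutant.1 hT x)).symm

/-- The vector `1̂` is separating for the commutant of the right multiplications. -/
theorem eq_of_apply_oneVec {S T : L2 ω →L[ℂ] L2 ω} (hS : S ∈ rightCommutant ω)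
    (hT : T ∈ rightCommutant ω) (h : S (oneVec ω) = T (oneVec ω)) : S = T := by
  refine clm_ext fun x => ?_
  rw [← vec_apply, apply_vec_of_mem hS, apply_vec_of_mem hT, h]

theorem norm_star_apply_oneVec_le {T : L2 ω →L[ℂ] L2 ω} (hT : T ∈ rightCommutant ω) :
    ‖star T (oneVec ω)‖ ≤ ‖T (oneVec ω)‖ := by
  have h1 : ∀ v : L2 ω, ‖⟪v, star T (oneVec ω)⟫_ℂ‖ ≤ ‖v‖ * ‖T (oneVec ω)‖ := by
    intro v
    induction v using UniformSpace.Completion.induction_on with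
    | hp => exact isClosed_le (by fun_prop) (by fun_prop)
    | ih v =>
      change ‖⟪vec ω ((toPreL2 ω).symm v), star T (oneVec ω)⟫_ℂ‖
        ≤ ‖vec ω ((toPreL2 ω).symm v)‖ * ‖T (oneVec ω)‖
      rw [ContinuousLinearMap.star_eq_adjoint, ContinuousLinearMap.adjoint_inner_right,
        apply_vec_of_mem hT, inner_rightMul_left, rightMul_oneVec, mul_comm, ← norm_vec_star]
      exact norm_inner_le_norm _ _
  have h2 := h1 (star T (oneVec ω))
  rw [inner_self_eq_norm_sq_to_K, norm_pow, RCLike.norm_ofReal, abs_norm, pow_two] at h2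
  by_cases h0 : ‖star T (oneVec ω)‖ = 0
  · rw [h0]; exact norm_nonneg _
  · exact le_of_mul_le_mul_left h2 (lt_of_le_of_ne (norm_nonneg _) (Ne.symm h0))

/-- The trace property, in terms of the `2`-norm. -/
theorem norm_star_apply_oneVec {T : L2 ω →L[ℂ] L2 ω} (hT : T ∈ rightCommutant ω) :
    ‖star T (oneVec ω)‖ = ‖T (oneVec ω)‖ := by
  refine le_antisymm (norm_star_apply_oneVec_le hT) ?_
  have h := norm_star_apply_oneVec_le (star_mem hT)
  rwa [star_star] at h

/-- The `2`-norm satisfies `‖T S‖₂ ≤ ‖S‖ ‖T‖₂`. -/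
theorem norm_apply_apply_oneVec_le {S T : L2 ω →L[ℂ] L2 ω} (hS : S ∈ rightCommutant ω)
    (hT : T ∈ rightCommutant ω) : ‖T (S (oneVec ω))‖ ≤ ‖S‖ * ‖T (oneVec ω)‖ := by
  rw [← norm_star_apply_oneVec hT, ← norm_star (x := S)]
  have h := norm_star_apply_oneVec (mul_mem hT hS)
  rw [star_mul] at h
  change ‖star S (star T (oneVec ω))‖ = ‖T (S (oneVec ω))‖ at h
  rw [← h]
  exact (star S).le_opNorm _

/-- A bounded sequence in the commutant of the right multiplications that converges at `1̂` converges
in the weak operator topology. -/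
theorem exists_tendsto_of_apply_oneVec {T : ℕ → L2 ω →L[ℂ] L2 ω} {C : ℝ}
    (hT : ∀ k, T k ∈ rightCommutant ω) (hC : ∀ k, ‖T k‖ ≤ C) {ξ : L2 ω}
    (hξ : Tendsto (fun k => T k (oneVec ω)) atTop (𝓝 ξ)) :
    ∃ S : L2 ω →L[ℂ] L2 ω, S (oneVec ω) = ξ ∧
      ∀ v w, Tendsto (fun k => ⟪v, T k w⟫_ℂ) atTop (𝓝 ⟪v, S w⟫_ℂ) := by
  have hlim : ∀ x, Tendsto (fun k => T k (vec ω x)) atTop (𝓝 (rightMul ω x ξ)) := by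
    intro x
    refine (((rightMul ω x).continuous.tendsto ξ).comp hξ).congr fun k => ?_
    exact (apply_vec_of_mem (hT k) x).symm
  -- the limit operator, on the dense subspace
  let S₀ : PreL2 ω →ₗ[ℂ] L2 ω :=
    { toFun := fun y => rightMul ω ((toPreL2 ω).symm y) ξ
      map_add' := fun y z => by
        refine tendsto_nhds_unique (hlim _) ?_
        refine ((hlim ((toPreL2 ω).symm y)).add (hlim ((toPreL2 ω).symm z))).congr fun k => ?_
        rw [map_add, map_add, map_add]
      map_smul' := fun c y => by
        refine tendsto_nhds_unique (hlim _) ?_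
        refine ((hlim ((toPreL2 ω).symm y)).const_smul c).congr fun k => ?_
        rw [map_smul, map_smul, map_smul] }
  have hS₀ : ∀ y, ‖S₀ y‖ ≤ C * ‖y‖ := by
    intro y
    refine le_of_tendsto' (hlim ((toPreL2 ω).symm y)).norm fun k => ?_
    refine ((T k).le_opNorm _).trans ?_
    rw [norm_vec, LinearEquiv.apply_symm_apply]
    gcongr
    exact hC k
  let S : L2 ω →L[ℂ] L2 ω := (S₀.mkContinuous C hS₀).extend
    (UniformSpace.Completion.toComplL (𝕜 := ℂ) (E := PreL2 ω))
  have hS : ∀ x, S (vec ω x) = rightMul ω x ξ := by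
    intro x
    exact ContinuousLinearMap.extend_eq (S₀.mkContinuous C hS₀)
      (e := UniformSpace.Completion.toComplL (𝕜 := ℂ) (E := PreL2 ω))
      UniformSpace.Completion.denseRange_coe
      (UniformSpace.Completion.isUniformInducing_coe _) (toPreL2 ω x)
  refine ⟨S, ?_, ?_⟩
  · refine tendsto_nhds_unique ?_ hξ
    rw [← vec_one, hS]
    exact hlim 1
  · refine tendsto_inner_of_dense (Eventually.of_forall hC) dense_range_vec ?_
    rintro v - _ ⟨x, rfl⟩
    rw [hS]
    exact tendsto_const_nhds.inner (hlim x)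

end Vec

/-! ### The universal sofic group in `W*(𝒮)` -/

section Emb

variable {ω : Ultrafilter ℕ}

theorem soficEmb_mk (g : ∀ n : ℕ, Equiv.Perm (Fin n)) :
    soficEmb ω (QuotientGroup.mk g) = leftMul ω (permSeq g) := rfl

theorem star_permSeq (g : ∀ n : ℕ, Equiv.Perm (Fin n)) : star (permSeq g) = permSeq g⁻¹ :=
  Subtype.ext (funext fun _ => Matrix.conjTranspose_permMatrix _)

theorem star_soficEmb (s : SoficGroup ω) : star (soficEmb ω s) = soficEmb ω s⁻¹ := by
  obtain ⟨g, rfl⟩ := QuotientGroup.mk_surjective s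
  rw [← QuotientGroup.mk_inv, soficEmb_mk, soficEmb_mk, ← map_star, star_permSeq]

theorem norm_soficEmb_le (s : SoficGroup ω) : ‖soficEmb ω s‖ ≤ 1 := by
  obtain ⟨g, rfl⟩ := QuotientGroup.mk_surjective s
  exact norm_leftMul_le _ fun _ => Matrix.permMatrix_l2_opNorm_le _

theorem soficEmb_mem_rightCommutant (s : SoficGroup ω) : soficEmb ω s ∈ rightCommutant ω := by
  obtain ⟨g, rfl⟩ := QuotientGroup.mk_surjective s
  exact leftMul_mem_rightCommutant _

theorem soficEmb_mem_WS (s : SoficGroup ω) : soficEmb ω s ∈ WS ω :=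
  subset_vNGenerated _ ⟨s, rfl⟩

theorem WS_le_rightCommutant : WS ω ≤ rightCommutant ω := by
  refine vNGenerated_le_centralizer ?_
  rintro _ ⟨s, rfl⟩
  exact soficEmb_mem_rightCommutant s

/-- Every element of the universal sofic group acts on `L²(ℳ)` by right multiplication. -/
theorem exists_rightMul (s : SoficGroup ω) :
    ∃ x : BddSeq, vec ω x = soficEmb ω s (oneVec ω) := by
  obtain ⟨g, rfl⟩ := QuotientGroup.mk_surjective s
  exact ⟨permSeq g, (leftMul_oneVec _).symm⟩

end Emb

/-! ### The Loeb algebra -/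

section Loeb

variable {ω : Ultrafilter ℕ}

/-- The bounded sequence of diagonal matrices with the given entries. -/
def diagSeq (f : ∀ n : ℕ, Fin n → ℂ) (hf : ∃ C : ℝ, ∀ n i, ‖f n i‖ ≤ C) : BddSeq :=
  ⟨fun n => Matrix.diagonal (f n), by
    obtain ⟨C, hC⟩ := hf
    refine ⟨max C 0, fun n => ?_⟩
    rw [Matrix.l2_opNorm_diagonal, pi_norm_le_iff_of_nonneg (le_max_right _ _)]
    exact fun i => (hC n i).trans (le_max_left _ _)⟩

theorem norm_leftMul_diagSeq_le {f : ∀ n : ℕ, Fin n → ℂ} (hf : ∃ C : ℝ, ∀ n i, ‖f n i‖ ≤ C)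
    {C : ℝ} (hC0 : 0 ≤ C) (hC : ∀ n i, ‖f n i‖ ≤ C) : ‖leftMul ω (diagSeq f hf)‖ ≤ C := by
  refine norm_leftMul_le _ fun n => ?_
  change ‖Matrix.diagonal (f n)‖ ≤ C
  rw [Matrix.l2_opNorm_diagonal, pi_norm_le_iff_of_nonneg hC0]
  exact hC n

theorem mem_loebAlgebra_iff {T : L2 ω →L[ℂ] L2 ω} :
    T ∈ loebAlgebra ω ↔ ∃ f hf, leftMul ω (diagSeq f hf) = T := by
  rw [loebAlgebra, StarSubalgebra.mem_map]
  constructor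
  · rintro ⟨x, hx, rfl⟩
    obtain ⟨C, hC⟩ := x.2
    refine ⟨fun n => (x.1 n).diag, ⟨C, fun n i => (norm_entry_le _ _ _).trans (hC n)⟩, ?_⟩
    congr 1
    exact Subtype.ext (funext fun n => (hx n).diagonal_diag)
  · rintro ⟨f, hf, rfl⟩
    exact ⟨diagSeq f hf, fun n => Matrix.isDiag_diagonal _, rfl⟩

theorem diagSeq_sub (f g : ∀ n : ℕ, Fin n → ℂ) (hf hg) (hfg) :
    diagSeq (fun n i => f n i - g n i) hfg = diagSeq f hf - diagSeq g hg :=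
  Subtype.ext (funext fun _ => (Matrix.diagonal_sub _ _).symm)

theorem diagSeq_mul (f g : ∀ n : ℕ, Fin n → ℂ) (hf hg) (hfg) :
    diagSeq (fun n i => f n i * g n i) hfg = diagSeq f hf * diagSeq g hg :=
  Subtype.ext (funext fun _ => (Matrix.diagonal_mul_diagonal _ _).symm)

theorem normTwoSq_diagonal {n : ℕ} (d : Fin n → ℂ) :
    normTwoSq (Matrix.diagonal d) = (∑ i, ‖d i‖ ^ 2) / n := by
  have h : star (Matrix.diagonal d) * Matrix.diagonal d
      = Matrix.diagonal (fun i => ((‖d i‖ ^ 2 : ℝ) : ℂ)) := by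
    rw [Matrix.star_eq_conjTranspose, Matrix.diagonal_conjTranspose, Matrix.diagonal_mul_diagonal]
    congr 1
    funext i
    push_cast
    exact RCLike.conj_mul _
  rw [normTwoSq, h, ntr]
  simp only [Matrix.diagonal_apply_eq]
  rw [← Complex.ofReal_sum, ← Complex.ofReal_natCast, ← Complex.ofReal_div, Complex.ofReal_re]

theorem leftMul_diagSeq_eq_iff (f g : ∀ n : ℕ, Fin n → ℂ) (hf hg) :
    leftMul ω (diagSeq f hf) = leftMul ω (diagSeq g hg) ↔
      Tendsto (fun n => (∑ i, ‖f n i - g n i‖ ^ 2) / (n : ℝ)) (ω : Filter ℕ) (𝓝 0) := by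
  have hfg : ∃ C : ℝ, ∀ n i, ‖f n i - g n i‖ ≤ C := by
    obtain ⟨C, hC⟩ := hf
    obtain ⟨D, hD⟩ := hg
    exact ⟨C + D, fun n i => (norm_sub_le _ _).trans (add_le_add (hC n i) (hD n i))⟩
  rw [← sub_eq_zero, ← map_sub, ← diagSeq_sub f g hf hg hfg, leftMul_eq_zero_iff]
  exact tendsto_congr fun n => normTwoSq_diagonal _

/-- The sequence of diagonal projections given by a sequence of sets. -/
def indSeq (A : ∀ n : ℕ, Finset (Fin n)) : BddSeq :=
  diagSeq (fun n i => if i ∈ A n then 1 else 0) ⟨1, fun n i => by split_ifs <;> simp⟩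

theorem leftMul_indSeq_congr {A B : ∀ n : ℕ, Finset (Fin n)} (hAB : ∀ n, A n ⊆ B n)
    (h : Negligible ω (fun n => B n \ A n)) : leftMul ω (indSeq A) = leftMul ω (indSeq B) := by
  refine (leftMul_diagSeq_eq_iff _ _ _ _).2 (h.congr fun n => ?_)
  congr 1
  rw [Finset.card_eq_sum_ones, Nat.cast_sum, ← Finset.sum_subset (Finset.subset_univ (B n \ A n))]
  · refine Finset.sum_congr rfl fun i hi => ?_
    rw [Finset.mem_sdiff] at hi
    simp [hi.1, hi.2]
  · intro i _ hi
    rw [Finset.mem_sdiff, not_and, not_not] at hi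
    by_cases hB : i ∈ B n
    · simp [hB, hi hB]
    · have hA : i ∉ A n := fun h => hB (hAB n h)
      simp [hA, hB]

/-- Every projection of the Loeb algebra is given by a sequence of sets. -/
theorem exists_indSeq_eq {f : ∀ n : ℕ, Fin n → ℂ} {hf : ∃ C : ℝ, ∀ n i, ‖f n i‖ ≤ C}
    (h : IsIdempotentElem (leftMul ω (diagSeq f hf))) :
    ∃ A, leftMul ω (indSeq A) = leftMul ω (diagSeq f hf) := by
  classical
  have hff : ∃ C : ℝ, ∀ n i, ‖f n i * f n i‖ ≤ C := by
    obtain ⟨C, hC⟩ := hf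
    exact ⟨C * C, fun n i => by
      rw [norm_mul]
      exact mul_le_mul (hC n i) (hC n i) (norm_nonneg _) ((norm_nonneg _).trans (hC n i))⟩
  rw [IsIdempotentElem, ← map_mul, ← diagSeq_mul f f hf hf hff, leftMul_diagSeq_eq_iff] at h
  refine ⟨fun n => Finset.univ.filter (fun i => 1 / 2 ≤ ‖f n i‖), (leftMul_diagSeq_eq_iff _ _ _ _).2 ?_⟩
  have h4 := h.const_mul 4
  rw [mul_zero] at h4
  refine squeeze_zero (fun n => by positivity) (fun n => ?_) h4
  rw [← mul_div_assoc, Finset.mul_sum]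
  gcongr with i
  -- if `|z| ≥ 1/2` then `|z - 1| ≤ 2 |z² - z|`; if `|z| ≤ 1/2` then `|z| ≤ 2 |z² - z|`
  have key : f n i * f n i - f n i = f n i * (f n i - 1) := by ring
  rw [key, norm_mul, mul_pow]
  simp only [Finset.mem_filter, Finset.mem_univ, true_and]
  split_ifs with hi
  · rw [norm_sub_rev]
    have h1 : (1 / 2 : ℝ) ^ 2 ≤ ‖f n i‖ ^ 2 := by gcongr
    nlinarith [sq_nonneg ‖f n i - 1‖]
  · rw [zero_sub, norm_neg]
    have h2 : (1 : ℝ) ≤ ‖f n i‖ + ‖f n i - 1‖ := by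
      have := norm_sub_le (f n i) (f n i - 1)
      rwa [sub_sub_cancel, norm_one] at this
    have h1 : (1 / 2 : ℝ) ^ 2 ≤ ‖f n i - 1‖ ^ 2 := by
      push Not at hi
      gcongr
      linarith
    nlinarith [sq_nonneg ‖f n i‖]

/-! ### Dyadic expansions -/

theorem summable_dyadic {b : ℕ → ℝ} (hb : ∀ k, b k = 0 ∨ b k = 1) :
    Summable (fun k => (1 / 2 : ℝ) ^ (k + 1) * b k) := by
  refine Summable.of_nonneg_of_le (fun k => ?_) (fun k => ?_)
    ((summable_nat_add_iff 1).2 summable_geometric_two)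
  · rcases hb k with h | h <;> rw [h] <;> positivity
  · rcases hb k with h | h <;> rw [h] <;> simp

theorem dyadic_tail {b : ℕ → ℝ} (hb : ∀ k, b k = 0 ∨ b k = 1) (K : ℕ) :
    |∑' k, (1 / 2 : ℝ) ^ (k + 1) * b k - ∑ k ∈ Finset.range K, (1 / 2 : ℝ) ^ (k + 1) * b k|
      ≤ (1 / 2) ^ K := by
  rw [← (summable_dyadic hb).sum_add_tsum_nat_add K, add_sub_cancel_left]
  have hs := (summable_nat_add_iff K).2 (summable_dyadic hb)
  have h0 : ∀ k, 0 ≤ (1 / 2 : ℝ) ^ (k + K + 1) * b (k + K) := fun k => by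
    rcases hb (k + K) with h | h <;> rw [h] <;> positivity
  rw [abs_of_nonneg (tsum_nonneg h0)]
  have hg : HasSum (fun k : ℕ => (1 / 2 : ℝ) ^ (K + 1) * (1 / 2) ^ k) ((1 / 2) ^ (K + 1) * 2) :=
    hasSum_geometric_two.mul_left _
  calc ∑' k, (1 / 2 : ℝ) ^ (k + K + 1) * b (k + K) ≤ ∑' k, (1 / 2 : ℝ) ^ (K + 1) * (1 / 2) ^ k := by
        refine hs.tsum_le_tsum (fun k => ?_) hg.summable
        rw [← pow_add, show K + 1 + k = k + K + 1 by ring]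
        refine mul_le_of_le_one_right (by positivity) ?_
        rcases hb (k + K) with h | h <;> rw [h]
        exact zero_le_one
    _ = (1 / 2) ^ K := by rw [hg.tsum_eq, pow_succ]; ring

theorem exists_dyadic {x : ℝ} (h0 : 0 ≤ x) (h1 : x ≤ 1) :
    ∃ b : ℕ → ℝ, (∀ k, b k = 0 ∨ b k = 1) ∧ x = ∑' k, (1 / 2 : ℝ) ^ (k + 1) * b k := by
  classical
  let bit : ℝ → ℝ := fun y => if 1 / 2 ≤ y then 1 else 0
  let g : ℕ → ℝ := fun k => Nat.rec (motive := fun _ => ℝ) x (fun _ y => 2 * y - bit y) k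
  have hg : ∀ k, 0 ≤ g k ∧ g k ≤ 1 := by
    intro k
    induction k with
    | zero => exact ⟨h0, h1⟩
    | succ k ih =>
      change 0 ≤ 2 * g k - bit (g k) ∧ 2 * g k - bit (g k) ≤ 1
      rcases le_or_gt (1 / 2) (g k) with h | h
      · rw [show bit (g k) = 1 from if_pos h]
        constructor <;> linarith
      · rw [show bit (g k) = 0 from if_neg h.not_ge]
        constructor <;> linarith
  have hsum : ∀ K, x = ∑ k ∈ Finset.range K, (1 / 2 : ℝ) ^ (k + 1) * bit (g k)
      + (1 / 2) ^ K * g K := by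
    intro K
    induction K with
    | zero => simp [g]
    | succ K ih =>
      rw [Finset.sum_range_succ]
      change x = _ + (1 / 2) ^ (K + 1) * (2 * g K - bit (g K))
      rw [ih]
      ring
  have hb : ∀ k, bit (g k) = 0 ∨ bit (g k) = 1 := fun k =>
    (em (1 / 2 ≤ g k)).symm.imp (fun h => if_neg h) (fun h => if_pos h)
  refine ⟨fun k => bit (g k), hb, ?_⟩
  refine tendsto_nhds_unique ?_ (summable_dyadic hb).hasSum.tendsto_sum_nat
  have h2 : Tendsto (fun K => x - (1 / 2 : ℝ) ^ K * g K) atTop (𝓝 x) := by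
    have h3 : Tendsto (fun K => (1 / 2 : ℝ) ^ K * g K) atTop (𝓝 0) :=
      squeeze_zero (fun K => mul_nonneg (by positivity) (hg K).1)
        (fun K => mul_le_of_le_one_right (by positivity) (hg K).2)
        (tendsto_pow_atTop_nhds_zero_of_lt_one (by norm_num) (by norm_num))
    simpa using h3.const_sub x
  exact h2.congr fun K => by rw [sub_eq_iff_eq_add]; exact hsum K

/-- The value at `i` of the function `∑ₖ 2⁻ᵏ⁻¹ 1_{A k}`. -/
noncomputable def dyadicFun (A : ℕ → ∀ n : ℕ, Finset (Fin n)) (n : ℕ) (i : Fin n) : ℝ :=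
  ∑' k, (1 / 2 : ℝ) ^ (k + 1) * (if i ∈ A k n then 1 else 0)

theorem dyadicFun_tail (A : ℕ → ∀ n : ℕ, Finset (Fin n)) (K n : ℕ) (i : Fin n) :
    |dyadicFun A n i - ∑ k ∈ Finset.range K, (1 / 2 : ℝ) ^ (k + 1) * (if i ∈ A k n then 1 else 0)|
      ≤ (1 / 2) ^ K :=
  dyadic_tail (fun k => by split_ifs <;> simp) K

/-- The diagonal sequence `∑ₖ 2⁻ᵏ⁻¹ 1_{A k}`. -/
noncomputable def dyadicSeq (A : ℕ → ∀ n : ℕ, Finset (Fin n)) : BddSeq :=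
  diagSeq (fun n i => (dyadicFun A n i : ℂ)) ⟨1, fun n i => by
    have h := dyadicFun_tail A 0 n i
    simpa using h⟩

theorem norm_dyadicSeq_sub_le (A : ℕ → ∀ n : ℕ, Finset (Fin n)) (K : ℕ) :
    ‖leftMul ω (dyadicSeq A)
      - ∑ k ∈ Finset.range K, ((1 / 2 : ℂ) ^ (k + 1)) • leftMul ω (indSeq (A k))‖ ≤ (1 / 2) ^ K := by
  have hval : ∀ n i, ((dyadicFun A n i : ℂ) - ∑ k ∈ Finset.range K,
      (1 / 2 : ℂ) ^ (k + 1) * (if i ∈ A k n then 1 else 0))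
      = ((dyadicFun A n i - ∑ k ∈ Finset.range K,
      (1 / 2 : ℝ) ^ (k + 1) * (if i ∈ A k n then 1 else 0) : ℝ) : ℂ) := by
    intro n i
    push_cast
    congr 2
    funext k
    split_ifs <;> simp
  have hbd : ∀ n i, ‖((dyadicFun A n i : ℂ) - ∑ k ∈ Finset.range K,
      (1 / 2 : ℂ) ^ (k + 1) * (if i ∈ A k n then 1 else 0))‖ ≤ (1 / 2) ^ K := by
    intro n i
    rw [hval, Complex.norm_real]
    exact dyadicFun_tail A K n i
  have heq : dyadicSeq A - ∑ k ∈ Finset.range K, ((1 / 2 : ℂ) ^ (k + 1)) • indSeq (A k)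
      = diagSeq _ ⟨_, hbd⟩ := by
    apply Subtype.ext
    funext n
    rw [AddSubgroupClass.coe_sub, AddSubmonoidClass.coe_finsetSum, Pi.sub_apply, Finset.sum_apply]
    ext i j
    rw [Matrix.sub_apply, Matrix.sum_apply]
    change Matrix.diagonal _ i j - ∑ k ∈ Finset.range K, (1 / 2 : ℂ) ^ (k + 1) *
      Matrix.diagonal _ i j = Matrix.diagonal _ i j
    by_cases hij : i = j
    · subst hij
      simp only [Matrix.diagonal_apply_eq]
    · simp [Matrix.diagonal_apply_ne _ hij]
  have h := norm_leftMul_diagSeq_le (ω := ω) ⟨_, hbd⟩ (by positivity) hbd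
  rw [← heq, map_sub, map_sum] at h
  simpa only [map_smul] using h

theorem tendsto_dyadicSeq (A : ℕ → ∀ n : ℕ, Finset (Fin n)) :
    Tendsto (fun K => ∑ k ∈ Finset.range K, ((1 / 2 : ℂ) ^ (k + 1)) • leftMul ω (indSeq (A k)))
      atTop (𝓝 (leftMul ω (dyadicSeq A))) := by
  rw [tendsto_iff_norm_sub_tendsto_zero]
  refine squeeze_zero (fun K => norm_nonneg _) (fun K => ?_)
    (tendsto_pow_atTop_nhds_zero_of_lt_one (r := (1 / 2 : ℝ)) (by norm_num) (by norm_num))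
  rw [norm_sub_rev]
  exact norm_dyadicSeq_sub_le A K

theorem exists_dyadicSeq_eq {f : ∀ n : ℕ, Fin n → ℝ} (h0 : ∀ n i, 0 ≤ f n i)
    (h1 : ∀ n i, f n i ≤ 1) : ∃ A, ∀ n i, dyadicFun A n i = f n i := by
  classical
  choose b hb hs using fun n (i : Fin n) => exists_dyadic (h0 n i) (h1 n i)
  refine ⟨fun k n => Finset.univ.filter (fun i => b n i k = 1), fun n i => ?_⟩
  rw [dyadicFun, hs n i]
  congr 1
  funext k
  rcases hb n i k with h | h <;> simp [h]

/-- The Loeb algebra is spanned by the dyadic sums of projections. -/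
theorem loebAlgebra_le_span : (loebAlgebra ω : Set (L2 ω →L[ℂ] L2 ω)) ⊆
    Submodule.span ℂ (Set.range fun A => leftMul ω (dyadicSeq A)) := by
  intro T hT
  obtain ⟨f, hf, rfl⟩ := mem_loebAlgebra_iff.1 hT
  obtain ⟨C', hC'⟩ := id hf
  obtain ⟨C, hC0, hC⟩ : ∃ C : ℝ, 0 < C ∧ ∀ n i, ‖f n i‖ ≤ C :=
    ⟨max C' 1, by positivity, fun n i => (hC' n i).trans (le_max_left _ _)⟩
  have hpart : ∀ g : ∀ n : ℕ, Fin n → ℝ, (∀ n i, |g n i| ≤ C) →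
      ∃ A, ∀ n i, dyadicFun A n i = (g n i + C) / (2 * C) := by
    intro g hg
    refine exists_dyadicSeq_eq (fun n i => ?_) (fun n i => ?_)
    · have := (abs_le.1 (hg n i)).1
      exact div_nonneg (by linarith) (by linarith)
    · have := (abs_le.1 (hg n i)).2
      exact div_le_one_of_le₀ (by linarith) (by linarith)
  obtain ⟨A, hA⟩ := hpart (fun n i => (f n i).re) fun n i => (Complex.abs_re_le_norm _).trans (hC n i)
  obtain ⟨B, hB⟩ := hpart (fun n i => (f n i).im) fun n i => (Complex.abs_im_le_norm _).trans (hC n i)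
  obtain ⟨E, hE⟩ := exists_dyadicSeq_eq (f := fun n _ => 1) (fun n i => zero_le_one) (fun n i => le_rfl)
  have heq : diagSeq f hf = (2 * C : ℂ) • dyadicSeq A + (2 * C * Complex.I) • dyadicSeq B
      - (C + C * Complex.I) • dyadicSeq E := by
    apply Subtype.ext
    funext n
    ext i j
    change Matrix.diagonal _ i j = (2 * C : ℂ) * Matrix.diagonal _ i j
      + (2 * C * Complex.I) * Matrix.diagonal _ i j - (C + C * Complex.I) * Matrix.diagonal _ i j
    by_cases hij : i = j
    · subst hij
      simp only [Matrix.diagonal_apply_eq, hA, hB, hE]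
      have hC' : (C : ℂ) ≠ 0 := by exact_mod_cast hC0.ne'
      push_cast
      field_simp
      conv_lhs => rw [← Complex.re_add_im (f n i)]
      ring
    · simp [Matrix.diagonal_apply_ne _ hij]
  rw [heq, map_sub, map_add, map_smul, map_smul, map_smul]
  have hmem : ∀ A, leftMul ω (dyadicSeq A) ∈
      Submodule.span ℂ (Set.range fun A => leftMul ω (dyadicSeq A)) :=
    fun A => Submodule.subset_span ⟨A, rfl⟩
  exact Submodule.sub_mem _ (Submodule.add_mem _ (Submodule.smul_mem _ _ (hmem A))
    (Submodule.smul_mem _ _ (hmem B))) (Submodule.smul_mem _ _ (hmem E))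

end Loeb

/-! ### Powers of elements of the universal sofic group -/

/-- Orthogonal vectors of equal norm converge weakly to `0`, by Bessel's inequality. -/
theorem tendsto_inner_of_orthogonal {H : Type*} [NormedAddCommGroup H] [InnerProductSpace ℂ H]
    {e : ℕ → H} (he : ∀ j k, j < k → ⟪e j, e k⟫_ℂ = 0) {c : ℝ} (hc : ∀ k, ‖e k‖ = c) (v : H) :
    Tendsto (fun k => ⟪v, e k⟫_ℂ) atTop (𝓝 0) := by
  have hc0 : 0 ≤ c := by rw [← hc 0]; exact norm_nonneg _
  rcases hc0.eq_or_lt with h0 | h0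
  · have : ∀ k, e k = 0 := fun k => norm_eq_zero.1 ((hc k).trans h0.symm)
    simp [this]
  · have hsymm : ∀ j k, j ≠ k → ⟪e j, e k⟫_ℂ = 0 := by
      intro j k hjk
      rcases lt_or_gt_of_ne hjk with h | h
      · exact he j k h
      · rw [← inner_conj_symm, he k j h, map_zero]
    have hc' : (c : ℂ) ≠ 0 := by exact_mod_cast h0.ne'
    have hon : Orthonormal ℂ (fun k => ((c : ℂ)⁻¹) • e k) := by
      refine ⟨fun k => ?_, fun j k hjk => ?_⟩
      · rw [norm_smul, hc, norm_inv, Complex.norm_real, Real.norm_of_nonneg hc0,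
          inv_mul_cancel₀ h0.ne']
      · change ⟪((c : ℂ)⁻¹) • e j, ((c : ℂ)⁻¹) • e k⟫_ℂ = 0
        rw [inner_smul_left, inner_smul_right, hsymm j k hjk, mul_zero, mul_zero]
    have h1 := hon.inner_products_summable (x := v)
    have h2 := h1.tendsto_atTop_zero.sqrt
    simp only [Real.sqrt_sq (norm_nonneg _), Real.sqrt_zero] at h2
    have h3 := (tendsto_zero_iff_norm_tendsto_zero.2 h2).const_mul (c : ℂ)
    rw [mul_zero] at h3
    have h4 := (Complex.continuous_conj.tendsto 0).comp h3
    rw [map_zero] at h4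
    refine h4.congr fun k => ?_
    rw [Function.comp_apply, inner_smul_left, map_mul, map_mul, Complex.conj_conj,
      Complex.conj_ofReal, inner_conj_symm, ← mul_assoc, mul_inv_cancel₀ hc', one_mul]

/-- Let `u` be a unitary and `r` a projection with `u * r = r`. If the matrix coefficients of the
powers of `u` at a vector `Ω` agree with that of `r`, then these powers converge weakly to `r` at
`Ω`: the vectors `u ^ k (Ω - r Ω)` are orthogonal. -/
theorem tendsto_pow_apply {H : Type*} [NormedAddCommGroup H] [InnerProductSpace ℂ H]
    [CompleteSpace H] {u r : H →L[ℂ] H} (huu : star u * u = 1) (hur : u * r = r)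
    (hrs : star r = r) (hrr : r * r = r) {Ω : H}
    (h : ∀ k : ℕ, k ≠ 0 → ⟪Ω, (u ^ k) Ω⟫_ℂ = ⟪Ω, r Ω⟫_ℂ) (v : H) :
    Tendsto (fun k : ℕ => ⟪v, (u ^ k) Ω⟫_ℂ) atTop (𝓝 ⟪v, r Ω⟫_ℂ) := by
  have hurk : ∀ k : ℕ, u ^ k * r = r := by
    intro k
    induction k with
    | zero => rw [pow_zero, one_mul]
    | succ k ih => rw [pow_succ, mul_assoc, hur, ih]
  have huk : ∀ k : ℕ, star (u ^ k) * u ^ k = 1 := by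
    intro k
    induction k with
    | zero => simp
    | succ k ih =>
      calc star (u ^ (k + 1)) * u ^ (k + 1) = star u * (star (u ^ k) * u ^ k) * u := by
            rw [pow_succ, star_mul]; simp only [mul_assoc]
        _ = 1 := by rw [ih, mul_one, huu]
  have hinner : ∀ k x y, ⟪(u ^ k) x, (u ^ k) y⟫_ℂ = ⟪x, y⟫_ℂ := by
    intro k x y
    rw [← ContinuousLinearMap.adjoint_inner_right, ← ContinuousLinearMap.star_eq_adjoint]
    exact congrArg (fun T : H →L[ℂ] H => ⟪x, T y⟫_ℂ) (huk k)
  have hru : ∀ k : ℕ, r * u ^ k = r := by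
    intro k
    have h1 : star (u ^ k) * r = r := by
      have h2 := congrArg (fun T => star (u ^ k) * T) (hurk k)
      simp only [← mul_assoc] at h2
      rw [huk, one_mul] at h2
      exact h2.symm
    have h3 := congrArg star h1
    rwa [star_mul, star_star, hrs] at h3
  have hξ : ∀ k, (u ^ k) (Ω - r Ω) = (u ^ k - r) Ω := by
    intro k
    rw [map_sub, _root_.sub_apply]
    congr 1
    exact congrArg (fun T : H →L[ℂ] H => T Ω) (hurk k)
  have horth : ∀ j k, j < k → ⟪(u ^ j) (Ω - r Ω), (u ^ k) (Ω - r Ω)⟫_ℂ = 0 := by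
    intro j k hjk
    obtain ⟨m, rfl⟩ := Nat.exists_eq_add_of_lt hjk
    rw [add_assoc, pow_add]
    change ⟪(u ^ j) (Ω - r Ω), (u ^ j) ((u ^ (m + 1)) (Ω - r Ω))⟫_ℂ = 0
    have h2 : r ((u ^ (m + 1) - r) Ω) = 0 := by
      have : r * (u ^ (m + 1) - r) = 0 := by rw [mul_sub, hru, hrr, sub_self]
      exact congrArg (fun T : H →L[ℂ] H => T Ω) this
    have h3 : ⟪r Ω, (u ^ (m + 1) - r) Ω⟫_ℂ = 0 := by
      have h4 := ContinuousLinearMap.adjoint_inner_left r ((u ^ (m + 1) - r) Ω) Ω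
      rw [← ContinuousLinearMap.star_eq_adjoint, hrs] at h4
      rw [h4, h2, inner_zero_right]
    rw [hinner, hξ, inner_sub_left, h3, sub_zero, _root_.sub_apply, inner_sub_right]
    exact sub_eq_zero.2 (h (m + 1) (Nat.succ_ne_zero m))
  have hnorm : ∀ k, ‖(u ^ k) (Ω - r Ω)‖ = ‖Ω - r Ω‖ := by
    intro k
    rw [@norm_eq_sqrt_re_inner ℂ, hinner, ← @norm_eq_sqrt_re_inner ℂ]
  have h1 := (tendsto_inner_of_orthogonal horth hnorm v).add_const ⟪v, r Ω⟫_ℂ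
  rw [zero_add] at h1
  refine h1.congr fun k => ?_
  rw [hξ, ← inner_add_right, _root_.sub_apply, sub_add_cancel]

section Powers

variable {ω : Ultrafilter ℕ}

theorem permMatrixHom_apply {n : ℕ} (σ : Equiv.Perm (Fin n)) (i j : Fin n) :
    Matrix.permMatrixHom (R := ℂ) σ i j = if i = σ j then 1 else 0 := by
  change (if j ∈ some (σ⁻¹ i) then (1 : ℂ) else 0) = _
  have h : j ∈ some (σ⁻¹ i) ↔ i = σ j := by
    rw [Option.mem_some_iff, Equiv.Perm.inv_eq_iff_eq]
  simp only [h]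

/-- The fixed points of a sequence of permutations. -/
def fixSet (g : ∀ n : ℕ, Equiv.Perm (Fin n)) (n : ℕ) : Finset (Fin n) :=
  Finset.univ.filter (fun i => g n i = i)

theorem permSeq_mul_indSeq (g : ∀ n : ℕ, Equiv.Perm (Fin n)) :
    permSeq g * indSeq (fixSet g) = indSeq (fixSet g) := by
  apply Subtype.ext
  funext n
  ext i j
  change (Matrix.permMatrixHom (R := ℂ) (g n) * Matrix.diagonal
    (fun i => if i ∈ fixSet g n then (1 : ℂ) else 0)) i j
      = Matrix.diagonal (fun i => if i ∈ fixSet g n then (1 : ℂ) else 0) i j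
  rw [Matrix.mul_diagonal, permMatrixHom_apply, Matrix.diagonal_apply]
  by_cases hj : g n j = j
  · by_cases hij : i = j <;> simp [fixSet, hj, hij]
  · by_cases hij : i = j <;> simp [fixSet, hj, hij]

theorem star_indSeq (A : ∀ n : ℕ, Finset (Fin n)) : star (indSeq A) = indSeq A := by
  apply Subtype.ext
  funext n
  refine (Matrix.diagonal_conjTranspose _).trans (congrArg Matrix.diagonal (funext fun i => ?_))
  by_cases hi : i ∈ A n <;> simp [hi]

theorem indSeq_mul_self (A : ∀ n : ℕ, Finset (Fin n)) : indSeq A * indSeq A = indSeq A := by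
  apply Subtype.ext
  funext n
  refine (Matrix.diagonal_mul_diagonal _ _).trans (congrArg Matrix.diagonal (funext fun i => ?_))
  by_cases hi : i ∈ A n <;> simp [hi]

theorem trace_indSeq_fixSet (g : ∀ n : ℕ, Equiv.Perm (Fin n)) :
    trace ω (leftMul ω (indSeq (fixSet g))) = trace ω (soficEmb ω (QuotientGroup.mk g)) := by
  rw [soficEmb_mk, trace_leftMul, trace_leftMul]
  refine traceLim_eq ((tendsto_traceLim ω (permSeq g)).congr fun n => ?_)
  change ntr (Matrix.permMatrixHom (R := ℂ) (g n)) = ntr (Matrix.diagonal _)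
  unfold ntr
  congr 1
  refine Finset.sum_congr rfl fun j _ => ?_
  rw [permMatrixHom_apply, Matrix.diagonal_apply_eq]
  simp only [fixSet, Finset.mem_filter, Finset.mem_univ, true_and, eq_comm]

/-- If the powers of an element `u` of the universal sofic group have the same trace as `u`, then
they converge to the projection on the fixed points of `u`: off the fixed points, the powers of `u`
are orthogonal in `L²(ℳ)`. -/
theorem tendsto_pow_of_trace_pow (g : ∀ n : ℕ, Equiv.Perm (Fin n))
    (h : ∀ k : ℕ, k ≠ 0 → trace ω (soficEmb ω (QuotientGroup.mk g ^ k))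
      = trace ω (soficEmb ω (QuotientGroup.mk g))) (v w : L2 ω) :
    Tendsto (fun k : ℕ => ⟪v, (soficEmb ω (QuotientGroup.mk g) ^ k) w⟫_ℂ) atTop
      (𝓝 ⟪v, leftMul ω (indSeq (fixSet g)) w⟫_ℂ) := by
  have hur : soficEmb ω (QuotientGroup.mk g) * leftMul ω (indSeq (fixSet g))
      = leftMul ω (indSeq (fixSet g)) := by
    rw [soficEmb_mk, ← map_mul, permSeq_mul_indSeq]
  have hrs : star (leftMul ω (indSeq (fixSet g))) = leftMul ω (indSeq (fixSet g)) := by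
    rw [← map_star, star_indSeq]
  have hrr : leftMul ω (indSeq (fixSet g)) * leftMul ω (indSeq (fixSet g))
      = leftMul ω (indSeq (fixSet g)) := by
    rw [← map_mul, indSeq_mul_self]
  have huu : star (soficEmb ω (QuotientGroup.mk g)) * soficEmb ω (QuotientGroup.mk g) = 1 := by
    rw [star_soficEmb, ← map_mul, inv_mul_cancel, map_one]
  have hΩ := tendsto_pow_apply huu hur hrs hrr (Ω := oneVec ω) fun k hk => by
    have h1 := h k hk
    rw [map_pow, ← trace_indSeq_fixSet] at h1
    exact h1
  refine tendsto_inner_of_dense (C := 1) (Eventually.of_forall fun k => ?_) dense_range_vec ?_ v w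
  · rw [← map_pow]
    exact norm_soficEmb_le _
  · rintro v - _ ⟨x, rfl⟩
    rw [apply_vec_of_mem (leftMul_mem_rightCommutant _), ← star_star x, ← inner_rightMul_left]
    refine (hΩ (rightMul ω (star x) v)).congr fun k => ?_
    rw [inner_rightMul_left, apply_vec_of_mem (pow_mem (soficEmb_mem_rightCommutant _) k)]

/-- Every projection of the Loeb algebra is the limit of the powers of an element of the universal
sofic group: of a long cycle on the complement of the corresponding set. -/
theorem exists_tendsto_pow (hω : (ω : Filter ℕ) ≤ atTop) (A : ∀ n : ℕ, Finset (Fin n)) :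
    ∃ ψ : SoficGroup ω, (∀ k : ℕ, k ≠ 0 → len (ψ ^ k) = len ψ) ∧
      ∀ v w, Tendsto (fun k : ℕ => ⟪v, (soficEmb ω ψ ^ k) w⟫_ℂ) atTop
        (𝓝 ⟪v, leftMul ω (indSeq A) w⟫_ℂ) := by
  choose g hg hgs using fun n => (Finset.univ \ A n).exists_cycleOn
  have hgA : ∀ n i, i ∈ A n → g n i = i := by
    intro n i hi
    by_contra hne
    have := hgs n (Equiv.Perm.mem_support.2 hne)
    simp [hi] at this
  have hpow : ∀ n k i, i ∈ A n → (g n ^ k) i = i := fun n k i hi =>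
    Equiv.Perm.pow_apply_eq_self_of_apply_eq_self (hgA n i hi) k
  -- the `k`-th power of the cycle moves all points of the complement if that has more than `k` points
  have hcard : ∀ k : ℕ, k ≠ 0 → ∀ n, ((Finset.univ \ A n) \
      (Finset.univ.filter (fun i => (g n ^ k) i ≠ i))).card ≤ k := by
    intro k hk n
    rcases le_or_gt (Finset.univ \ A n).card k with h | h
    · exact (Finset.card_le_card Finset.sdiff_subset).trans h
    · have : (Finset.univ \ A n) \ (Finset.univ.filter (fun i => (g n ^ k) i ≠ i)) = ∅ := by
        rw [Finset.sdiff_eq_empty_iff_subset]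
        intro i hi
        rw [Finset.mem_filter]
        refine ⟨Finset.mem_univ _, fun h' => ?_⟩
        have h2 := ((hg n).pow_apply_eq hi (n := k)).1 h'
        exact absurd (Nat.le_of_dvd (Nat.pos_of_ne_zero hk) h2) (by omega)
      rw [this]
      simp
  have hsub : ∀ k n, Finset.univ.filter (fun i => (g n ^ k) i ≠ i) ⊆ Finset.univ \ A n := by
    intro k n i hi
    rw [Finset.mem_filter] at hi
    rw [Finset.mem_sdiff]
    exact ⟨Finset.mem_univ _, fun h => hi.2 (hpow n k i h)⟩
  have hneg : ∀ k : ℕ, k ≠ 0 → Negligible ω (fun n => (Finset.univ \ A n) \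
      (Finset.univ.filter (fun i => (g n ^ k) i ≠ i))) := fun k hk =>
    Negligible.of_card_bounded hω k (hcard k hk)
  have hlen : ∀ k : ℕ, k ≠ 0 → Tendsto (fun n => ((Finset.univ \ A n).card : ℝ) / n) (ω : Filter ℕ)
      (𝓝 (len (QuotientGroup.mk g ^ k : SoficGroup ω))) := by
    intro k hk
    have h1 := (tendsto_len hω (g ^ k)).add (hneg k hk)
    rw [add_zero] at h1
    refine h1.congr fun n => ?_
    rw [← add_div, ← Nat.cast_add]
    congr 2
    rw [add_comm]
    exact Finset.card_sdiff_add_card_eq_card (hsub k n)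
  have hlen' : ∀ k : ℕ, k ≠ 0 → len (QuotientGroup.mk g ^ k : SoficGroup ω)
      = len (QuotientGroup.mk g : SoficGroup ω) := by
    intro k hk
    have h1 := hlen 1 one_ne_zero
    rw [pow_one] at h1
    exact tendsto_nhds_unique (hlen k hk) h1
  refine ⟨QuotientGroup.mk g, hlen', ?_⟩
  have hA : leftMul ω (indSeq A) = leftMul ω (indSeq (fixSet g)) := by
    refine leftMul_indSeq_congr (fun n i hi => ?_) ((hneg 1 one_ne_zero).mono fun n i hi => ?_)
    · simpa [fixSet] using hgA n i hi
    · simpa [fixSet, and_comm] using hi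
  rw [hA]
  exact tendsto_pow_of_trace_pow g fun k hk => by
    rw [trace_soficEmb hω, trace_soficEmb hω, hlen' k hk]

theorem indSeq_mem_WS (hω : (ω : Filter ℕ) ≤ atTop) (A : ∀ n : ℕ, Finset (Fin n)) :
    leftMul ω (indSeq A) ∈ WS ω := by
  obtain ⟨ψ, -, h⟩ := exists_tendsto_pow hω A
  exact mem_vNGenerated_of_tendsto h
    (Eventually.of_forall fun k => pow_mem (soficEmb_mem_WS ψ) k)

/-- The Loeb algebra is contained in `W*(𝒮)`. -/
theorem loebAlgebra_le_WS (hω : (ω : Filter ℕ) ≤ atTop) : loebAlgebra ω ≤ WS ω := by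
  intro T hT
  have h1 : Submodule.span ℂ (Set.range fun A => leftMul ω (dyadicSeq A))
      ≤ (WS ω).toSubalgebra.toSubmodule := by
    rw [Submodule.span_le]
    rintro _ ⟨A, rfl⟩
    refine (isClosed_norm_vNGenerated _).mem_of_tendsto (tendsto_dyadicSeq A)
      (Eventually.of_forall fun K => ?_)
    exact sum_mem fun k _ => SMulMemClass.smul_mem _ (indSeq_mem_WS hω (A k))
  exact h1 (loebAlgebra_le_span hT)

end Powers

/-! ### The graph of an automorphism in `L²` -/

section Graph

variable {ω : Ultrafilter ℕ}

/-- Evaluation of pairs of operators at `1̂`. -/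
noncomputable def evalOne (ω : Ultrafilter ℕ) :
    ((L2 ω →L[ℂ] L2 ω) × (L2 ω →L[ℂ] L2 ω)) →L[ℂ] L2 ω × L2 ω :=
  (ContinuousLinearMap.apply ℂ (L2 ω) (oneVec ω)).prodMap
    (ContinuousLinearMap.apply ℂ (L2 ω) (oneVec ω))

theorem evalOne_apply (p : (L2 ω →L[ℂ] L2 ω) × (L2 ω →L[ℂ] L2 ω)) :
    evalOne ω p = (p.1 (oneVec ω), p.2 (oneVec ω)) := rfl

/-- The graph of the linear extension of `Φ` to the span of `𝒮`. -/
noncomputable def spanGraph (Φ : SoficGroup ω ≃* SoficGroup ω) :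
    Submodule ℂ ((L2 ω →L[ℂ] L2 ω) × (L2 ω →L[ℂ] L2 ω)) :=
  Submodule.span ℂ (Set.range fun s => (soficEmb ω s, soficEmb ω (Φ s)))

/-- The closure in `L²(ℳ) × L²(ℳ)` of the graph of `Φ`. -/
noncomputable def graphL2 (Φ : SoficGroup ω ≃* SoficGroup ω) : Submodule ℂ (L2 ω × L2 ω) :=
  ((spanGraph Φ).map (evalOne ω).toLinearMap).topologicalClosure

theorem isClosed_graphL2 (Φ : SoficGroup ω ≃* SoficGroup ω) :
    IsClosed (graphL2 Φ : Set (L2 ω × L2 ω)) := Submodule.isClosed_topologicalClosure _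

theorem evalOne_mem_graphL2 {Φ : SoficGroup ω ≃* SoficGroup ω}
    {p : (L2 ω →L[ℂ] L2 ω) × (L2 ω →L[ℂ] L2 ω)} (hp : p ∈ spanGraph Φ) :
    evalOne ω p ∈ graphL2 Φ :=
  Submodule.le_topologicalClosure _ ⟨p, hp, rfl⟩

theorem mem_graphL2 (Φ : SoficGroup ω ≃* SoficGroup ω) (s : SoficGroup ω) :
    (soficEmb ω s (oneVec ω), soficEmb ω (Φ s) (oneVec ω)) ∈ graphL2 Φ :=
  evalOne_mem_graphL2 (Submodule.subset_span ⟨s, rfl⟩)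

/-- A closed subspace contains the graph if it contains the vectors given by the group elements. -/
theorem graphL2_le {Φ : SoficGroup ω ≃* SoficGroup ω} {V : Submodule ℂ (L2 ω × L2 ω)}
    (hV : IsClosed (V : Set (L2 ω × L2 ω)))
    (h : ∀ s, (soficEmb ω s (oneVec ω), soficEmb ω (Φ s) (oneVec ω)) ∈ V) : graphL2 Φ ≤ V := by
  refine Submodule.topologicalClosure_minimal _ ?_ hV
  rw [spanGraph, Submodule.map_span, Submodule.span_le]
  rintro _ ⟨_, ⟨s, rfl⟩, rfl⟩
  exact h s

theorem exists_seq_of_mem_graphL2 {Φ : SoficGroup ω ≃* SoficGroup ω} {p : L2 ω × L2 ω}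
    (hp : p ∈ graphL2 Φ) : ∃ w : ℕ → (L2 ω →L[ℂ] L2 ω) × (L2 ω →L[ℂ] L2 ω),
      (∀ k, w k ∈ spanGraph Φ) ∧ Tendsto (fun k => (w k).1 (oneVec ω)) atTop (𝓝 p.1) ∧
        Tendsto (fun k => (w k).2 (oneVec ω)) atTop (𝓝 p.2) := by
  obtain ⟨q, hq, hlim⟩ := mem_closure_iff_seq_limit.1
    (show p ∈ closure ((spanGraph Φ).map (evalOne ω).toLinearMap : Set (L2 ω × L2 ω)) from hp)
  choose w hw hwq using hq
  refine ⟨w, hw, ?_, ?_⟩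
  · refine ((continuous_fst.tendsto p).comp hlim).congr fun k => ?_
    rw [Function.comp_apply, ← hwq]
    rfl
  · refine ((continuous_snd.tendsto p).comp hlim).congr fun k => ?_
    rw [Function.comp_apply, ← hwq]
    rfl

theorem inner_soficEmb (s t : SoficGroup ω) :
    ⟪soficEmb ω s (oneVec ω), soficEmb ω t (oneVec ω)⟫_ℂ = trace ω (soficEmb ω (s⁻¹ * t)) := by
  rw [← ContinuousLinearMap.adjoint_inner_right, ← ContinuousLinearMap.star_eq_adjoint,
    star_soficEmb, map_mul]
  rfl

/-- A trace preserving automorphism extends to an isometry of `L²(W*(𝒮))`. -/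
theorem inner_eq_of_mem_graphL2 {Φ : SoficGroup ω ≃* SoficGroup ω}
    (hΦ : ∀ s, trace ω (soficEmb ω (Φ s)) = trace ω (soficEmb ω s)) {p q : L2 ω × L2 ω}
    (hp : p ∈ graphL2 Φ) (hq : q ∈ graphL2 Φ) : ⟪p.1, q.1⟫_ℂ = ⟪p.2, q.2⟫_ℂ := by
  let f : L2 ω × L2 ω → (L2 ω × L2 ω →L[ℂ] ℂ) := fun r =>
    (innerSL ℂ r.1).comp (ContinuousLinearMap.fst ℂ _ _)
      - (innerSL ℂ r.2).comp (ContinuousLinearMap.snd ℂ _ _)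
  have hf : ∀ r r', r' ∈ (f r).ker ↔ ⟪r.1, r'.1⟫_ℂ = ⟪r.2, r'.2⟫_ℂ := by
    intro r r'
    rw [LinearMap.mem_ker]
    exact sub_eq_zero
  have h1 : ∀ s, graphL2 Φ ≤ (f (soficEmb ω s (oneVec ω), soficEmb ω (Φ s) (oneVec ω))).ker := by
    intro s
    refine graphL2_le (ContinuousLinearMap.isClosed_ker _) fun t => (hf _ _).2 ?_
    rw [inner_soficEmb, inner_soficEmb, ← map_inv, ← map_mul, hΦ]
  have h2 : graphL2 Φ ≤ (f p).ker := by
    refine graphL2_le (ContinuousLinearMap.isClosed_ker _) fun s => (hf _ _).2 ?_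
    have h3 := (hf _ _).1 (h1 s hp)
    rw [← inner_conj_symm, h3, inner_conj_symm]
  exact (hf _ _).1 (h2 hq)

theorem norm_eq_of_mem_graphL2 {Φ : SoficGroup ω ≃* SoficGroup ω}
    (hΦ : ∀ s, trace ω (soficEmb ω (Φ s)) = trace ω (soficEmb ω s)) {p : L2 ω × L2 ω}
    (hp : p ∈ graphL2 Φ) : ‖p.1‖ = ‖p.2‖ := by
  rw [@norm_eq_sqrt_re_inner ℂ, inner_eq_of_mem_graphL2 hΦ hp hp, ← @norm_eq_sqrt_re_inner ℂ]

theorem swap_mem_graphL2 {Φ : SoficGroup ω ≃* SoficGroup ω} {p : L2 ω × L2 ω}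
    (hp : p ∈ graphL2 Φ.symm) : p.swap ∈ graphL2 Φ := by
  have h : graphL2 Φ.symm ≤ (graphL2 Φ).comap
      (ContinuousLinearEquiv.prodComm ℂ (L2 ω) (L2 ω)).toContinuousLinearMap.toLinearMap := by
    refine graphL2_le ((isClosed_graphL2 Φ).preimage
      (ContinuousLinearEquiv.prodComm ℂ (L2 ω) (L2 ω)).continuous) fun s => ?_
    have h1 := mem_graphL2 Φ (Φ.symm s)
    rw [MulEquiv.apply_symm_apply] at h1
    exact h1
  exact h hp

/-- The closure of the span of `𝒮 1̂`. -/
noncomputable def soficL2 (ω : Ultrafilter ℕ) : Submodule ℂ (L2 ω) :=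
  (Submodule.span ℂ (Set.range fun s => soficEmb ω s (oneVec ω))).topologicalClosure

instance : (soficL2 ω).HasOrthogonalProjection :=
  have : CompleteSpace (soficL2 ω) :=
    (Submodule.isClosed_topologicalClosure _).completeSpace_coe
  inferInstance

theorem soficL2_le {V : Submodule ℂ (L2 ω)} (hV : IsClosed (V : Set (L2 ω)))
    (h : ∀ s, soficEmb ω s (oneVec ω) ∈ V) : soficL2 ω ≤ V := by
  refine Submodule.topologicalClosure_minimal _ ?_ hV
  rw [Submodule.span_le]
  rintro _ ⟨s, rfl⟩
  exact h s

theorem soficEmb_mem_soficL2 (s : SoficGroup ω) : soficEmb ω s (oneVec ω) ∈ soficL2 ω :=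
  Submodule.le_topologicalClosure _ (Submodule.subset_span ⟨s, rfl⟩)

theorem soficEmb_apply_mem_soficL2 (s : SoficGroup ω) {v : L2 ω} (hv : v ∈ soficL2 ω) :
    soficEmb ω s v ∈ soficL2 ω := by
  have h : soficL2 ω ≤ (soficL2 ω).comap (soficEmb ω s).toLinearMap := by
    refine soficL2_le ((Submodule.isClosed_topologicalClosure _).preimage (soficEmb ω s).continuous)
      fun t => ?_
    have h1 := soficEmb_mem_soficL2 (s * t)
    rw [map_mul] at h1
    exact h1
  exact h hv

theorem soficEmb_comm_starProjection (s : SoficGroup ω) :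
    (soficL2 ω).starProjection * soficEmb ω s = soficEmb ω s * (soficL2 ω).starProjection := by
  refine ContinuousLinearMap.ext fun v => ?_
  change (soficL2 ω).starProjection (soficEmb ω s v) = soficEmb ω s ((soficL2 ω).starProjection v)
  refine Submodule.eq_starProjection_of_mem_of_inner_eq_zero
    (soficEmb_apply_mem_soficL2 s (Submodule.starProjection_apply_mem _ v)) fun w hw => ?_
  rw [← map_sub, ← ContinuousLinearMap.adjoint_inner_right, ← ContinuousLinearMap.star_eq_adjoint,
    star_soficEmb]
  exact Submodule.starProjection_inner_eq_zero v _ (soficEmb_apply_mem_soficL2 _ hw)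

theorem oneVec_mem_soficL2 : oneVec ω ∈ soficL2 ω := by
  have h := soficEmb_mem_soficL2 (1 : SoficGroup ω)
  rwa [map_one] at h

theorem apply_oneVec_mem_soficL2 {T : L2 ω →L[ℂ] L2 ω} (hT : T ∈ WS ω) :
    T (oneVec ω) ∈ soficL2 ω := by
  have h : WS ω ≤ StarSubalgebra.centralizer ℂ {(soficL2 ω).starProjection} := by
    refine vNGenerated_le_centralizer ?_
    rintro _ ⟨s, rfl⟩
    rw [SetLike.mem_coe, StarSubalgebra.mem_centralizer_iff]
    rintro _ rfl
    have hs : star (soficL2 ω).starProjection = (soficL2 ω).starProjection :=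
      isSelfAdjoint_starProjection _
    rw [hs]
    exact ⟨soficEmb_comm_starProjection s, soficEmb_comm_starProjection s⟩
  have h1 := ((StarSubalgebra.mem_centralizer_iff ℂ).1 (h hT) _ rfl).1
  have h2 : (soficL2 ω).starProjection (T (oneVec ω)) = T ((soficL2 ω).starProjection (oneVec ω)) :=
    congrArg (fun R : L2 ω →L[ℂ] L2 ω => R (oneVec ω)) h1
  rw [Submodule.starProjection_eq_self_iff.2 oneVec_mem_soficL2] at h2
  rw [← h2]
  exact Submodule.starProjection_apply_mem _ _

/-- The isometry of `L²` given by a trace preserving automorphism is defined everywhere. -/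
theorem exists_mem_graphL2 {Φ : SoficGroup ω ≃* SoficGroup ω}
    (hΦ : ∀ s, trace ω (soficEmb ω (Φ s)) = trace ω (soficEmb ω s)) {v : L2 ω}
    (hv : v ∈ soficL2 ω) : ∃ w, (v, w) ∈ graphL2 Φ := by
  let f : graphL2 Φ →L[ℂ] L2 ω := (ContinuousLinearMap.fst ℂ _ _).comp (graphL2 Φ).subtypeL
  have hf : Isometry f := by
    refine AddMonoidHomClass.isometry_of_norm f fun p => ?_
    change ‖p.1.1‖ = ‖p.1‖
    rw [Prod.norm_def, ← norm_eq_of_mem_graphL2 hΦ p.2, max_self]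
  have : CompleteSpace (graphL2 Φ) := (isClosed_graphL2 Φ).completeSpace_coe
  have h : soficL2 ω ≤ f.range := by
    refine soficL2_le ?_ fun s => ⟨⟨_, mem_graphL2 Φ s⟩, rfl⟩
    exact hf.isClosedEmbedding.isClosed_range
  obtain ⟨p, hp⟩ := h hv
  refine ⟨p.1.2, ?_⟩
  have h1 : (v, p.1.2) = p.1 := Prod.ext hp.symm rfl
  rw [h1]
  exact p.2

end Graph

/-! ### Resolvents -/

/-- The resolvent of a selfadjoint element at `-i` exists in every closed subalgebra. -/
theorem exists_resolvent {A : Type*} [CStarAlgebra A] (S : StarSubalgebra ℂ A)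
    (hS : IsClosed (S : Set A)) {a : A} (ha : a ∈ S) (hsa : star a = a) :
    ∃ c ∈ S, c * (a + algebraMap ℂ A Complex.I) = 1 ∧ (a + algebraMap ℂ A Complex.I) * c = 1 := by
  have h1 : -Complex.I ∉ spectrum ℂ a := fun h => by
    have := IsSelfAdjoint.im_eq_zero_of_mem_spectrum (show IsSelfAdjoint a from hsa) h
    simp at this
  rw [spectrum.notMem_iff] at h1
  have h2 : IsUnit (a + algebraMap ℂ A Complex.I) := by
    have h3 := h1.neg
    rwa [neg_sub, map_neg, sub_neg_eq_add] at h3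
  have hb : a + algebraMap ℂ A Complex.I ∈ S := add_mem ha (algebraMap_mem S _)
  have h4 : IsUnit (⟨_, hb⟩ : S) := (S.coe_isUnit (a := ⟨_, hb⟩)).1 h2
  obtain ⟨u, hu⟩ := h4
  have h5 : u.1.1 = a + algebraMap ℂ A Complex.I := congrArg Subtype.val hu
  refine ⟨u⁻¹.1.1, u⁻¹.1.2, ?_, ?_⟩
  · rw [← h5]
    exact congrArg Subtype.val u.inv_mul
  · rw [← h5]
    exact congrArg Subtype.val u.mul_inv

/-- The resolvent of a selfadjoint operator at `-i` is a contraction. -/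
theorem norm_resolvent_le {H : Type*} [NormedAddCommGroup H] [InnerProductSpace ℂ H]
    [CompleteSpace H] {a c : H →L[ℂ] H} (ha : star a = a)
    (hc : (a + algebraMap ℂ (H →L[ℂ] H) Complex.I) * c = 1) : ‖c‖ ≤ 1 := by
  have key : ∀ w : H, ‖w‖ ≤ ‖(a + algebraMap ℂ (H →L[ℂ] H) Complex.I) w‖ := by
    intro w
    have h1 : (a + algebraMap ℂ (H →L[ℂ] H) Complex.I) w = a w + Complex.I • w := by
      rw [Algebra.algebraMap_eq_smul_one]
      rfl
    have h2 : (⟪w, a w⟫_ℂ).im = 0 := by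
      rw [← Complex.conj_eq_iff_im, inner_conj_symm]
      have h3 := ContinuousLinearMap.adjoint_inner_left a w w
      rwa [← ContinuousLinearMap.star_eq_adjoint, ha] at h3
    have h3 : (⟪w, a w + Complex.I • w⟫_ℂ).im = ‖w‖ ^ 2 := by
      rw [inner_add_right, inner_smul_right, Complex.add_im, h2, inner_self_eq_norm_sq_to_K,
        zero_add, Complex.I_mul_im]
      rw [← RCLike.ofReal_pow]
      exact RCLike.ofReal_re (K := ℂ) _
    have h4 : ‖w‖ ^ 2 ≤ ‖w‖ * ‖a w + Complex.I • w‖ := by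
      rw [← h3]
      exact ((le_abs_self _).trans (Complex.abs_im_le_norm _)).trans (norm_inner_le_norm _ _)
    rw [h1]
    by_cases h0 : ‖w‖ = 0
    · rw [h0]; exact norm_nonneg _
    · rw [pow_two] at h4
      exact le_of_mul_le_mul_left h4 (lt_of_le_of_ne (norm_nonneg _) (Ne.symm h0))
  refine ContinuousLinearMap.opNorm_le_bound _ zero_le_one fun v => ?_
  have h1 : (a + algebraMap ℂ (H →L[ℂ] H) Complex.I) (c v) = v :=
    congrArg (fun T : H →L[ℂ] H => T v) hc
  have h2 := key (c v)
  rwa [h1, ← one_mul ‖v‖] at h2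

/-! ### The graph of the extension of an automorphism -/

section GraphAlg

variable {ω : Ultrafilter ℕ}

theorem fst_mem_WS_of_mem_spanGraph {Φ : SoficGroup ω ≃* SoficGroup ω}
    {w : (L2 ω →L[ℂ] L2 ω) × (L2 ω →L[ℂ] L2 ω)} (hw : w ∈ spanGraph Φ) :
    w.1 ∈ WS ω ∧ w.2 ∈ WS ω := by
  have h : spanGraph Φ ≤ ((WS ω).toSubalgebra.toSubmodule).prod ((WS ω).toSubalgebra.toSubmodule) := by
    rw [spanGraph, Submodule.span_le]
    rintro _ ⟨s, rfl⟩
    exact ⟨soficEmb_mem_WS s, soficEmb_mem_WS _⟩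
  exact h hw

theorem star_mem_spanGraph {Φ : SoficGroup ω ≃* SoficGroup ω}
    {w : (L2 ω →L[ℂ] L2 ω) × (L2 ω →L[ℂ] L2 ω)} (hw : w ∈ spanGraph Φ) :
    star w ∈ spanGraph Φ := by
  induction hw using Submodule.span_induction with
  | mem x hx =>
    obtain ⟨s, rfl⟩ := hx
    refine Submodule.subset_span ⟨s⁻¹, ?_⟩
    refine Prod.ext (star_soficEmb s).symm ?_
    change soficEmb ω (Φ s⁻¹) = star (soficEmb ω (Φ s))
    rw [star_soficEmb, map_inv]
  | zero => rw [star_zero]; exact zero_mem _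
  | add x y _ _ hx hy => rw [star_add]; exact add_mem hx hy
  | smul c x _ hx => rw [star_smul]; exact Submodule.smul_mem _ _ hx

/-- Corresponding operators preserve the graph in `L²`; this makes `graphAlg` closed under products.
The correspondence at `1̂` propagates to the vectors `s 1̂` by right multiplication. -/
theorem prodMap_mem_graphL2 {Φ : SoficGroup ω ≃* SoficGroup ω}
    {p : (L2 ω →L[ℂ] L2 ω) × (L2 ω →L[ℂ] L2 ω)} (h1 : p.1 ∈ rightCommutant ω)
    (h2 : p.2 ∈ rightCommutant ω) (hp : evalOne ω p ∈ graphL2 Φ) {q : L2 ω × L2 ω}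
    (hq : q ∈ graphL2 Φ) : (p.1 q.1, p.2 q.2) ∈ graphL2 Φ := by
  have h : graphL2 Φ ≤ (graphL2 Φ).comap (p.1.prodMap p.2).toLinearMap := by
    refine graphL2_le ((isClosed_graphL2 Φ).preimage (p.1.prodMap p.2).continuous) fun s => ?_
    -- the right multiplications by `s` and by `Φ s` preserve the graph
    obtain ⟨x, hx⟩ := exists_rightMul s
    obtain ⟨y, hy⟩ := exists_rightMul (Φ s)
    have h3 : graphL2 Φ ≤ (graphL2 Φ).comap ((rightMul ω x).prodMap (rightMul ω y)).toLinearMap := by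
      refine graphL2_le ((isClosed_graphL2 Φ).preimage
        ((rightMul ω x).prodMap (rightMul ω y)).continuous) fun t => ?_
      have h4 := mem_graphL2 Φ (t * s)
      rw [map_mul, map_mul, map_mul] at h4
      change (rightMul ω x (soficEmb ω t (oneVec ω)), rightMul ω y (soficEmb ω (Φ t) (oneVec ω)))
        ∈ graphL2 Φ
      rw [← apply_vec_of_mem (soficEmb_mem_rightCommutant _),
        ← apply_vec_of_mem (soficEmb_mem_rightCommutant _), hx, hy]
      exact h4
    have h5 := h3 hp
    change (p.1 (soficEmb ω s (oneVec ω)), p.2 (soficEmb ω (Φ s) (oneVec ω))) ∈ graphL2 Φ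
    rw [← hx, ← hy, apply_vec_of_mem h1, apply_vec_of_mem h2]
    exact h5
  exact h hq

/-- Convergence in the `2`-norm is preserved by the adjoint. -/
theorem tendsto_star_apply_oneVec {T : ℕ → L2 ω →L[ℂ] L2 ω} {S : L2 ω →L[ℂ] L2 ω}
    (hT : ∀ k, T k ∈ rightCommutant ω) (hS : S ∈ rightCommutant ω)
    (h : Tendsto (fun k => T k (oneVec ω)) atTop (𝓝 (S (oneVec ω)))) :
    Tendsto (fun k => star (T k) (oneVec ω)) atTop (𝓝 (star S (oneVec ω))) := by
  rw [tendsto_iff_norm_sub_tendsto_zero] at h ⊢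
  refine h.congr fun k => ?_
  rw [← _root_.sub_apply, ← _root_.sub_apply, ← star_sub, norm_star_apply_oneVec (sub_mem (hT k) hS)]

/-- The pairs of elements of `W*(𝒮)` that correspond to each other under the isometry of `L²` given
by `Φ`. This is the graph of the extension of `Φ` to `W*(𝒮)`. -/
noncomputable def graphAlg (Φ : SoficGroup ω ≃* SoficGroup ω) :
    StarSubalgebra ℂ ((L2 ω →L[ℂ] L2 ω) × (L2 ω →L[ℂ] L2 ω)) where
  carrier := {p | p.1 ∈ WS ω ∧ p.2 ∈ WS ω ∧ evalOne ω p ∈ graphL2 Φ}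
  mul_mem' := by
    rintro p q ⟨hp1, hp2, hp⟩ ⟨hq1, hq2, hq⟩
    exact ⟨mul_mem hp1 hq1, mul_mem hp2 hq2,
      prodMap_mem_graphL2 (WS_le_rightCommutant hp1) (WS_le_rightCommutant hp2) hp hq⟩
  add_mem' := by
    rintro p q ⟨hp1, hp2, hp⟩ ⟨hq1, hq2, hq⟩
    refine ⟨add_mem hp1 hq1, add_mem hp2 hq2, ?_⟩
    rw [map_add]
    exact add_mem hp hq
  algebraMap_mem' := by
    intro c
    refine ⟨algebraMap_mem (WS ω) c, algebraMap_mem (WS ω) c, ?_⟩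
    rw [Algebra.algebraMap_eq_smul_one, map_smul]
    refine Submodule.smul_mem _ _ ?_
    have h := mem_graphL2 Φ 1
    rw [map_one, map_one, map_one] at h
    exact h
  star_mem' := by
    rintro p ⟨hp1, hp2, hp⟩
    refine ⟨star_mem hp1, star_mem hp2, ?_⟩
    obtain ⟨w, hw, h1, h2⟩ := exists_seq_of_mem_graphL2 hp
    have hw' := fun k => fst_mem_WS_of_mem_spanGraph (hw k)
    have h3 := tendsto_star_apply_oneVec (fun k => WS_le_rightCommutant (hw' k).1)
      (WS_le_rightCommutant hp1) h1
    have h4 := tendsto_star_apply_oneVec (fun k => WS_le_rightCommutant (hw' k).2)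
      (WS_le_rightCommutant hp2) h2
    exact (isClosed_graphL2 Φ).mem_of_tendsto (h3.prodMk_nhds h4)
      (Eventually.of_forall fun k => evalOne_mem_graphL2 (star_mem_spanGraph (hw k)))

theorem spanGraph_subset_graphAlg {Φ : SoficGroup ω ≃* SoficGroup ω}
    {w : (L2 ω →L[ℂ] L2 ω) × (L2 ω →L[ℂ] L2 ω)} (hw : w ∈ spanGraph Φ) : w ∈ graphAlg Φ :=
  ⟨(fst_mem_WS_of_mem_spanGraph hw).1, (fst_mem_WS_of_mem_spanGraph hw).2, evalOne_mem_graphL2 hw⟩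

theorem isClosed_graphAlg (Φ : SoficGroup ω ≃* SoficGroup ω) :
    IsClosed (graphAlg Φ : Set ((L2 ω →L[ℂ] L2 ω) × (L2 ω →L[ℂ] L2 ω))) :=
  ((isClosed_norm_vNGenerated _).preimage continuous_fst).inter
    (((isClosed_norm_vNGenerated _).preimage continuous_snd).inter
      ((isClosed_graphL2 Φ).preimage (evalOne ω).continuous))

theorem swap_mem_graphAlg {Φ : SoficGroup ω ≃* SoficGroup ω}
    {p : (L2 ω →L[ℂ] L2 ω) × (L2 ω →L[ℂ] L2 ω)} (hp : p ∈ graphAlg Φ.symm) :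
    p.swap ∈ graphAlg Φ :=
  ⟨hp.2.1, hp.1, swap_mem_graphL2 hp.2.2⟩

theorem norm_apply_oneVec_eq {Φ : SoficGroup ω ≃* SoficGroup ω}
    (hΦ : ∀ s, trace ω (soficEmb ω (Φ s)) = trace ω (soficEmb ω s))
    {p : (L2 ω →L[ℂ] L2 ω) × (L2 ω →L[ℂ] L2 ω)} (hp : p ∈ graphAlg Φ) :
    ‖p.1 (oneVec ω)‖ = ‖p.2 (oneVec ω)‖ :=
  norm_eq_of_mem_graphL2 hΦ hp.2.2

theorem eq_zero_iff_of_mem_graphAlg {Φ : SoficGroup ω ≃* SoficGroup ω}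
    (hΦ : ∀ s, trace ω (soficEmb ω (Φ s)) = trace ω (soficEmb ω s))
    {p : (L2 ω →L[ℂ] L2 ω) × (L2 ω →L[ℂ] L2 ω)} (hp : p ∈ graphAlg Φ) : p.1 = 0 ↔ p.2 = 0 := by
  have h := norm_apply_oneVec_eq hΦ hp
  constructor
  · intro h1
    rw [h1, _root_.zero_apply, norm_zero] at h
    exact eq_of_apply_oneVec (WS_le_rightCommutant hp.2.1) (zero_mem _)
      (by rw [norm_eq_zero.1 h.symm, _root_.zero_apply])
  · intro h1
    rw [h1, _root_.zero_apply, norm_zero] at h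
    exact eq_of_apply_oneVec (WS_le_rightCommutant hp.1) (zero_mem _)
      (by rw [norm_eq_zero.1 h, _root_.zero_apply])

/-- The first projection of the graph. -/
noncomputable def graphFst (Φ : SoficGroup ω ≃* SoficGroup ω) :
    graphAlg Φ →⋆ₐ[ℂ] (L2 ω →L[ℂ] L2 ω) :=
  (StarAlgHom.fst ℂ (L2 ω →L[ℂ] L2 ω) (L2 ω →L[ℂ] L2 ω)).comp (graphAlg Φ).subtype

theorem graphFst_injective {Φ : SoficGroup ω ≃* SoficGroup ω}
    (hΦ : ∀ s, trace ω (soficEmb ω (Φ s)) = trace ω (soficEmb ω s)) :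
    Function.Injective (graphFst Φ) := by
  rw [injective_iff_map_eq_zero]
  intro p hp
  have h1 : p.1.1 = 0 := hp
  exact Subtype.ext (Prod.ext h1 ((eq_zero_iff_of_mem_graphAlg hΦ p.2).1 h1))

/-- An injective `⋆`-homomorphism of C⋆-algebras is isometric, so it has closed range. -/
theorem isClosed_range_graphFst {Φ : SoficGroup ω ≃* SoficGroup ω}
    (hΦ : ∀ s, trace ω (soficEmb ω (Φ s)) = trace ω (soficEmb ω s)) :
    IsClosed ((graphFst Φ).range : Set (L2 ω →L[ℂ] L2 ω)) := by
  have : IsClosed (graphAlg Φ : Set ((L2 ω →L[ℂ] L2 ω) × (L2 ω →L[ℂ] L2 ω))) := isClosed_graphAlg Φ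
  have : CompleteSpace (graphAlg Φ) := this.completeSpace_coe
  have h : Isometry (graphFst Φ) :=
    NonUnitalStarAlgHom.isometry (graphFst Φ) (graphFst_injective hΦ)
  exact h.isClosedEmbedding.isClosed_range

/-- The resolvents of the selfadjoint elements of `W*(𝒮)` have counterparts: they are limits of the
resolvents of elements of the span of `𝒮`, which are uniformly bounded. -/
theorem resolvent_mem_range_graphFst {Φ : SoficGroup ω ≃* SoficGroup ω}
    (hΦ : ∀ s, trace ω (soficEmb ω (Φ s)) = trace ω (soficEmb ω s)) {x : L2 ω →L[ℂ] L2 ω}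
    (hx : x ∈ WS ω) (hsa : star x = x) {c : L2 ω →L[ℂ] L2 ω} (hc : c ∈ WS ω)
    (hc1 : (x + algebraMap ℂ _ Complex.I) * c = 1) : c ∈ (graphFst Φ).range := by
  obtain ⟨η, hη⟩ := exists_mem_graphL2 hΦ (apply_oneVec_mem_soficL2 hx)
  obtain ⟨w', hw', hlim', -⟩ := exists_seq_of_mem_graphL2 hη
  -- selfadjoint approximants
  let w : ℕ → (L2 ω →L[ℂ] L2 ω) × (L2 ω →L[ℂ] L2 ω) := fun k =>
    (1 / 2 : ℂ) • (w' k + star (w' k))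
  have hw : ∀ k, w k ∈ graphAlg Φ := fun k => SMulMemClass.smul_mem _
    (add_mem (spanGraph_subset_graphAlg (hw' k)) (star_mem (spanGraph_subset_graphAlg (hw' k))))
  have hwsa : ∀ k, star (w k) = w k := by
    intro k
    change star ((1 / 2 : ℂ) • (w' k + star (w' k))) = (1 / 2 : ℂ) • (w' k + star (w' k))
    rw [star_smul, star_add, star_star, add_comm (star (w' k))]
    congr 1
    simp
  have hwlim : Tendsto (fun k => (w k).1 (oneVec ω)) atTop (𝓝 (x (oneVec ω))) := by
    have h1 := tendsto_star_apply_oneVec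
      (fun k => WS_le_rightCommutant (fst_mem_WS_of_mem_spanGraph (hw' k)).1)
      (WS_le_rightCommutant hx) hlim'
    rw [hsa] at h1
    have h2 := (hlim'.add h1).const_smul (1 / 2 : ℂ)
    have h3 : (1 / 2 : ℂ) • (x (oneVec ω) + x (oneVec ω)) = x (oneVec ω) := by
      rw [← two_smul ℂ, smul_smul]
      norm_num
    rw [h3] at h2
    exact h2
  choose v hv hv1 hv2 using fun k =>
    exists_resolvent (graphAlg Φ) (isClosed_graphAlg Φ) (hw k) (hwsa k)
  have hv1' : ∀ k, (v k).1 * ((w k).1 + algebraMap ℂ _ Complex.I) = 1 :=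
    fun k => congrArg Prod.fst (hv1 k)
  have hn : ∀ k, ‖(v k).1‖ ≤ 1 ∧ ‖(v k).2‖ ≤ 1 := fun k =>
    ⟨norm_resolvent_le (congrArg Prod.fst (hwsa k)) (congrArg Prod.fst (hv2 k)),
      norm_resolvent_le (congrArg Prod.snd (hwsa k)) (congrArg Prod.snd (hv2 k))⟩
  -- the resolvent identity
  have hres : ∀ k, (v k).1 - c = (v k).1 * ((x - (w k).1) * c) := by
    intro k
    calc (v k).1 - c = (v k).1 * ((x + algebraMap ℂ _ Complex.I) * c)
          - ((v k).1 * ((w k).1 + algebraMap ℂ _ Complex.I)) * c := by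
            rw [hc1, hv1', mul_one, one_mul]
      _ = (v k).1 * ((x - (w k).1) * c) := by noncomm_ring
  have hlim1 : Tendsto (fun k => (v k).1 (oneVec ω)) atTop (𝓝 (c (oneVec ω))) := by
    rw [tendsto_iff_norm_sub_tendsto_zero] at hwlim ⊢
    have h1 := hwlim.const_mul ‖c‖
    rw [mul_zero] at h1
    refine squeeze_zero (fun k => norm_nonneg _) (fun k => ?_) h1
    rw [← _root_.sub_apply, hres]
    change ‖(v k).1 ((x - (w k).1) (c (oneVec ω)))‖ ≤ _
    have h2 := norm_apply_apply_oneVec_le (WS_le_rightCommutant hc)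
      (WS_le_rightCommutant (sub_mem hx (hw k).1))
    rw [_root_.sub_apply x (w k).1 (oneVec ω), norm_sub_rev] at h2
    refine ((v k).1.le_opNorm _).trans ((mul_le_of_le_one_left (norm_nonneg _) (hn k).1).trans h2)
  have hcauchy : CauchySeq (fun k => (v k).2 (oneVec ω)) := by
    have h1 := hlim1.cauchySeq
    rw [Metric.cauchySeq_iff'] at h1 ⊢
    intro ε hε
    obtain ⟨N, hN⟩ := h1 ε hε
    refine ⟨N, fun n hn => ?_⟩
    have h2 := norm_apply_oneVec_eq hΦ (sub_mem (hv n) (hv N))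
    have h3 := hN n hn
    rw [dist_eq_norm, ← _root_.sub_apply] at h3 ⊢
    rw [← Prod.fst_sub, h2] at h3
    exact h3
  obtain ⟨ξ, hξ⟩ := cauchySeq_tendsto_of_complete hcauchy
  obtain ⟨d, hd1, hd⟩ := exists_tendsto_of_apply_oneVec
    (fun k => WS_le_rightCommutant (hv k).2.1) (fun k => (hn k).2) hξ
  refine ⟨⟨(c, d), hc, mem_vNGenerated_of_tendsto hd (Eventually.of_forall fun k => (hv k).2.1), ?_⟩,
    rfl⟩
  rw [evalOne_apply, hd1]
  exact (isClosed_graphL2 Φ).mem_of_tendsto (hlim1.prodMk_nhds hξ)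
    (Eventually.of_forall fun k => (hv k).2.2)

/-- Every element of `W*(𝒮)` has a counterpart. -/
theorem exists_mem_graphAlg {Φ : SoficGroup ω ≃* SoficGroup ω}
    (hΦ : ∀ s, trace ω (soficEmb ω (Φ s)) = trace ω (soficEmb ω s)) {x : L2 ω →L[ℂ] L2 ω}
    (hx : x ∈ WS ω) : ∃ y, (x, y) ∈ graphAlg Φ := by
  have hsa : ∀ x ∈ WS ω, star x = x → x ∈ (graphFst Φ).range := by
    intro x hx hsa
    obtain ⟨c, hc, hc1, hc2⟩ := exists_resolvent (WS ω) (isClosed_norm_vNGenerated _) hx hsa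
    have h1 := resolvent_mem_range_graphFst hΦ hx hsa hc hc2
    -- the range is a closed subalgebra, so it contains the inverse of the resolvent
    have hcl : IsClosed ((graphFst Φ).range : Set (L2 ω →L[ℂ] L2 ω)) := isClosed_range_graphFst hΦ
    have h2 : IsUnit (⟨c, h1⟩ : (graphFst Φ).range) :=
      ((graphFst Φ).range.coe_isUnit (a := ⟨c, h1⟩)).1 ⟨⟨c, _, hc1, hc2⟩, rfl⟩
    obtain ⟨u, hu⟩ := h2
    have hu1 : u.1.1 = c := congrArg Subtype.val hu
    have h3 : u⁻¹.1.1 = x + algebraMap ℂ _ Complex.I := by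
      have h4 : u⁻¹.1.1 * c = 1 := by
        rw [← hu1]
        exact congrArg Subtype.val u.inv_mul
      exact left_inv_eq_right_inv h4 hc1
    have h5 : x = u⁻¹.1.1 - algebraMap ℂ _ Complex.I := by rw [h3, add_sub_cancel_right]
    rw [h5]
    exact sub_mem u⁻¹.1.2 (algebraMap_mem _ _)
  have h1 := hsa (x + star x) (add_mem hx (star_mem hx)) (by rw [star_add, star_star, add_comm])
  have h2 := hsa (Complex.I • (x - star x))
    (SMulMemClass.smul_mem _ (sub_mem hx (star_mem hx))) (by
      rw [star_smul, star_sub, star_star, ← neg_sub x, smul_neg, ← neg_smul]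
      congr 1
      simp)
  have h3 : x = (1 / 2 : ℂ) • (x + star x) + (-Complex.I / 2) • (Complex.I • (x - star x)) := by
    rw [smul_smul, show -Complex.I / 2 * Complex.I = 1 / 2 by
      rw [div_mul_eq_mul_div, neg_mul, Complex.I_mul_I, neg_neg], ← smul_add, add_add_sub_cancel,
      ← two_smul ℂ x, smul_smul]
    norm_num
  have h4 : x ∈ (graphFst Φ).range := by
    rw [h3]
    exact add_mem (SMulMemClass.smul_mem _ h1) (SMulMemClass.smul_mem _ h2)
  obtain ⟨p, hp⟩ := h4
  have hp1 : p.1.1 = x := hp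
  refine ⟨p.1.2, ?_⟩
  rw [← hp1]
  exact p.2

end GraphAlg

/-! ### The extension of an automorphism to the von Neumann algebra -/

section Extension

variable {ω : Ultrafilter ℕ} {Φ : SoficGroup ω ≃* SoficGroup ω}

theorem snd_unique_of_mem_graphAlg
    (hΦ : ∀ s, trace ω (soficEmb ω (Φ s)) = trace ω (soficEmb ω s)) {x y z : L2 ω →L[ℂ] L2 ω}
    (hy : (x, y) ∈ graphAlg Φ) (hz : (x, z) ∈ graphAlg Φ) : y = z :=
  sub_eq_zero.1 ((eq_zero_iff_of_mem_graphAlg hΦ (sub_mem hy hz)).1 (sub_self x))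

theorem trace_symm (hΦ : ∀ s, trace ω (soficEmb ω (Φ s)) = trace ω (soficEmb ω s))
    (s : SoficGroup ω) : trace ω (soficEmb ω (Φ.symm s)) = trace ω (soficEmb ω s) := by
  rw [← hΦ, MulEquiv.apply_symm_apply]

theorem soficEmb_mem_graphAlg (Φ : SoficGroup ω ≃* SoficGroup ω) (s : SoficGroup ω) :
    (soficEmb ω s, soficEmb ω (Φ s)) ∈ graphAlg Φ :=
  spanGraph_subset_graphAlg (Submodule.subset_span ⟨s, rfl⟩)

theorem oneVec_mem_graphL2 (Φ : SoficGroup ω ≃* SoficGroup ω) :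
    (oneVec ω, oneVec ω) ∈ graphL2 Φ := by
  have h := mem_graphL2 Φ 1
  rw [map_one, map_one, map_one] at h
  exact h

theorem trace_eq_of_mem_graphAlg
    (hΦ : ∀ s, trace ω (soficEmb ω (Φ s)) = trace ω (soficEmb ω s))
    {p : (L2 ω →L[ℂ] L2 ω) × (L2 ω →L[ℂ] L2 ω)} (hp : p ∈ graphAlg Φ) :
    trace ω p.1 = trace ω p.2 :=
  inner_eq_of_mem_graphL2 hΦ (oneVec_mem_graphL2 Φ) hp.2.2

theorem norm_snd_le_of_mem_graphAlg
    (hΦ : ∀ s, trace ω (soficEmb ω (Φ s)) = trace ω (soficEmb ω s))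
    {p : (L2 ω →L[ℂ] L2 ω) × (L2 ω →L[ℂ] L2 ω)} (hp : p ∈ graphAlg Φ) : ‖p.2‖ ≤ ‖p.1‖ := by
  have : IsClosed (graphAlg Φ : Set ((L2 ω →L[ℂ] L2 ω) × (L2 ω →L[ℂ] L2 ω))) := isClosed_graphAlg Φ
  have h : ‖graphFst Φ ⟨p, hp⟩‖ = ‖(⟨p, hp⟩ : graphAlg Φ)‖ :=
    NonUnitalStarAlgHom.norm_map (graphFst Φ) (graphFst_injective hΦ) _
  exact (norm_snd_le p).trans_eq h.symm

/-- The passage to the counterpart is continuous in the weak operator topology on the unit ball. By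
commutation with the right multiplications, the matrix coefficients of an element `T` of `W*(𝒮)` at
the vectors given by bounded sequences are of the form `⟪η, T 1̂⟫`, where `η` may be replaced by its
projection to `soficL2 ω`, and the isometry of `L²` carries this to a coefficient of the
counterpart. -/
theorem tendsto_inner_snd (hΦ : ∀ s, trace ω (soficEmb ω (Φ s)) = trace ω (soficEmb ω s))
    {ι : Type*} {l : Filter ι} {T : ι → (L2 ω →L[ℂ] L2 ω) × (L2 ω →L[ℂ] L2 ω)}
    (hT : ∀ i, T i ∈ graphAlg Φ) (hT1 : ∀ᶠ i in l, ‖(T i).1‖ ≤ 1)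
    {S : (L2 ω →L[ℂ] L2 ω) × (L2 ω →L[ℂ] L2 ω)} (hS : S ∈ graphAlg Φ)
    (h : ∀ v w, Tendsto (fun i => ⟪v, (T i).1 w⟫_ℂ) l (𝓝 ⟪v, S.1 w⟫_ℂ)) (v w : L2 ω) :
    Tendsto (fun i => ⟪v, (T i).2 w⟫_ℂ) l (𝓝 ⟪v, S.2 w⟫_ℂ) := by
  refine tendsto_inner_of_dense (C := 1)
    (hT1.mono fun i hi => (norm_snd_le_of_mem_graphAlg hΦ (hT i)).trans hi) dense_range_vec ?_ v w
  rintro v - _ ⟨z, rfl⟩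
  obtain ⟨ξ, hξ⟩ := exists_mem_graphL2 (trace_symm hΦ)
    (Submodule.starProjection_apply_mem (soficL2 ω) (rightMul ω (star z) v))
  have key : ∀ p ∈ graphAlg Φ, ⟪ξ, p.1 (oneVec ω)⟫_ℂ = ⟪v, p.2 (vec ω z)⟫_ℂ := by
    intro p hp
    refine (inner_eq_of_mem_graphL2 hΦ (swap_mem_graphL2 hξ) hp.2.2).trans ?_
    rw [apply_vec_of_mem (WS_le_rightCommutant hp.2.1)]
    change ⟪(soficL2 ω).starProjection (rightMul ω (star z) v), p.2 (oneVec ω)⟫_ℂ = _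
    rw [Submodule.inner_starProjection_left_eq_right,
      Submodule.starProjection_eq_self_iff.2 (apply_oneVec_mem_soficL2 hp.2.1),
      inner_rightMul_left, star_star]
  rw [← key S hS]
  exact (h ξ (oneVec ω)).congr fun i => key _ (hT i)

/-- The extension of a trace preserving automorphism `Φ` of the universal sofic group to
`W*(𝒮)`, given by its graph `graphAlg Φ`. -/
theorem exists_extension (hΦ : ∀ s, trace ω (soficEmb ω (Φ s)) = trace ω (soficEmb ω s)) :
    ∃ Θ : WS ω ≃⋆ₐ[ℂ] WS ω, ∀ x : WS ω,
      ((x : L2 ω →L[ℂ] L2 ω), (Θ x : L2 ω →L[ℂ] L2 ω)) ∈ graphAlg Φ := by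
  let f₁ : graphAlg Φ →⋆ₐ[ℂ] WS ω := StarAlgHom.codRestrict
    ((StarAlgHom.fst ℂ (L2 ω →L[ℂ] L2 ω) (L2 ω →L[ℂ] L2 ω)).comp (graphAlg Φ).subtype) (WS ω)
    fun p => p.2.1
  let f₂ : graphAlg Φ →⋆ₐ[ℂ] WS ω := StarAlgHom.codRestrict
    ((StarAlgHom.snd ℂ (L2 ω →L[ℂ] L2 ω) (L2 ω →L[ℂ] L2 ω)).comp (graphAlg Φ).subtype) (WS ω)
    fun p => p.2.2.1
  have h₁ : Function.Bijective f₁ := by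
    refine ⟨(injective_iff_map_eq_zero f₁).2 fun p hp => ?_, fun x => ?_⟩
    · have h1 : p.1.1 = 0 := congrArg Subtype.val hp
      exact Subtype.ext (Prod.ext h1 ((eq_zero_iff_of_mem_graphAlg hΦ p.2).1 h1))
    · obtain ⟨y, hy⟩ := exists_mem_graphAlg hΦ x.2
      exact ⟨⟨_, hy⟩, rfl⟩
  have h₂ : Function.Bijective f₂ := by
    refine ⟨(injective_iff_map_eq_zero f₂).2 fun p hp => ?_, fun x => ?_⟩
    · have h1 : p.1.2 = 0 := congrArg Subtype.val hp
      exact Subtype.ext (Prod.ext ((eq_zero_iff_of_mem_graphAlg hΦ p.2).2 h1) h1)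
    · obtain ⟨y, hy⟩ := exists_mem_graphAlg (trace_symm hΦ) x.2
      exact ⟨⟨_, swap_mem_graphAlg hy⟩, rfl⟩
  refine ⟨(StarAlgEquiv.ofBijective f₁ h₁).symm.trans (StarAlgEquiv.ofBijective f₂ h₂), fun x => ?_⟩
  obtain ⟨p, rfl⟩ := h₁.2 x
  have h3 : (StarAlgEquiv.ofBijective f₁ h₁).symm (f₁ p) = p :=
    (StarAlgEquiv.ofBijective f₁ h₁).symm_apply_apply p
  rw [StarAlgEquiv.trans_apply, h3]
  exact p.2

theorem isNormalMap_of_graph (hΦ : ∀ s, trace ω (soficEmb ω (Φ s)) = trace ω (soficEmb ω s))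
    {Θ : WS ω → WS ω} (hΘ : ∀ x : WS ω,
      ((x : L2 ω →L[ℂ] L2 ω), (Θ x : L2 ω →L[ℂ] L2 ω)) ∈ graphAlg Φ) : IsNormalMap Θ := by
  intro x _
  have h1 : ∀ y : WS ω, @nhds _ (TopologicalSpace.induced Subtype.val (wot (L2 ω))) y
      = comap Subtype.val (@nhds _ (wot (L2 ω)) y.1) := fun y =>
    @nhds_induced _ _ (wot (L2 ω)) Subtype.val y
  unfold ContinuousWithinAt nhdsWithin
  rw [h1, h1, tendsto_comap_iff]
  have h2 : ∀ v w, Tendsto (fun y : WS ω => ⟪v, y.1 w⟫_ℂ)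
      (comap Subtype.val (@nhds _ (wot (L2 ω)) x.1) ⊓ 𝓟 {x : WS ω | ‖x.1‖ ≤ 1})
      (𝓝 ⟪v, x.1 w⟫_ℂ) :=
    tendsto_wot_iff.1 (tendsto_comap.mono_left inf_le_left)
  have h3 := tendsto_inner_snd hΦ (T := fun y : WS ω => (y.1, (Θ y).1)) hΘ
    (mem_inf_of_right (mem_principal_self _)) (S := (x.1, (Θ x).1)) (hΘ x) h2
  exact tendsto_wot_iff.2 h3

/-- A trace preserving `⋆`-homomorphism that extends `Φ` is isometric for the `2`-norm, so that its
graph is contained in `graphAlg Φ`. -/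
theorem mem_graphAlg_of_extends (hΦ : ∀ s, trace ω (soficEmb ω (Φ s)) = trace ω (soficEmb ω s))
    {Ψ : WS ω →⋆ₐ[ℂ] WS ω} (hτ : ∀ x : WS ω, trace ω (Ψ x) = trace ω x)
    (hΨ : ∀ s, Ψ (soficToWS ω s) = soficToWS ω (Φ s)) (x : WS ω) :
    ((x : L2 ω →L[ℂ] L2 ω), (Ψ x : L2 ω →L[ℂ] L2 ω)) ∈ graphAlg Φ := by
  have hsq : ∀ T : L2 ω →L[ℂ] L2 ω, ((‖T (oneVec ω)‖ ^ 2 : ℝ) : ℂ) = trace ω (star T * T) := by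
    intro T
    rw [trace, ContinuousLinearMap.star_eq_adjoint]
    change _ = ⟪oneVec ω, ContinuousLinearMap.adjoint T (T (oneVec ω))⟫_ℂ
    rw [ContinuousLinearMap.adjoint_inner_right, inner_self_eq_norm_sq_to_K]
    push_cast
    rfl
  have hiso : ∀ z : WS ω, ‖(Ψ z : L2 ω →L[ℂ] L2 ω) (oneVec ω)‖
      = ‖(z : L2 ω →L[ℂ] L2 ω) (oneVec ω)‖ := by
    intro z
    have h1 := hτ (star z * z)
    rw [map_mul, map_star] at h1
    have h2 : ((‖(Ψ z : L2 ω →L[ℂ] L2 ω) (oneVec ω)‖ ^ 2 : ℝ) : ℂ)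
        = ((‖(z : L2 ω →L[ℂ] L2 ω) (oneVec ω)‖ ^ 2 : ℝ) : ℂ) := by
      rw [hsq, hsq]
      exact h1
    exact (pow_left_inj₀ (norm_nonneg _) (norm_nonneg _) two_ne_zero).1 (Complex.ofReal_injective h2)
  have hspan : ∀ w ∈ spanGraph Φ, ∀ hw : w.1 ∈ WS ω, (Ψ ⟨w.1, hw⟩ : L2 ω →L[ℂ] L2 ω) = w.2 := by
    intro w hw
    induction hw using Submodule.span_induction with
    | mem w hw =>
      obtain ⟨s, rfl⟩ := hw
      exact fun _ => congrArg Subtype.val (hΨ s)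
    | zero => exact fun _ => congrArg Subtype.val (map_zero Ψ)
    | add a b ha hb iha ihb =>
      intro _
      have ha1 := (fst_mem_WS_of_mem_spanGraph ha).1
      have hb1 := (fst_mem_WS_of_mem_spanGraph hb).1
      rw [Prod.snd_add, ← iha ha1, ← ihb hb1]
      exact congrArg Subtype.val (map_add Ψ ⟨a.1, ha1⟩ ⟨b.1, hb1⟩)
    | smul c a ha iha =>
      intro _
      have ha1 := (fst_mem_WS_of_mem_spanGraph ha).1
      rw [Prod.smul_snd, ← iha ha1]
      exact congrArg Subtype.val (map_smul Ψ c ⟨a.1, ha1⟩)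
  refine ⟨x.2, (Ψ x).2, ?_⟩
  obtain ⟨η, hη⟩ := exists_mem_graphL2 hΦ (apply_oneVec_mem_soficL2 x.2)
  obtain ⟨w, hw, h1, -⟩ := exists_seq_of_mem_graphL2 hη
  have hw1 := fun k => (fst_mem_WS_of_mem_spanGraph (hw k)).1
  have h2 : Tendsto (fun k => (w k).2 (oneVec ω)) atTop
      (𝓝 ((Ψ x : L2 ω →L[ℂ] L2 ω) (oneVec ω))) := by
    rw [tendsto_iff_norm_sub_tendsto_zero] at h1 ⊢
    refine h1.congr fun k => ?_
    rw [← hspan _ (hw k) (hw1 k), ← _root_.sub_apply]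
    have h3 := hiso (⟨_, hw1 k⟩ - x)
    rw [map_sub] at h3
    exact h3.symm
  exact (isClosed_graphL2 Φ).mem_of_tendsto (h1.prodMk_nhds h2)
    (Eventually.of_forall fun k => evalOne_mem_graphL2 (hw k))

/-- The counterpart of a projection of the Loeb algebra is again a projection of the Loeb algebra:
both are limits of powers, of an element `ψ` and of `Φ ψ`, and the latter has powers of constant
trace since `Φ` preserves the trace. -/
theorem exists_indSeq_mem_graphAlg (hω : (ω : Filter ℕ) ≤ atTop)
    (hΦ : ∀ s, trace ω (soficEmb ω (Φ s)) = trace ω (soficEmb ω s)) (A : ∀ n : ℕ, Finset (Fin n)) :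
    ∃ B, (leftMul ω (indSeq A), leftMul ω (indSeq B)) ∈ graphAlg Φ := by
  obtain ⟨ψ, hψ, hlim⟩ := exists_tendsto_pow hω A
  obtain ⟨g, hg⟩ := QuotientGroup.mk_surjective (Φ ψ)
  obtain ⟨y, hy⟩ := exists_mem_graphAlg hΦ (indSeq_mem_WS hω A)
  have h1 := tendsto_pow_of_trace_pow (ω := ω) g fun k hk => by
    rw [hg, ← map_pow, hΦ, hΦ, trace_soficEmb hω, trace_soficEmb hω, hψ k hk]
  have h2 := tendsto_inner_snd hΦ (T := fun k : ℕ => (soficEmb ω ψ, soficEmb ω (Φ ψ)) ^ k)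
    (fun k => pow_mem (soficEmb_mem_graphAlg Φ ψ) k) (l := atTop)
    (Eventually.of_forall fun k => by
      rw [Prod.pow_fst, ← map_pow]
      exact norm_soficEmb_le _) hy hlim
  have h3 : y = leftMul ω (indSeq (fixSet g)) := by
    refine ContinuousLinearMap.ext fun w => ext_inner_left ℂ fun v => ?_
    have h4 := h1 v w
    rw [hg] at h4
    exact tendsto_nhds_unique (h2 v w) h4
  exact ⟨fixSet g, h3 ▸ hy⟩

theorem snd_mem_loebAlgebra (hω : (ω : Filter ℕ) ≤ atTop)
    (hΦ : ∀ s, trace ω (soficEmb ω (Φ s)) = trace ω (soficEmb ω s)) {x y : L2 ω →L[ℂ] L2 ω}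
    (h : (x, y) ∈ graphAlg Φ) (hx : x ∈ loebAlgebra ω) : y ∈ loebAlgebra ω := by
  have key : ∀ z ∈ Submodule.span ℂ (Set.range fun A => leftMul ω (dyadicSeq A)),
      ∃ u ∈ loebAlgebra ω, (z, u) ∈ graphAlg Φ := by
    intro z hz
    induction hz using Submodule.span_induction with
    | mem z hz =>
      obtain ⟨A, rfl⟩ := hz
      choose B hB using fun k => exists_indSeq_mem_graphAlg hω hΦ (A k)
      refine ⟨leftMul ω (dyadicSeq B), mem_loebAlgebra_iff.2 ⟨_, _, rfl⟩, ?_⟩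
      refine (isClosed_graphAlg Φ).mem_of_tendsto
        ((tendsto_dyadicSeq A).prodMk_nhds (tendsto_dyadicSeq B)) (Eventually.of_forall fun K => ?_)
      have h1 : ∑ k ∈ Finset.range K, ((1 / 2 : ℂ) ^ (k + 1)) •
          (leftMul ω (indSeq (A k)), leftMul ω (indSeq (B k))) ∈ graphAlg Φ :=
        sum_mem fun k _ => SMulMemClass.smul_mem _ (hB k)
      simp only [Prod.smul_mk] at h1
      rw [← prod_mk_sum] at h1
      exact h1
    | zero => exact ⟨0, zero_mem _, zero_mem _⟩
    | add a b _ _ iha ihb =>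
      obtain ⟨u, hu, hu1⟩ := iha
      obtain ⟨v, hv, hv1⟩ := ihb
      exact ⟨u + v, add_mem hu hv, add_mem hu1 hv1⟩
    | smul c a _ iha =>
      obtain ⟨u, hu, hu1⟩ := iha
      exact ⟨c • u, SMulMemClass.smul_mem _ hu, SMulMemClass.smul_mem c hu1⟩
  obtain ⟨u, hu, hu1⟩ := key x (loebAlgebra_le_span hx)
  rwa [snd_unique_of_mem_graphAlg hΦ h hu1]

end Extension

end UniversalSofic

theorem mainTheorem2 (ω : Ultrafilter ℕ) (hω : ∀ n : ℕ, ω ≠ pure n) :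
    (∀ p ∈ UniversalSofic.loebAlgebra ω, IsStarProjection p →
      ∃ ψ : UniversalSofic.SoficGroup ω,
        Filter.Tendsto
          (fun k : ℕ => ContinuousLinearMapWOT.ofCLM (UniversalSofic.soficEmb ω ψ ^ k))
          Filter.atTop (nhds (ContinuousLinearMapWOT.ofCLM p))) ∧
    UniversalSofic.loebAlgebra ω ≤ UniversalSofic.WS ω ∧
    ∀ Φ : UniversalSofic.SoficGroup ω ≃* UniversalSofic.SoficGroup ω,
      ∃ Θ : UniversalSofic.WS ω ≃⋆ₐ[ℂ] UniversalSofic.WS ω,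
        UniversalSofic.IsNormalMap Θ ∧
        (∀ x : UniversalSofic.WS ω,
          UniversalSofic.trace ω (Θ x) = UniversalSofic.trace ω x) ∧
        (∀ s : UniversalSofic.SoficGroup ω,
          Θ (UniversalSofic.soficToWS ω s) = UniversalSofic.soficToWS ω (Φ s)) ∧
        (∀ Ψ : UniversalSofic.WS ω →⋆ₐ[ℂ] UniversalSofic.WS ω,
          (∀ x : UniversalSofic.WS ω,
            UniversalSofic.trace ω (Ψ x) = UniversalSofic.trace ω x) →
          (∀ s : UniversalSofic.SoficGroup ω,
            Ψ (UniversalSofic.soficToWS ω s) = UniversalSofic.soficToWS ω (Φ s)) →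
          ∀ x : UniversalSofic.WS ω, Ψ x = Θ x) ∧
        Θ '' {x : UniversalSofic.WS ω |
            (x : UniversalSofic.L2 ω →L[ℂ] UniversalSofic.L2 ω) ∈ UniversalSofic.loebAlgebra ω} =
          {x : UniversalSofic.WS ω |
            (x : UniversalSofic.L2 ω →L[ℂ] UniversalSofic.L2 ω) ∈ UniversalSofic.loebAlgebra ω} := by
  have hω' := UniversalSofic.le_atTop_of_ne_pure hω
  refine ⟨fun p hp hpp => ?_, UniversalSofic.loebAlgebra_le_WS hω', fun Φ => ?_⟩
  · obtain ⟨f, hf, rfl⟩ := UniversalSofic.mem_loebAlgebra_iff.1 hp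
    obtain ⟨A, hA⟩ := UniversalSofic.exists_indSeq_eq hpp.isIdempotentElem
    obtain ⟨ψ, -, hψ⟩ := UniversalSofic.exists_tendsto_pow hω' A
    refine ⟨ψ, ContinuousLinearMapWOT.tendsto_iff_forall_inner_apply_tendsto.2 fun w v => ?_⟩
    rw [← hA]
    exact hψ v w
  · have hΦ := UniversalSofic.trace_map hω' Φ
    obtain ⟨Θ, hΘ⟩ := UniversalSofic.exists_extension hΦ
    refine ⟨Θ, UniversalSofic.isNormalMap_of_graph hΦ hΘ,
      fun x => (UniversalSofic.trace_eq_of_mem_graphAlg hΦ (hΘ x)).symm,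
      fun s => Subtype.ext (UniversalSofic.snd_unique_of_mem_graphAlg hΦ (hΘ _)
        (UniversalSofic.soficEmb_mem_graphAlg Φ s)),
      fun Ψ hτ hΨ x => Subtype.ext (UniversalSofic.snd_unique_of_mem_graphAlg hΦ
        (UniversalSofic.mem_graphAlg_of_extends hΦ hτ hΨ x) (hΘ x)), ?_⟩
    refine Set.Subset.antisymm ?_ fun y hy => ?_
    · rintro _ ⟨x, hx, rfl⟩
      exact UniversalSofic.snd_mem_loebAlgebra hω' hΦ (hΘ x) hx
    · obtain ⟨x, rfl⟩ := Θ.surjective y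
      -- the inverse of `Θ` has the graph given by the inverse of `Φ`
      exact ⟨x, UniversalSofic.snd_mem_loebAlgebra hω' (UniversalSofic.trace_symm hΦ)
        (UniversalSofic.swap_mem_graphAlg (Φ := Φ.symm) (hΘ x)) hy, rfl⟩
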